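/- Let $V$ be a finite-dimensional complex vector space, $W\subset GL(V)$ a finite group, $\Gamma\subset V$ a $W$-stable lattice, and $X=V/\Gamma$. A reflection of $W$ is a nontrivial semisimple element fixing a hyperplane pointwise; a reflection hypertorus is a connected component of $X^g=\{x\in X: gx=x\}$ for a reflection $g\in W$ (these components all have codimension one); $X_{\rm reg}$ is the complement of all reflection hypertori. For a hypertorus $H$ let $W_H$ be the (cyclic) stabilizer of a generic point of $H$, $n_H=|W_H|$, $g_H\in W_H$ the element with $\det g_H=e^{2\pi i/n_H}$, and $V_H^*\subset V^*$ the line of functionals vanishing on $V^{g_H}$. Let $S$ be the set of pairs $(H,j)$ with $1\le j\le n_H-1$, and let $C:S\to\mathbb C$ be $W$-invariant for $g(H,j)=(gH,j)$. Let $V^\vee$ be the space of antilinear forms on $V$, with $(w\alpha)(v)=\alpha(w^{-1}v)$, $\omega(\alpha,v)=\operatorname{Im}\alpha(v)$, and $\Gamma^\vee=\{\alpha\in V^\vee:\omega(\alpha,\Gamma)\subset\mathbb Z\}$. For $\alpha\in V^\vee$ put $\chi_\alpha(\gamma)=e^{2\pi i\,\omega(\alpha,\gamma)}$, and let $\mathcal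 L_\alpha$ be the line bundle on $X$ obtained from $V\times\mathbb C$ by dividing by $\gamma:(z,\xi)\mapsto(z+\gamma,\chi_\alpha(\gamma)\xi)$, so that $\mathcal L_\alpha^*=\mathcal L_{-\alpha}$; put $(\mathcal L_\alpha)^w=\mathcal L_{w\alpha}$ for $w\in W$. Fix $\alpha$ with $w\alpha-\alpha\notin\Gamma^\vee$ for all $w\in W$, $w\neq1$, write $\mathcal L=\mathcal L_\alpha$, and fix a flat holomorphic connection $\nabla$ on $\mathcal L$; denote also by $\nabla$ the connections on the bundles $\mathcal L^w$ obtained from it by the action of $w$, and the dual connections on $(\mathcal L^*)^w=(\mathcal L^w)^*$. (1) For all $w\in W$ and $(H,j)\in S$, with $\mathcal M=\mathcal L^w$ and $g=g_H^j$, there is a unique meromorphic section $f^{\mathcal M}_{H,j}$ of $(\mathcal M^{g})^*\otimes\mathcal M\otimes V_H^*$ whose only singularity is a simple pole on $H$, with Poincaré residue $1$ on $H$. (Here $(\mathcal M^g)^*\otimes\mathcal M$ is trivialized on $H$ by $(\mathcal M^g)_x=\mathcal M_{g^{-1}x}=\mathcal M_x$ for $x\in H$.) For $g\in W$ put $F^{\mathcal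 M}_{C,g}=\sum_{(H,j)\in S:\,g_H^j=g}C(H,j)f^{\mathcal M}_{H,j}$. (2) Let $\mathcal F=\bigoplus_{w\in W}(\mathcal L^*)^w$. For every $W$-invariant open $U\subset X$ let $\mathcal O(U)$, $D(U)$, $\mathcal F(U)$ be the holomorphic functions on $U\cap X_{\rm reg}$, the differential operators of finite order on $U\cap X_{\rm reg}$ (that is, the algebra generated by $\mathcal O(U)$ and the vector fields $\partial_v$, $v\in V$), and the sections of $\mathcal F$ over $U\cap X_{\rm reg}$, in each case with at most poles along the reflection hypertori in $U$; for $U\subset X_{\rm reg}$ these are just the holomorphic functions, holomorphic differential operators and holomorphic sections on $U$. Then there is a unique homomorphism of $\mathbb C$-algebras $$\rho=\rho_U:\ W\ltimes D(U)\to\operatorname{End}_{\mathbb C}\mathcal F(U)$$ such that for every section $\beta$ of $(\mathcal L^*)^w$ $$(\rho(g)\beta)(x)=\beta(g^{-1}x)\ \text{ (a section of }(\mathcal L^*)^{gw}),\qquad \rho(f)\beta=f\beta,\qquad \rho(\partial_v)\beta=\Bigl(\nabla_v+\sum_{g\in W}\langle F^{\mathcal L^w}_{C,g},v\rangle\Bigr)\beta$$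 for all $g\in W$, $f\in\mathcal O(U)$, $v\in V$, where $\langle F^{\mathcal L^w}_{C,g},v\rangle\beta$ is a section of $(\mathcal L^*)^{gw}$. (3) The $\rho_U$ are compatible with restriction to $W$-invariant open subsets $U'\subset U$. Thus these formulas define a representation of the sheaf of algebras $W\ltimes D_{X_{\rm reg}}$ on $\mathcal F|_{X_{\rm reg}}$. -/

import Mathlib

open Topology

noncomputable section

/-- A finite group `W ⊂ GL(V)` together with a `W`-stable lattice `Γ ⊂ V`
(a discrete subgroup spanning `V` over `ℝ`). -/
structure TorusAction (V : Type*) [NormedAddCommGroup V] [NormedSpace ℂ V] where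
  W : Subgroup (V ≃ₗ[ℂ] V)
  finite : Finite W
  Γ : Submodule ℤ V
  discrete : DiscreteTopology Γ
  lattice : IsZLattice ℝ Γ
  smul_mem : ∀ g ∈ W, ∀ γ ∈ Γ, g γ ∈ Γ

namespace TorusAction

variable {V : Type*} [NormedAddCommGroup V] [NormedSpace ℂ V]

attribute [instance] TorusAction.finite TorusAction.discrete TorusAction.lattice

section Geometry

variable (T : TorusAction V)

/-- The complex torus `X = V / Γ`, with its quotient topology. -/
abbrev X : Type _ := V ⧸ T.Γ

/-- The projection `V → X`. -/
abbrev proj : V → T.X := Submodule.Quotient.mk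

/-- An element of `W` as a linear map. -/
abbrev lin (g : T.W) : V →ₗ[ℂ] V := ((g : V ≃ₗ[ℂ] V) : V →ₗ[ℂ] V)

/-- The action of `g ∈ W` on the torus `X`. -/
def act (g : T.W) : T.X → T.X :=
  Submodule.mapQ T.Γ T.Γ ((T.lin g).restrictScalars ℤ) (fun γ hγ => T.smul_mem g g.2 γ hγ)

/-- Reflections: nontrivial semisimple elements whose fixed space is a hyperplane. -/
def IsReflection (g : T.W) : Prop :=
  g ≠ 1 ∧ Module.End.IsSemisimple (T.lin g) ∧
    Module.finrank ℂ (LinearMap.ker (T.lin g - 1)) + 1 = Module.finrank ℂ V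

/-- `X^g`, the fixed points of `g` on the torus. -/
def fixedPts (g : T.W) : Set T.X := {x | T.act g x = x}

/-- Reflection hypertori: the connected components of `X^g`, where `g ∈ W` is a reflection.
They are cosets of the image of the hyperplane `V^g`, hence all of codimension one. -/
def IsHypertorus (H : Set T.X) : Prop :=
  ∃ g : T.W, T.IsReflection g ∧ ∃ x ∈ T.fixedPts g, H = connectedComponentIn (T.fixedPts g) x

/-- `X_reg`, the complement of the reflection hypertori. -/
def reg : Set T.X := {x | ∀ H, T.IsHypertorus H → x ∉ H}

/-- `W_H`, the stabilizer of a generic point of `H`; since only finitely many proper closed subsets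
of `H` are of the form `H ∩ X^g`, this is the pointwise stabilizer of `H`. -/
def stab (H : Set T.X) : Subgroup T.W where
  carrier := {g | ∀ z : V, T.proj z ∈ H → T.proj (g • z) = T.proj z}
  one_mem' := by intro z _; simp
  mul_mem' := by
    intro a b ha hb z hz
    have h1 := hb z hz
    have h2 := ha (b • z) (by rw [h1]; exact hz)
    rw [mul_smul, h2, h1]
  inv_mem' := by
    intro a ha z hz
    have h1 := ha z hz
    rw [Submodule.Quotient.eq] at h1 ⊢
    have h2 := T.smul_mem (a⁻¹ : T.W) (a⁻¹ : T.W).2 _ h1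
    have h3 : ((a⁻¹ : T.W) : V ≃ₗ[ℂ] V) (a • z - z) = z - a⁻¹ • z := by
      change a⁻¹ • (a • z - z) = _
      rw [smul_sub, inv_smul_smul]
    rw [h3] at h2
    simpa using T.Γ.neg_mem h2

/-- `n_H`, the order of the cyclic group `W_H`. -/
def ord (H : Set T.X) : ℕ := Nat.card (T.stab H)

/-- `g_H`, the element of `W_H` with determinant `exp (2πi / n_H)`. -/
def gen (H : Set T.X) : T.W :=
  Classical.epsilon fun g : T.W =>
    g ∈ T.stab H ∧ LinearMap.det (T.lin g) = Complex.exp (2 * Real.pi * Complex.I / T.ord H)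

/-- The set `S` of pairs `(H, j)`, `H` a reflection hypertorus and `1 ≤ j ≤ n_H - 1`. -/
abbrev S : Type _ := {p : Set T.X × ℕ // T.IsHypertorus p.1 ∧ 1 ≤ p.2 ∧ p.2 < T.ord p.1}

/-- The element `g_H ^ j` attached to `(H, j) ∈ S`. -/
def elt (p : T.S) : T.W := T.gen p.1.1 ^ p.1.2

/-- `W`-invariance of a function on `S`, for the action `g (H, j) = (g H, j)`. -/
def IsInvariant (C : T.S → ℂ) : Prop :=
  ∀ (g : T.W) (p q : T.S), q.1.1 = T.act g '' p.1.1 → q.1.2 = p.1.2 → C q = C p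

/-- `W`-invariant open subsets `U` of `X` (that is, preimages of open subsets of `X / W`). -/
structure InvOpen where
  carrier : Set T.X
  isOpen : IsOpen carrier
  act_mem : ∀ (g : T.W), ∀ x ∈ carrier, T.act g x ∈ carrier

variable {T}

/-- The preimage in `V` of `U ∩ X_reg`. -/
def dom (U : T.InvOpen) : Set V := {z | T.proj z ∈ U.carrier ∧ T.proj z ∈ T.reg}

end Geometry

section GeometryLemmas

variable {T : TorusAction V}

lemma act_proj (g : T.W) (z : V) : T.act g (T.proj z) = T.proj (g • z) := rfl

lemma gamma_smul_mem (g : T.W) {γ : V} (hγ : γ ∈ T.Γ) : g • γ ∈ T.Γ := T.smul_mem g g.2 γ hγ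

lemma mem_reg_iff (x : T.X) : x ∈ T.reg ↔ ∀ g, T.IsReflection g → x ∉ T.fixedPts g := by
  constructor
  · intro h g hg hx
    exact h _ ⟨g, hg, x, hx, rfl⟩ (mem_connectedComponentIn hx)
  · rintro h H ⟨g, hg, y, hy, rfl⟩ hx
    exact h g hg (connectedComponentIn_subset _ _ hx)

lemma isReflection_conj (h g : T.W) (hg : T.IsReflection g) : T.IsReflection (h * g * h⁻¹) := by
  obtain ⟨h1, h2, h3⟩ := hg
  refine ⟨?_, ?_, ?_⟩
  · intro hh
    apply h1
    rwa [mul_inv_eq_one, mul_eq_left] at hh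
  · refine (LinearEquiv.isSemisimple_iff (f := T.lin g) (g := T.lin (h * g * h⁻¹))
      (h : V ≃ₗ[ℂ] V) ?_).1 h2
    ext z
    change h • (g • z) = (h * g * h⁻¹) • (h • z)
    simp [mul_smul]
  · rw [← h3]
    congr 1
    refine (LinearEquiv.finrank_eq (LinearEquiv.ofSubmodules (h : V ≃ₗ[ℂ] V) _ _ ?_)).symm
    ext z
    simp only [Submodule.mem_map, LinearMap.mem_ker, LinearMap.sub_apply, Module.End.one_apply,
      sub_eq_zero]
    change (∃ y, g • y = y ∧ h • y = z) ↔ (h * g * h⁻¹) • z = z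
    constructor
    · rintro ⟨y, hy, rfl⟩
      simp [mul_smul, hy]
    · intro hz
      refine ⟨h⁻¹ • z, ?_, by simp⟩
      rw [mul_smul, mul_smul, smul_eq_iff_eq_inv_smul] at hz
      exact hz

lemma smul_proj_mem_reg (h : T.W) {z : V} (hz : T.proj z ∈ T.reg) : T.proj (h • z) ∈ T.reg := by
  rw [mem_reg_iff] at hz ⊢
  intro g hg hx
  have hc := isReflection_conj h⁻¹ g hg
  apply hz _ hc
  have hx' : T.proj (g • (h • z)) = T.proj (h • z) := hx
  change T.proj ((h⁻¹ * g * h⁻¹⁻¹) • z) = T.proj z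
  rw [Submodule.Quotient.eq] at hx' ⊢
  have := gamma_smul_mem h⁻¹ hx'
  simpa [mul_smul, smul_sub] using this

lemma smul_mem_dom {U : T.InvOpen} (h : T.W) {z : V} (hz : z ∈ dom U) : h • z ∈ dom U :=
  ⟨U.act_mem h _ hz.1, smul_proj_mem_reg h hz.2⟩

lemma smul_mem_dom_iff {U : T.InvOpen} (h : T.W) {z : V} : h • z ∈ dom U ↔ z ∈ dom U :=
  ⟨fun hz => by simpa using smul_mem_dom h⁻¹ hz, smul_mem_dom h⟩

lemma proj_add_gamma (z : V) {γ : V} (hγ : γ ∈ T.Γ) : T.proj (z + γ) = T.proj z := by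
  rw [Submodule.Quotient.eq]
  simpa using hγ

lemma add_gamma_mem_dom_iff {U : T.InvOpen} {z γ : V} (hγ : γ ∈ T.Γ) :
    z + γ ∈ dom U ↔ z ∈ dom U := by
  simp only [dom, Set.mem_ofPred_eq, proj_add_gamma z hγ]

lemma continuous_smul (g : T.W) [FiniteDimensional ℂ V] : Continuous fun z : V => g • z :=
  (T.lin g).continuous_of_finiteDimensional

lemma isOpen_dom [FiniteDimensional ℂ V] (U : T.InvOpen) : IsOpen (dom U) := by
  have h1 : IsOpen {z : V | T.proj z ∈ U.carrier} :=
    U.isOpen.preimage continuous_quot_mk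
  have hΓ : IsClosed (T.Γ : Set V) :=
    @AddSubgroup.isClosed_of_discrete _ _ _ _ _ T.Γ.toAddSubgroup T.discrete
  have h2 : dom U = {z : V | T.proj z ∈ U.carrier} ∩
      ⋂ g : {g : T.W // T.IsReflection g}, {z : V | (g : T.W) • z - z ∈ T.Γ}ᶜ := by
    ext z
    simp only [dom, mem_reg_iff, Set.mem_ofPred_eq, Set.mem_inter_iff, Set.mem_iInter,
      Set.mem_compl_iff, Subtype.forall, fixedPts, act_proj]
    refine and_congr_right fun _ => forall_congr' fun g => forall_congr' fun _ => ?_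
    rw [Submodule.Quotient.eq]
  rw [h2]
  refine h1.inter (isOpen_iInter_of_finite fun g => ?_)
  rw [isOpen_compl_iff]
  exact hΓ.preimage ((continuous_smul g.1).sub continuous_id)

end GeometryLemmas

section LineBundles

variable (T : TorusAction V)

/-- `V^∨`, the antilinear forms on `V`. -/
abbrev AntiDual (V : Type*) [NormedAddCommGroup V] [NormedSpace ℂ V] : Type _ :=
  V →ₛₗ[starRingEnd ℂ] ℂ

/-- The pairing `ω(α, v) = Im α(v)`. -/
def omega (α : AntiDual V) (v : V) : ℝ := (α v).im

/-- `χ_α(v) = exp (2πi ω(α, v))`. The line bundle `L_α` is the quotient of `V × ℂ` by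
`γ : (z, ξ) ↦ (z + γ, χ_α(γ) ξ)`, `γ ∈ Γ`. -/
def chi (α : AntiDual V) (v : V) : ℂ := Complex.exp (2 * Real.pi * Complex.I * (omega α v : ℂ))

/-- The dual lattice `Γ^∨ ⊂ V^∨`. -/
def dualLattice : Set (AntiDual V) := {α | ∀ γ ∈ T.Γ, ∃ n : ℤ, omega α γ = n}

variable {T}

/-- The dual action of `W` on `V^∨`; the bundle `(L_α)^w` is `L_{wα}`. -/
def dualAct (w : T.W) (α : AntiDual V) : AntiDual V := α.comp (T.lin w⁻¹)

/-- Functions on the preimage of `U ∩ X_reg` in `V` (extended by zero), holomorphic, with at most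
poles along the reflection hypertori: near every point of the preimage of `U` they are quotients
`p / q` of holomorphic functions with `q` nowhere zero over `X_reg`.
If `U ⊂ X_reg`, these are just the holomorphic functions on the preimage of `U`. -/
def merFun (U : T.InvOpen) : Submodule ℂ (V → ℂ) where
  carrier := {f | (∀ z, T.proj z ∈ U.carrier → ∃ p q : V → ℂ, AnalyticAt ℂ p z ∧ AnalyticAt ℂ q z ∧
      ∀ᶠ y in 𝓝 z, y ∈ dom U → q y ≠ 0 ∧ f y = p y / q y) ∧ ∀ z, z ∉ dom U → f z = 0}
  zero_mem' := ⟨fun z _ => ⟨0, 1, analyticAt_const, analyticAt_const, by simp⟩, by simp⟩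
  add_mem' := by
    rintro f g ⟨hf, hf0⟩ ⟨hg, hg0⟩
    refine ⟨fun z hz => ?_, fun z hz => by simp [hf0 z hz, hg0 z hz]⟩
    obtain ⟨p, q, hp, hq, h⟩ := hf z hz
    obtain ⟨p', q', hp', hq', h'⟩ := hg z hz
    refine ⟨p * q' + q * p', q * q', (hp.mul hq').add (hq.mul hp'), hq.mul hq', ?_⟩
    filter_upwards [h, h'] with y hy hy' hd
    obtain ⟨a, b⟩ := hy hd
    obtain ⟨a', b'⟩ := hy' hd
    refine ⟨mul_ne_zero a a', ?_⟩
    simp only [Pi.add_apply, Pi.mul_apply, b, b']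
    field_simp
  smul_mem' := by
    rintro c f ⟨hf, hf0⟩
    refine ⟨fun z hz => ?_, fun z hz => by simp [hf0 z hz]⟩
    obtain ⟨p, q, hp, hq, h⟩ := hf z hz
    refine ⟨fun y => c * p y, q, analyticAt_const.mul hp, hq, ?_⟩
    filter_upwards [h] with y hy hd
    obtain ⟨a, b⟩ := hy hd
    exact ⟨a, by simp only [Pi.smul_apply, smul_eq_mul, b, mul_div_assoc]⟩

/-- Sections of `L_α` over `U ∩ X_reg` with at most poles along the reflection hypertori, as
functions on the preimage in `V` with multipliers `χ_α`. If `U ⊂ X_reg`, these are the holomorphic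
sections of `L_α` over `U`. -/
def sec (U : T.InvOpen) (α : AntiDual V) : Submodule ℂ (V → ℂ) where
  carrier := {f | f ∈ merFun U ∧ ∀ z, ∀ γ ∈ T.Γ, f (z + γ) = chi α γ * f z}
  zero_mem' := ⟨zero_mem _, by simp⟩
  add_mem' := by
    rintro f g ⟨hf, hf'⟩ ⟨hg, hg'⟩
    exact ⟨add_mem hf hg, fun z γ hγ => by simp [hf' z γ hγ, hg' z γ hγ, mul_add]⟩
  smul_mem' := by
    rintro c f ⟨hf, hf'⟩
    refine ⟨(merFun U).smul_mem c hf, fun z γ hγ => ?_⟩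
    simp only [Pi.smul_apply, smul_eq_mul, hf' z γ hγ]
    ring

/-- The functions on `U ∩ X_reg` (with at most poles along the reflection hypertori), that is, the
sections of the trivial bundle `L_0`. -/
abbrev regFun (U : T.InvOpen) : Submodule ℂ (V → ℂ) := sec U 0

end LineBundles

section Operators

variable {T : TorusAction V}

lemma mul_mem_merFun {U : T.InvOpen} {f g : V → ℂ} (hf : f ∈ merFun U) (hg : g ∈ merFun U) :
    f * g ∈ merFun U := by
  obtain ⟨hf, hf0⟩ := hf
  obtain ⟨hg, hg0⟩ := hg
  refine ⟨fun z hz => ?_, fun z hz => by simp [hf0 z hz]⟩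
  obtain ⟨p, q, hp, hq, h⟩ := hf z hz
  obtain ⟨p', q', hp', hq', h'⟩ := hg z hz
  refine ⟨p * p', q * q', hp.mul hp', hq.mul hq', ?_⟩
  filter_upwards [h, h'] with y hy hy' hd
  obtain ⟨a, b⟩ := hy hd
  obtain ⟨a', b'⟩ := hy' hd
  refine ⟨mul_ne_zero a a', ?_⟩
  simp only [Pi.mul_apply, b, b']
  field_simp

open Classical in
/-- The directional derivative `∂_v f` on the preimage of `U ∩ X_reg`, extended by zero. -/
def derivFun (U : T.InvOpen) (v : V) (f : V → ℂ) : V → ℂ :=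
  fun z => if z ∈ dom U then fderiv ℂ f z v else 0

variable [FiniteDimensional ℂ V]

lemma analyticAt_of_mem {U : T.InvOpen} {f : V → ℂ} (hf : f ∈ merFun U) {z : V} (hz : z ∈ dom U) :
    AnalyticAt ℂ f z := by
  obtain ⟨p, q, hp, hq, h⟩ := hf.1 z hz.1
  refine (hp.div hq (h.self_of_nhds hz).1).congr ?_
  filter_upwards [h, (isOpen_dom U).mem_nhds hz] with y hy hd
  exact (hy hd).2.symm

lemma derivFun_mem {U : T.InvOpen} (v : V) {f : V → ℂ} (hf : f ∈ merFun U) :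
    derivFun U v f ∈ merFun U := by
  have : CompleteSpace V := FiniteDimensional.complete ℂ V
  refine ⟨fun z hz => ?_, fun z hz => by simp [derivFun, hz]⟩
  obtain ⟨p, q, hp, hq, h⟩ := hf.1 z hz
  refine ⟨fun y => fderiv ℂ p y v * q y - p y * fderiv ℂ q y v, fun y => q y ^ 2, ?_, hq.pow 2, ?_⟩
  · have hev (r : V → ℂ) (hr : AnalyticAt ℂ r z) : AnalyticAt ℂ (fun y => fderiv ℂ r y v) z :=
      ((ContinuousLinearMap.apply ℂ ℂ v).analyticAt _).comp hr.fderiv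
    exact ((hev p hp).mul hq).sub (hp.mul (hev q hq))
  · filter_upwards [h.eventually_nhds, hp.eventually_analyticAt, hq.eventually_analyticAt]
      with y hy hpy hqy hd
    have hq0 := (hy.self_of_nhds hd).1
    refine ⟨pow_ne_zero 2 hq0, ?_⟩
    have he : f =ᶠ[𝓝 y] fun x => p x / q x := by
      filter_upwards [hy, (isOpen_dom U).mem_nhds hd] with x hx hxd
      exact (hx hxd).2
    have hder := hpy.differentiableAt.hasFDerivAt.mul
      (hasFDerivAt_inv hq0 |>.comp y hqy.differentiableAt.hasFDerivAt)
    have hpq : (fun x => p x / q x) = p * ((fun x => x⁻¹) ∘ q) := by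
      ext x
      simp [div_eq_mul_inv]
    simp only [derivFun, hd, if_true, he.fderiv_eq, hpq, hder.fderiv]
    simp
    field_simp
    ring

/-- Multiplication by a function `f` on `U`. -/
def mulEnd (U : T.InvOpen) (f : regFun U) : Module.End ℂ (merFun U) where
  toFun φ := ⟨f.1 * φ.1, mul_mem_merFun f.2.1 φ.2⟩
  map_add' a b := by ext; simp [mul_add]
  map_smul' c a := by ext; simp; ring

/-- The vector field `∂_v`, as an operator. -/
def derivEnd (U : T.InvOpen) (v : V) : Module.End ℂ (merFun U) where
  toFun φ := ⟨derivFun U v φ.1, derivFun_mem v φ.2⟩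
  map_add' a b := by
    ext z
    by_cases hz : z ∈ dom U
    · have ha := (analyticAt_of_mem a.2 hz).differentiableAt
      have hb := (analyticAt_of_mem b.2 hz).differentiableAt
      simp [derivFun, hz, fderiv_add ha hb]
    · simp [derivFun, hz]
  map_smul' c a := by
    ext z
    by_cases hz : z ∈ dom U
    · have ha := (analyticAt_of_mem a.2 hz).differentiableAt
      simp [derivFun, hz, fderiv_const_smul ha c]
    · simp [derivFun, hz]

/-- The algebra of differential operators on `U` with at most poles along the reflection
hypertori. Since the tangent bundle of `X` is trivialized by the vector fields `∂_v`, this is the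
algebra generated by the functions on `U` and the `∂_v`. Because `V → X` is a covering, it acts on
all functions on the preimage of `U`, not only on the `Γ`-periodic ones; this action is faithful
(it can be tested on polynomials), so the algebra is realized as an algebra of operators on them. -/
def diffOps (U : T.InvOpen) : Subalgebra ℂ (Module.End ℂ (merFun U)) :=
  Algebra.adjoin ℂ (Set.range (mulEnd U) ∪ Set.range (derivEnd U))

/-- A function `f` on `U`, as an element of the algebra of differential operators. -/
def mulOp (U : T.InvOpen) (f : regFun U) : diffOps U :=
  ⟨mulEnd U f, Algebra.subset_adjoin (Or.inl ⟨f, rfl⟩)⟩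

/-- The vector field `∂_v`, as an element of the algebra of differential operators. -/
def derivOp (U : T.InvOpen) (v : V) : diffOps U :=
  ⟨derivEnd U v, Algebra.subset_adjoin (Or.inr ⟨v, rfl⟩)⟩

lemma translate_mem {U : T.InvOpen} (g : T.W) {f : V → ℂ} (hf : f ∈ merFun U) :
    (fun z => f (g⁻¹ • z)) ∈ merFun U := by
  refine ⟨fun z hz => ?_, fun z hz => hf.2 _ (by rwa [smul_mem_dom_iff])⟩
  obtain ⟨p, q, hp, hq, h⟩ := hf.1 (g⁻¹ • z) (U.act_mem g⁻¹ _ hz)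
  have hl : AnalyticAt ℂ (fun z : V => g⁻¹ • z) z :=
    ((T.lin g⁻¹).toContinuousLinearMap).analyticAt z
  refine ⟨fun y => p (g⁻¹ • y), fun y => q (g⁻¹ • y), hp.comp hl, hq.comp hl, ?_⟩
  filter_upwards [(continuous_smul g⁻¹).continuousAt.eventually h] with y hy hd
  exact hy (smul_mem_dom _ hd)

/-- The action of `g ∈ W` on functions, `(g φ)(z) = φ(g⁻¹ z)`. -/
def translate (U : T.InvOpen) (g : T.W) : Module.End ℂ (merFun U) where
  toFun φ := ⟨fun z => φ.1 (g⁻¹ • z), translate_mem g φ.2⟩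
  map_add' _ _ := rfl
  map_smul' _ _ := rfl

lemma translate_one (U : T.InvOpen) : translate U 1 = 1 := by
  ext φ z
  simp [translate]

lemma translate_mul (U : T.InvOpen) (g h : T.W) :
    translate U (g * h) = translate U g * translate U h := by
  ext φ z
  simp [translate, mul_smul]

lemma translate_mulEnd_mem {U : T.InvOpen} (g : T.W) (f : regFun U) :
    translate U g * mulEnd U f * translate U g⁻¹ ∈ diffOps U := by
  have hf : (fun z => f.1 (g⁻¹ • z)) ∈ regFun U := by
    refine ⟨translate_mem g f.2.1, fun z γ hγ => ?_⟩
    have := f.2.2 (g⁻¹ • z) (g⁻¹ • γ) (gamma_smul_mem g⁻¹ hγ)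
    simpa [smul_add, chi, omega] using this
  have he : translate U g * mulEnd U f * translate U g⁻¹ = mulEnd U ⟨_, hf⟩ := by
    ext φ z
    simp [translate, mulEnd]
  rw [he]
  exact Algebra.subset_adjoin (Or.inl ⟨_, rfl⟩)

lemma translate_derivEnd {U : T.InvOpen} (g : T.W) (v : V) :
    translate U g * derivEnd U v * translate U g⁻¹ = derivEnd U (g • v) := by
  ext φ z
  by_cases hz : z ∈ dom U
  · have hz' : g⁻¹ • z ∈ dom U := smul_mem_dom _ hz
    have hφ : HasFDerivAt φ.1 (fderiv ℂ φ.1 z) (g • (g⁻¹ • z)) := by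
      rw [smul_inv_smul]
      exact (analyticAt_of_mem φ.2 hz).differentiableAt.hasFDerivAt
    have hl : HasFDerivAt (fun z : V => g • z) (T.lin g).toContinuousLinearMap (g⁻¹ • z) :=
      ((T.lin g).toContinuousLinearMap).hasFDerivAt
    have hc := (hφ.comp (g⁻¹ • z) hl).fderiv
    simp only [translate, derivEnd, derivFun, Module.End.mul_apply, LinearMap.coe_mk,
      AddHom.coe_mk, hz, hz', if_true, inv_inv]
    change fderiv ℂ (φ.1 ∘ fun z => g • z) (g⁻¹ • z) v = _
    rw [hc]
    rfl
  · have hz' : g⁻¹ • z ∉ dom U := by rwa [smul_mem_dom_iff]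
    simp [translate, derivEnd, derivFun, hz, hz']

lemma conj_mem {U : T.InvOpen} (g : T.W) {P : Module.End ℂ (merFun U)} (hP : P ∈ diffOps U) :
    translate U g * P * translate U g⁻¹ ∈ diffOps U := by
  have hinv : translate U g⁻¹ * translate U g = 1 := by
    rw [← translate_mul, inv_mul_cancel, translate_one]
  have hinv' : translate U g * translate U g⁻¹ = 1 := by
    rw [← translate_mul, mul_inv_cancel, translate_one]
  induction hP using Algebra.adjoin_induction with
  | mem x hx =>
    rcases hx with ⟨f, rfl⟩ | ⟨v, rfl⟩
    · exact translate_mulEnd_mem g f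
    · rw [translate_derivEnd]
      exact Algebra.subset_adjoin (Or.inr ⟨_, rfl⟩)
  | algebraMap r =>
    rw [← Algebra.commutes, mul_assoc, hinv', mul_one]
    exact Subalgebra.algebraMap_mem _ r
  | add x y _ _ hx hy =>
    rw [mul_add, add_mul]
    exact add_mem hx hy
  | mul x y _ _ hx hy =>
    have : translate U g * (x * y) * translate U g⁻¹ =
        (translate U g * x * translate U g⁻¹) * (translate U g * y * translate U g⁻¹) := by
      calc _ = translate U g * x * 1 * y * translate U g⁻¹ := by simp only [mul_assoc, mul_one]
        _ = _ := by rw [← hinv]; simp only [mul_assoc]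
    rw [this]
    exact mul_mem hx hy

/-- `W` acts on differential operators by `g P g⁻¹`, where `(g φ)(z) = φ(g⁻¹ z)`; the crossed
product `W ⋉ D(U)` is the skew group algebra for this action. -/
instance (U : T.InvOpen) : MulSemiringAction T.W (diffOps U) where
  smul g P := ⟨translate U g * P.1 * translate U g⁻¹, conj_mem g P.2⟩
  one_smul P := by
    apply Subtype.ext
    change translate U 1 * P.1 * translate U 1⁻¹ = P.1
    rw [inv_one, translate_one, one_mul, mul_one]
  mul_smul g h P := by
    apply Subtype.ext
    change translate U (g * h) * P.1 * translate U (g * h)⁻¹ =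
      translate U g * (translate U h * P.1 * translate U h⁻¹) * translate U g⁻¹
    rw [mul_inv_rev, translate_mul, translate_mul]
    simp only [mul_assoc]
  smul_zero g := by
    apply Subtype.ext
    change translate U g * 0 * translate U g⁻¹ = 0
    simp
  smul_add g P Q := by
    apply Subtype.ext
    change translate U g * (P.1 + Q.1) * translate U g⁻¹ =
      translate U g * P.1 * translate U g⁻¹ + translate U g * Q.1 * translate U g⁻¹
    rw [mul_add, add_mul]
  smul_one g := by
    apply Subtype.ext
    change translate U g * 1 * translate U g⁻¹ = 1
    rw [mul_one, ← translate_mul, mul_inv_cancel, translate_one]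
  smul_mul g P Q := by
    apply Subtype.ext
    change translate U g * (P.1 * Q.1) * translate U g⁻¹ =
      (translate U g * P.1 * translate U g⁻¹) * (translate U g * Q.1 * translate U g⁻¹)
    have hinv : translate U g⁻¹ * translate U g = 1 := by
      rw [← translate_mul, inv_mul_cancel, translate_one]
    calc _ = translate U g * P.1 * 1 * Q.1 * translate U g⁻¹ := by simp only [mul_assoc, mul_one]
      _ = _ := by rw [← hinv]; simp only [mul_assoc]

instance (U : T.InvOpen) : SMulCommClass T.W ℂ (diffOps U) where
  smul_comm g c P := by
    apply Subtype.ext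
    change translate U g * (c • P.1) * translate U g⁻¹ =
      c • (translate U g * P.1 * translate U g⁻¹)
    simp

/-- `W ⋉ D(U)`: finite sums of `single g P` (standing for `P g`), with
`(P g) (Q h) = P (g Q g⁻¹) g h`. -/
abbrev Crossed (U : T.InvOpen) : Type _ := SkewMonoidAlgebra (diffOps U) T.W

end Operators

section Dunkl

variable (T : TorusAction V)

/-- A flat holomorphic connection `∇ = d + form` on `L_α`; as the multipliers `χ_α(γ)` are
constants, `d` acts on sections, and the connection form is a holomorphic `Γ`-periodic closed 1-form on `V`. -/
structure FlatConnection where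
  form : V → V →L[ℂ] ℂ
  holomorphic : Differentiable ℂ form
  periodic : ∀ z, ∀ γ ∈ T.Γ, form (z + γ) = form z
  closed : ∀ z u v, fderiv ℂ form z u v = fderiv ℂ form z v u

variable {T}

/-- `f` is the meromorphic section `f_{H,j}` of `(L^g)^* ⊗ L ⊗ V_H^*`, where `L = L_α` and
`g = g_H ^ j`, viewed as a `V^*`-valued function on `V` (with value zero on the preimage of `H`):
its only singularity is a simple pole on `H`, with residue `1`.

If `z` lies over `H`, then `g x = x` for the image `x` of `z`, so the fibre of `L^g` at `x`, which
is the fibre of `L` at `g⁻¹ x`, is the fibre of `L` at `x`; this is the trivialization of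
`(L^g)^* ⊗ L` on `H`. In the coordinate on `V`, the section `1` is given by the locally
constant function `χ_α (z - g⁻¹ z)`. -/
structure IsPolarSection (α : AntiDual V) (p : T.S) (f : V → V →L[ℂ] ℂ) : Prop where
  /-- the values lie in `V_H^*`, the functionals that vanish on `V^{g_H}` -/
  mem_dual : ∀ z v, T.gen p.1.1 • v = v → f z v = 0
  multiplier : ∀ z, ∀ γ ∈ T.Γ, f (z + γ) = chi (α - dualAct (T.elt p) α) γ • f z
  holomorphic : ∀ z, T.proj z ∉ p.1.1 → AnalyticAt ℂ f z
  /-- near a point `z₀` over `H`, where `H` is given by `a (z - z₀) = 0`, the form `a (z - z₀) f`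
  extends holomorphically, and has the value (residue) `· a` at `z₀` -/
  residue : ∀ z₀, T.proj z₀ ∈ p.1.1 → ∀ a : V →L[ℂ] ℂ, (∀ v, T.gen p.1.1 • v = v → a v = 0) →
    ∃ β : V → V →L[ℂ] ℂ, AnalyticAt ℂ β z₀ ∧
      (∀ᶠ z in 𝓝 z₀, T.proj z ∉ p.1.1 → a (z - z₀) • f z = β z) ∧
      β z₀ = chi α (z₀ - (T.elt p)⁻¹ • z₀) • a
  zero_on : ∀ z, T.proj z ∈ p.1.1 → f z = 0

/-- The section `f_{H,j}^L` for `L = L_α`. -/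
def polarSection (α : AntiDual V) (p : T.S) : V → V →L[ℂ] ℂ :=
  Classical.epsilon (IsPolarSection α p)

/-- `F_{C,g}^L = ∑ C(H,j) f_{H,j}^L` over the `(H,j) ∈ S` with `g_H ^ j = g`, for `L = L_α`. -/
def dunklCoeff (C : T.S → ℂ) (α : AntiDual V) (g : T.W) (z : V) : V →L[ℂ] ℂ :=
  ∑ᶠ (p : T.S) (_ : T.elt p = g), C p • polarSection α p z

/-- `∇_v` on sections of `(L^*)^w`: the connection dual to `∇`, transported by `w`. -/
def nabla (D : T.FlatConnection) (w : T.W) (v : V) (β : V → ℂ) (z : V) : ℂ :=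
  fderiv ℂ β z v - D.form (w⁻¹ • z) (w⁻¹ • v) * β z

/-- Sections over `U ∩ X_reg` of `F = ⊕_w (L^*)^w`, where `L = L_α`, `L^* = L_{-α}`, with at most
poles along the reflection hypertori; `β w` is the component of `β` in `(L^*)^w`. -/
abbrev Fsec (U : T.InvOpen) (α : AntiDual V) : Type _ := ∀ w : T.W, sec U (dualAct w (-α))

variable [FiniteDimensional ℂ V]

/-- `ρ` is given on generators by the formulas for `ρ(g)`, `ρ(f)` and `ρ(∂_v)`. -/
structure IsDunklRep (α : AntiDual V) (D : T.FlatConnection) (C : T.S → ℂ) (U : T.InvOpen)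
    (ρ : Crossed U →ₐ[ℂ] Module.End ℂ (Fsec U α)) : Prop where
  /-- `ρ(g)` maps `(L^*)^w` to `(L^*)^{gw}` by `β ↦ β ∘ g⁻¹` -/
  map_group : ∀ (g w : T.W) (β : Fsec U α) (z : V),
    (ρ (SkewMonoidAlgebra.single g 1) β (g * w)).1 z = (β w).1 (g⁻¹ • z)
  map_function : ∀ (f : regFun U) (w : T.W) (β : Fsec U α) (z : V),
    (ρ (SkewMonoidAlgebra.single 1 (mulOp U f)) β w).1 z = f.1 z * (β w).1 z
  /-- `ρ(∂_v) β = (∇_v + ∑_g ⟨F_{C,g}^{L^w}, v⟩) β` for a section `β` of `(L^*)^w`. The `g`-th term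
  is a section of `(L^*)^{gw}`, so the component in `(L^*)^k` of `ρ(∂_v) β` for general `β` is
  the sum over `w` of the terms with `g = k w⁻¹`. -/
  map_deriv : ∀ (v : V) (k : T.W) (β : Fsec U α), ∀ z ∈ dom U,
    (ρ (SkewMonoidAlgebra.single 1 (derivOp U v)) β k).1 z =
      nabla D k v (β k).1 z + ∑ᶠ w : T.W, dunklCoeff C (dualAct w α) (k * w⁻¹) z v * (β w).1 z

end Dunkl

section Restriction

variable {T : TorusAction V}

/-- Restriction to `U'`: the function is set to zero off the preimage of `U' ∩ X_reg`. -/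
def cut (U' : T.InvOpen) (f : V → ℂ) : V → ℂ := (dom U').indicator f

lemma cut_mem {U U' : T.InvOpen} (h : U'.carrier ⊆ U.carrier) {f : V → ℂ} (hf : f ∈ merFun U) :
    cut U' f ∈ merFun U' := by
  refine ⟨fun z hz => ?_, fun z hz => Set.indicator_of_notMem hz f⟩
  obtain ⟨p, q, hp, hq, hh⟩ := hf.1 z (h hz)
  refine ⟨p, q, hp, hq, ?_⟩
  filter_upwards [hh] with y hy hd
  have := hy ⟨h hd.1, hd.2⟩
  exact ⟨this.1, by rw [cut, Set.indicator_of_mem hd, this.2]⟩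

lemma cut_mem_sec {U U' : T.InvOpen} (h : U'.carrier ⊆ U.carrier) {α : AntiDual V} {f : V → ℂ}
    (hf : f ∈ sec U α) : cut U' f ∈ sec U' α := by
  refine ⟨cut_mem h hf.1, fun z γ hγ => ?_⟩
  by_cases hz : z ∈ dom U'
  · rw [cut, Set.indicator_of_mem hz, Set.indicator_of_mem ((add_gamma_mem_dom_iff hγ).2 hz),
      hf.2 z γ hγ]
  · rw [cut, Set.indicator_of_notMem hz,
      Set.indicator_of_notMem (fun h' => hz ((add_gamma_mem_dom_iff hγ).1 h')), mul_zero]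

/-- Restriction of sections of `F` from `U` to `U' ⊂ U`. -/
def Fres {U U' : T.InvOpen} (h : U'.carrier ⊆ U.carrier) {α : AntiDual V} (β : Fsec U α) :
    Fsec U' α := fun w => ⟨cut U' (β w).1, cut_mem_sec h (β w).2⟩

variable [FiniteDimensional ℂ V]

/-- `P'` is the restriction to `U' ⊂ U` of the differential operator `P` on `U`. -/
def IsRestriction {U U' : T.InvOpen} (h : U'.carrier ⊆ U.carrier) (P : diffOps U)
    (P' : diffOps U') : Prop :=
  ∀ φ : merFun U, (P'.1 ⟨cut U' φ.1, cut_mem h φ.2⟩).1 = cut U' (P.1 φ).1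

/-- Differential operators can be restricted. -/
lemma exists_isRestriction {U U' : T.InvOpen} (h : U'.carrier ⊆ U.carrier) (P : diffOps U) :
    ∃ P' : diffOps U', IsRestriction h P P' := by
  obtain ⟨P, hP⟩ := P
  induction hP using Algebra.adjoin_induction with
  | mem x hx =>
    rcases hx with ⟨f, rfl⟩ | ⟨v, rfl⟩
    · refine ⟨mulOp U' ⟨cut U' f.1, cut_mem_sec h f.2⟩, fun φ => ?_⟩
      ext z
      by_cases hz : z ∈ dom U' <;> simp [mulOp, mulEnd, cut, hz]
    · refine ⟨derivOp U' v, fun φ => ?_⟩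
      ext z
      by_cases hz : z ∈ dom U'
      · have hz' : z ∈ dom U := ⟨h hz.1, hz.2⟩
        have he : cut U' φ.1 =ᶠ[𝓝 z] φ.1 := by
          filter_upwards [(isOpen_dom U').mem_nhds hz] with y hy
          exact Set.indicator_of_mem hy _
        simp only [derivOp, derivEnd, derivFun, LinearMap.coe_mk, AddHom.coe_mk, hz, if_true,
          he.fderiv_eq]
        simp [cut, hz, hz', derivFun]
      · simp [derivOp, derivEnd, derivFun, cut, hz]
  | algebraMap r =>
    refine ⟨algebraMap ℂ _ r, fun φ => ?_⟩
    ext z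
    by_cases hz : z ∈ dom U' <;> simp [cut, hz, Algebra.algebraMap_eq_smul_one]
  | add x y _ _ hx hy =>
    obtain ⟨x', hx'⟩ := hx
    obtain ⟨y', hy'⟩ := hy
    refine ⟨x' + y', fun φ => ?_⟩
    have h1 := hx' φ
    have h2 := hy' φ
    simp only at h1 h2
    ext z
    have h1' := congrFun h1 z
    have h2' := congrFun h2 z
    by_cases hz : z ∈ dom U' <;> simp_all [cut]
  | mul x y _ _ hx hy =>
    obtain ⟨x', hx'⟩ := hx
    obtain ⟨y', hy'⟩ := hy
    refine ⟨x' * y', fun φ => ?_⟩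
    have h2 : y'.1 ⟨cut U' φ.1, cut_mem h φ.2⟩ = ⟨cut U' (y φ).1, cut_mem h (y φ).2⟩ :=
      Subtype.ext (hy' φ)
    change (x'.1 (y'.1 _)).1 = _
    rw [h2]
    exact hx' (y φ)

end Restriction

end TorusAction

end

/-! Polar sections. An element g fixing the hyperplane `ker a` attached to H makes the character
`chi (α - dualAct g α)` trivial on `ker a`, so everything reduces to one variable t = a(z). There a
Weierstrass zeta series twisted by a nontrivial unitary character of the period group has simple
poles on that group and, after an affine correction, exactly the required multipliers
(`exists_twisted_zeta`). Uniqueness is a Liouville argument (`eq_zero_of_removable`): a function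
with nontrivial unitary multipliers whose singularities are removable along generic lines is zero.

Flatness. The formulas define a representation only if the Dunkl operators commute. Each polar
section is ψ(a z) a, hence closed, and the form of `∇` is constant, so only the quadratic part of
the curvature matters. Its component of degree g is the 2-form Σ_h F_{g h⁻¹} ∧ F_h. For g = 1 each
term is a wedge of proportional functionals. For g ≠ 1 the sum has the nontrivial multiplier χ_{α -
gα}; its double poles vanish because a ∧ a = 0, and its residues along every hypertorus cancel by
W-equivariance of the F's, which is where the invariance of C enters (`residue_cancel`). The
Liouville argument then kills it (`sum_wedge_dunklCoeff`). The terms mixing the form of `∇` with F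
cancel because a difference θ∘k⁻¹ - θ∘w⁻¹ vanishes on the fixed space of k w⁻¹.

From generators to the algebra. Differential operators are given here as operators on functions,
without a presentation, so one must show that an operator P determines its counterpart on sections
of F. The subalgebra `pairAlg` generated by the pairs of corresponding generators relates the two.
At a point z, commutativity lets one build, for every section, a tuple of polynomials whose ordinary
jets equal the covariant jets of the section (`jetEq_taylorPoly`); the value at z of the operator on
the section is then read off from P on these polynomials. Thus `pairAlg` is the graph of a
homomorphism (`eq_of_mem_pairAlg`, `repHom`), which W-equivariance extends to the crossed product.
Uniqueness is determination on generators, and compatibility with restriction follows from the same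
graph property on the smaller open set. -/

noncomputable section

/-! ### The Weierstrass zeta function twisted by a unitary character. -/

section TwistedZeta

open Filter

/-- The summand at `l` of the twisted Weierstrass zeta function. -/
def twistedZetaTerm (χ : ℂ → ℂ) (l t : ℂ) : ℂ :=
  (χ l)⁻¹ * (1 / (t + l) - 1 / l + t / l ^ 2)

/-- The two correction terms cancel the expansion of 1/(t + l) through second order, leaving
t²/(l²(t + l)); this cubic decay is what summation over a group of rank at most 2 needs. -/
lemma norm_twistedZetaTerm_le {χ : ℂ → ℂ} {l : ℂ} (hχ : ‖χ l‖ = 1) {r : ℝ} (hr : 0 < r)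
    {t : ℂ} (ht : ‖t‖ ≤ r) (hl : 2 * r ≤ ‖l‖) :
    ‖twistedZetaTerm χ l t‖ ≤ 2 * r ^ 2 * (‖l‖ ^ 3)⁻¹ := by
  have hl0 : 0 < ‖l‖ := by linarith
  have hl0' : l ≠ 0 := norm_pos_iff.1 hl0
  have h1 : ‖l‖ / 2 ≤ ‖t + l‖ := by
    have := norm_sub_le (t + l) t
    rw [add_sub_cancel_left] at this
    linarith
  have h2 : t + l ≠ 0 := norm_pos_iff.1 (by linarith)
  have h3 : 1 / (t + l) - 1 / l + t / l ^ 2 = t ^ 2 / (l ^ 2 * (t + l)) := by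
    field_simp
    ring
  rw [twistedZetaTerm, h3, norm_mul, norm_inv, hχ, inv_one, one_mul, norm_div, norm_mul, norm_pow,
    norm_pow]
  calc ‖t‖ ^ 2 / (‖l‖ ^ 2 * ‖t + l‖) ≤ r ^ 2 / (‖l‖ ^ 2 * (‖l‖ / 2)) := by gcongr
    _ = _ := by field_simp

lemma isClosed_of_discrete {E : Type*} [NormedAddCommGroup E] (L : Submodule ℤ E)
    [h : DiscreteTopology L] : IsClosed (L : Set E) :=
  @AddSubgroup.isClosed_of_discrete _ _ _ _ _ L.toAddSubgroup h

lemma eventually_notMem_of_discrete {E : Type*} [NormedAddCommGroup E] (L : Submodule ℤ E)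
    [h : DiscreteTopology L] (x : E) : ∀ᶠ y in 𝓝[≠] x, y ∉ L := by
  by_cases hx : x ∈ L
  · have := isDiscrete_iff_nhdsNE.1 (⟨h⟩ : IsDiscrete (L : Set E)) x hx
    rw [← disjoint_iff, Filter.disjoint_principal_right] at this
    exact this
  · exact eventually_nhdsWithin_of_eventually_nhds
      ((isClosed_of_discrete L).isOpen_compl.mem_nhds hx)

variable (Λ : Submodule ℤ ℂ) [DiscreteTopology Λ]

lemma finrank_discrete_complex_le : Module.finrank ℤ Λ ≤ 2 := by
  have hs : Submodule.span ℤ (Λ : Set ℂ) = Λ := Submodule.span_eq Λ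
  have h1 : DiscreteTopology (Submodule.span ℤ (Λ : Set ℂ)) := by rwa [hs]
  have h2 := Real.finrank_eq_int_finrank_of_discrete h1
  have h3 : Set.finrank ℤ (Λ : Set ℂ) = Module.finrank ℤ Λ := by rw [Set.finrank, hs]
  rw [← h3, ← h2, ← Complex.finrank_real_complex]
  exact Submodule.finrank_le _

lemma summable_inv_norm_cube : Summable fun l : Λ => (‖(l : ℂ)‖ ^ 3)⁻¹ := by
  simpa using ZLattice.summable_norm_pow_inv Λ 3 (by have := finrank_discrete_complex_le Λ; omega)

lemma finite_norm_lt_of_discrete {E : Type*} [NormedAddCommGroup E] [ProperSpace E]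
    (L : Submodule ℤ E) [h : DiscreteTopology L] (r : ℝ) : {l : L | ‖(l : E)‖ < r}.Finite := by
  have := Metric.finite_isBounded_inter_isClosed DiscreteTopology.isDiscrete
    (Metric.isBounded_ball (x := (0 : E)) (r := r)) (isClosed_of_discrete L)
  refine Set.Finite.of_finite_image (f := Subtype.val) (this.subset ?_) Subtype.val_injective.injOn
  rintro _ ⟨l, hl, rfl⟩
  exact ⟨by simpa using hl, l.2⟩

/-- The twisted Weierstrass zeta function. -/
def twistedZeta (χ : ℂ → ℂ) (t : ℂ) : ℂ := ∑' l : Λ, twistedZetaTerm χ l t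

variable {Λ} {χ : ℂ → ℂ}

lemma summable_twistedZetaTerm (hχ : ∀ t, ‖χ t‖ = 1) (t : ℂ) :
    Summable fun l : Λ => twistedZetaTerm χ l t := by
  have hr : 0 < ‖t‖ + 1 := by positivity
  refine Summable.of_norm_bounded_eventually
    ((summable_inv_norm_cube Λ).mul_left (2 * (‖t‖ + 1) ^ 2)) ?_
  refine (finite_norm_lt_of_discrete Λ (2 * (‖t‖ + 1))).subset fun l hl => ?_
  simp only [Set.mem_ofPred_eq, Set.mem_compl_iff] at hl ⊢
  by_contra h
  exact hl (norm_twistedZetaTerm_le (hχ _) hr (by linarith) (not_lt.1 h))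

/-- On a disc around 0 containing t₀ all but finitely many summands are holomorphic and dominated
uniformly, so a singularity can come only from the finite part. -/
lemma twistedZeta_local (hχ : ∀ t, ‖χ t‖ = 1) (t₀ : ℂ) :
    ∃ h : ℂ → ℂ, AnalyticAt ℂ h t₀ ∧ (t₀ ∉ Λ → twistedZeta Λ χ =ᶠ[𝓝 t₀] h) ∧
      (t₀ ∈ Λ → ∀ᶠ t in 𝓝 t₀, twistedZeta Λ χ t = (χ (-t₀))⁻¹ / (t - t₀) + h t) := by
  classical
  set r := ‖t₀‖ + 1 with hrdef
  have hr : 0 < r := by positivity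
  set s : Finset Λ := (finite_norm_lt_of_discrete Λ (2 * r)).toFinset with hs
  have hmem (l : Λ) : l ∈ s ↔ ‖(l : ℂ)‖ < 2 * r := by simp [hs]
  have hball : Metric.ball (0 : ℂ) r ∈ 𝓝 t₀ := Metric.isOpen_ball.mem_nhds (by simp [hrdef])
  have hterm (l t : ℂ) (h : t + l ≠ 0) : AnalyticAt ℂ (twistedZetaTerm χ l) t := by
    refine analyticAt_const.mul (((analyticAt_const.div (analyticAt_id.add analyticAt_const) h).sub
      analyticAt_const).add ?_)
    simp only [div_eq_mul_inv]
    exact analyticAt_id.mul analyticAt_const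
  set tail : ℂ → ℂ := fun t => ∑' l : {l : Λ // l ∉ s}, twistedZetaTerm χ l t with htail
  have htail_an : AnalyticAt ℂ tail t₀ := by
    refine DifferentiableOn.analyticAt (s := Metric.ball 0 r) ?_ hball
    refine Complex.differentiableOn_tsum_of_summable_norm (u := fun l => 2 * r ^ 2 * (‖(l.1 : ℂ)‖ ^ 3)⁻¹)
      (((summable_inv_norm_cube Λ).mul_left _).subtype _) (fun l t ht => ?_) Metric.isOpen_ball
      (fun l t ht => ?_)
    · have hl : 2 * r ≤ ‖(l.1 : ℂ)‖ := not_lt.1 fun h => l.2 ((hmem _).2 h)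
      have ht' : ‖t‖ < r := by simpa using ht
      refine (hterm _ _ fun h0 => ?_).differentiableAt.differentiableWithinAt
      have : ‖t‖ = ‖(l.1 : ℂ)‖ := by rw [eq_neg_of_add_eq_zero_left h0, norm_neg]
      linarith
    · have hl : 2 * r ≤ ‖(l.1 : ℂ)‖ := not_lt.1 fun h => l.2 ((hmem _).2 h)
      have ht' : ‖t‖ < r := by simpa using ht
      exact norm_twistedZetaTerm_le (hχ _) hr ht'.le hl
  have hsplit (t : ℂ) : twistedZeta Λ χ t = ∑ l ∈ s, twistedZetaTerm χ l t + tail t :=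
    ((summable_twistedZetaTerm hχ t).sum_add_tsum_subtype_compl s).symm
  by_cases ht₀ : t₀ ∈ Λ
  · have hm : (-⟨t₀, ht₀⟩ : Λ) ∈ s := by
      rw [hmem]
      simp
      linarith
    -- The pole comes from the summand at `-t₀`, whose affine remainder joins h. For t₀ = 0 the
    -- convention 1/0 = 0 makes that remainder zero, so the summand at 0 is just (χ 0)⁻¹/t.
    refine ⟨fun t => (χ (-t₀))⁻¹ * (1 / t₀ + t / t₀ ^ 2) +
      ∑ l ∈ s.erase (-⟨t₀, ht₀⟩), twistedZetaTerm χ l t + tail t, ?_, fun h => absurd ht₀ h,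
      fun _ => ?_⟩
    · refine AnalyticAt.add (AnalyticAt.add ?_ ?_) htail_an
      · simp only [div_eq_mul_inv]
        exact analyticAt_const.mul (analyticAt_const.add (analyticAt_id.mul analyticAt_const))
      · refine Finset.analyticAt_fun_sum _ fun l hl => hterm _ _ fun h0 => ?_
        refine (Finset.mem_erase.1 hl).1 (Subtype.ext ?_)
        simpa using eq_neg_of_add_eq_zero_right h0
    · refine Eventually.of_forall fun t => ?_
      rw [hsplit, ← Finset.add_sum_erase s _ hm]
      simp only [twistedZetaTerm, Submodule.coe_neg]
      simp only [div_neg, neg_sq, ← sub_eq_add_neg]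
      ring
  · refine ⟨fun t => ∑ l ∈ s, twistedZetaTerm χ l t + tail t, ?_, fun _ => ?_,
      fun h => absurd h ht₀⟩
    · refine AnalyticAt.add (Finset.analyticAt_fun_sum _ fun l hl => hterm _ _ fun h0 => ?_) htail_an
      exact ht₀ (by rw [eq_neg_of_add_eq_zero_left h0]; exact Λ.neg_mem l.2)
    · exact Eventually.of_forall hsplit

/-- After the shift l ↦ l + l' the polar terms of the two series match and cancel; what remains in
each summand is affine in t. -/
lemma twistedZeta_add (hχ : ∀ t, ‖χ t‖ = 1) (hmul : ∀ s t, χ (s + t) = χ s * χ t) (l' : Λ) :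
    ∃ A B : ℂ, ∀ t, twistedZeta Λ χ (t + l') - χ l' * twistedZeta Λ χ t = A + B * t := by
  have hne (t : ℂ) : χ t ≠ 0 := norm_pos_iff.1 (by rw [hχ]; exact one_pos)
  set P : Λ → ℂ := fun l => (χ l)⁻¹ * (-(1 / (l : ℂ)) + 1 / (l + l' : ℂ) + l' / (l : ℂ) ^ 2) with hP
  set Q : Λ → ℂ := fun l => (χ l)⁻¹ * (1 / (l : ℂ) ^ 2 - 1 / (l + l' : ℂ) ^ 2) with hQ
  have hterm (t : ℂ) (l : Λ) : twistedZetaTerm χ l (t + l') -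
      χ l' * twistedZetaTerm χ (l + l' : Λ) t = P l + t * Q l := by
    simp only [twistedZetaTerm, hP, hQ, Submodule.coe_add, hmul, mul_inv, add_assoc,
      add_comm (l' : ℂ) (l : ℂ)]
    have := hne l'
    field_simp
    ring
  have hsum2 (t : ℂ) : Summable fun l : Λ => χ l' * twistedZetaTerm χ (l + l' : Λ) t :=
    (((Equiv.addRight l').summable_iff).2 (summable_twistedZetaTerm hχ t)).mul_left _
  have hsum (t : ℂ) : Summable fun l : Λ => P l + t * Q l := by
    simp only [← hterm]
    exact (summable_twistedZetaTerm hχ _).sub (hsum2 t)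
  -- The two coefficient series converge separately: t = 0 isolates P, and subtracting it from t = 1
  -- isolates Q.
  have hsP : Summable P := by simpa using hsum 0
  have hsQ : Summable Q := by
    have := (hsum 1).sub hsP
    simpa using this
  refine ⟨∑' l, P l, ∑' l, Q l, fun t => ?_⟩
  have h1 : χ l' * twistedZeta Λ χ t = ∑' l : Λ, χ l' * twistedZetaTerm χ (l + l' : Λ) t := by
    rw [tsum_mul_left]
    congr 1
    exact ((Equiv.addRight l').tsum_eq (fun l : Λ => twistedZetaTerm χ l t)).symm
  rw [h1, twistedZeta, ← (summable_twistedZetaTerm hχ _).tsum_sub (hsum2 t)]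
  simp only [hterm]
  rw [hsP.tsum_add (hsQ.mul_left t), tsum_mul_left, mul_comm t]

/-- For a nontrivial unitary character `χ`, there is a meromorphic function with multipliers `χ`
and simple poles exactly at the lattice points. -/
theorem exists_twisted_zeta (hχ : ∀ t, ‖χ t‖ = 1) (hmul : ∀ s t, χ (s + t) = χ s * χ t)
    (hnt : ∃ l ∈ Λ, χ l ≠ 1) :
    ∃ ψ : ℂ → ℂ, (∀ t, ∀ l ∈ Λ, ψ (t + l) = χ l * ψ t) ∧ (∀ t ∉ Λ, AnalyticAt ℂ ψ t) ∧
      (∀ l ∈ Λ, ψ l = 0) ∧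
      ∀ l ∈ Λ, ∃ h : ℂ → ℂ, AnalyticAt ℂ h l ∧ ∀ᶠ t in 𝓝[≠] l, ψ t = χ l / (t - l) + h t := by
  classical
  have hne (t : ℂ) : χ t ≠ 0 := norm_pos_iff.1 (by rw [hχ]; exact one_pos)
  obtain ⟨l₀, hl₀, hχ₀⟩ := hnt
  have h1 : 1 - χ l₀ ≠ 0 := sub_ne_zero.2 (Ne.symm hχ₀)
  obtain ⟨A, B, hAB⟩ := twistedZeta_add (Λ := Λ) hχ hmul ⟨l₀, hl₀⟩
  -- An affine correction e + d t solving the functional equation for the single period l₀; it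
  -- exists since χ(l₀) ≠ 1.
  set d : ℂ := -B / (1 - χ l₀) with hd
  set e : ℂ := -(A + d * l₀) / (1 - χ l₀) with he
  set Z : ℂ → ℂ := fun t => twistedZeta Λ χ t + (e + d * t) with hZ
  have hZ₀ (t : ℂ) : Z (t + l₀) = χ l₀ * Z t := by
    have h2 := hAB t
    have h3 : twistedZeta Λ χ (t + l₀) = χ l₀ * twistedZeta Λ χ t + (A + B * t) := by
      rw [← h2]; simp
    have h4 : d * (1 - χ l₀) = -B := by rw [hd]; field_simp
    have h5 : e * (1 - χ l₀) = -(A + d * l₀) := by rw [he]; field_simp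
    simp only [hZ, h3]
    linear_combination h5 + t * h4
  have hZl (l : ℂ) (hl : l ∈ Λ) (t : ℂ) : Z (t + l) = χ l * Z t := by
    obtain ⟨A', B', hAB'⟩ := twistedZeta_add (Λ := Λ) hχ hmul ⟨l, hl⟩
    obtain ⟨a, b, hab⟩ : ∃ a b : ℂ, ∀ t, Z (t + l) - χ l * Z t = a + b * t := by
      refine ⟨A' + e + d * l - χ l * e, B' + d - χ l * d, fun t => ?_⟩
      have := hAB' t
      simp only [hZ] at this ⊢
      linear_combination this
    -- Translations commute, so the affine defect for another period l itself has multiplier χ(l₀) ≠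
    -- 1 under l₀; this forces both of its coefficients to vanish.
    have hinv (t : ℂ) : a + b * (t + l₀) = χ l₀ * (a + b * t) := by
      rw [← hab, ← hab, add_right_comm, hZ₀, hZ₀]
      ring
    have hb : b = 0 := by
      have h2 := hinv 0
      have h3 := hinv 1
      have : (1 - χ l₀) * b = 0 := by linear_combination h3 - h2
      exact (mul_eq_zero.1 this).resolve_left h1
    have ha : a = 0 := by
      have h2 := hinv 0
      rw [hb] at h2
      have : (1 - χ l₀) * a = 0 := by linear_combination h2
      exact (mul_eq_zero.1 this).resolve_left h1
    have := hab t
    rw [ha, hb] at this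
    linear_combination this
  have haff (t : ℂ) : AnalyticAt ℂ (fun t => e + d * t) t :=
    analyticAt_const.add (analyticAt_const.mul analyticAt_id)
  have hinvneg (l : ℂ) : (χ (-l))⁻¹ = χ l := by
    have h0 : χ 0 = 1 := by
      have := hmul 0 0
      rw [add_zero] at this
      exact (mul_eq_left₀ (hne 0)).1 this.symm
    rw [inv_eq_iff_eq_inv]
    exact eq_inv_of_mul_eq_one_left (by rw [← hmul, neg_add_cancel, h0])
  -- The value 0 at the poles is compatible with the multipliers and supplies the normalization
  -- `zero_on` of polar sections.
  refine ⟨fun t => if t ∈ Λ then 0 else Z t, fun t l hl => ?_, fun t ht => ?_,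
    fun l hl => if_pos hl, fun l hl => ?_⟩
  · have hiff : t + l ∈ Λ ↔ t ∈ Λ := Submodule.add_mem_iff_left _ hl
    by_cases ht : t ∈ Λ
    · simp [hiff, ht]
    · simp [hiff, ht, hZl l hl t]
  · obtain ⟨h, hh, hh1, -⟩ := twistedZeta_local (Λ := Λ) hχ t
    refine (hh.add (haff t)).congr ?_
    filter_upwards [hh1 ht, (isClosed_of_discrete Λ).isOpen_compl.mem_nhds ht] with y hy hy'
    have hy'' : y ∉ Λ := hy'
    simp [hZ, hy, hy'']
  · obtain ⟨h, hh, -, hh1⟩ := twistedZeta_local (Λ := Λ) hχ l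
    refine ⟨fun t => h t + (e + d * t), hh.add (haff l), ?_⟩
    filter_upwards [eventually_nhdsWithin_of_eventually_nhds (hh1 hl),
      eventually_notMem_of_discrete Λ l] with y hy hy'
    rw [if_neg hy']
    simp only [hZ, hy, hinvneg]
    ring

end TwistedZeta

namespace TorusAction

variable {V : Type*} [NormedAddCommGroup V] [NormedSpace ℂ V]

/-! ### Hypertori as fibres of linear functionals modulo periods. -/

section HypertorusGeometry

variable {T : TorusAction V}

lemma exists_small_eq_zero {E : Type*} [NormedAddCommGroup E] (L : Submodule ℤ E)
    [DiscreteTopology L] : ∃ ε > 0, ∀ x ∈ L, ‖x‖ < ε → x = 0 := by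
  obtain ⟨ε, hε, h⟩ := Metric.eventually_nhds_iff.1
    (eventually_nhdsWithin_iff.1 (eventually_notMem_of_discrete L 0))
  refine ⟨ε, hε, fun x hx hxε => ?_⟩
  by_contra h0
  exact h (by simpa using hxε) h0 hx

/-- The image of the lattice under a functional. -/
def periods (T : TorusAction V) (a : V →L[ℂ] ℂ) : Submodule ℤ ℂ :=
  T.Γ.map ((a : V →ₗ[ℂ] ℂ).restrictScalars ℤ)

lemma mem_periods {a : V →L[ℂ] ℂ} {t : ℂ} : t ∈ T.periods a ↔ ∃ γ ∈ T.Γ, a γ = t := Iff.rfl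

/-- The preimage of `H` in `V` is `{a ∈ c + a(Γ)}`, and `ker a` is fixed by the stabilizer. -/
structure IsDefiningForm (T : TorusAction V) (H : Set T.X) (a : V →L[ℂ] ℂ) (c : ℂ) : Prop where
  ne_zero : a ≠ 0
  discrete : DiscreteTopology (T.periods a)
  mem_iff : ∀ z, T.proj z ∈ H ↔ a z - c ∈ T.periods a
  fix : ∀ g ∈ T.stab H, ∀ v, a v = 0 → g • v = v

/-- Every element of the pointwise stabilizer of a fibre of `a` fixes `ker a`. -/
lemma fix_of_mem_stab {H : Set T.X} {a : V →L[ℂ] ℂ} {z₀ : V}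
    (h : ∀ v, a v = 0 → T.proj (z₀ + v) ∈ H) {g : T.W} (hg : g ∈ T.stab H) {v : V} (hv : a v = 0) :
    g • v = v := by
  obtain ⟨ε, hε, hsmall⟩ := exists_small_eq_zero T.Γ
  -- All points z₀ + t v lie over H, so g moves each of them by a lattice vector. Subtracting the
  -- case t = 0 puts the whole complex line through g v - v into Γ, which discreteness forbids
  -- unless g v = v.
  have hdiff (t : ℂ) : t • (g • v - v) ∈ T.Γ := by
    have h1 := hg (z₀ + t • v) (h _ (by simp [hv]))
    have h2 := hg z₀ (by simpa using h 0 (map_zero a))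
    rw [Submodule.Quotient.eq] at h1 h2
    have h3 : t • (g • v - v) = (g • (z₀ + t • v) - (z₀ + t • v)) - (g • z₀ - z₀) := by
      have h4 : g • (t • v) = t • (g • v) := (T.lin g).map_smul t v
      rw [smul_add, h4, smul_sub]
      abel
    rw [h3]
    exact T.Γ.sub_mem h1 h2
  set w := g • v - v with hw
  have hpos : 0 < ε / (2 * (‖w‖ + 1)) := by positivity
  have h0 := hsmall _ (hdiff (ε / (2 * (‖w‖ + 1)) : ℝ)) (by
    rw [norm_smul, Complex.norm_real, Real.norm_of_nonneg hpos.le, div_mul_eq_mul_div,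
      div_lt_iff₀ (by positivity)]
    nlinarith [norm_nonneg w])
  rcases smul_eq_zero.1 h0 with h1 | h1
  · exact absurd (Complex.ofReal_eq_zero.1 h1) hpos.ne'
  · exact sub_eq_zero.1 h1

lemma exists_apply_eq_one {a : V →L[ℂ] ℂ} (ha : a ≠ 0) : ∃ w, a w = 1 := by
  obtain ⟨v, hv⟩ : ∃ v, a v ≠ 0 := by
    by_contra! h
    exact ha (ContinuousLinearMap.ext h)
  exact ⟨(a v)⁻¹ • v, by simp [hv]⟩

lemma smul_smul_complex (g : T.W) (t : ℂ) (v : V) : g • (t • v) = t • (g • v) :=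
  (T.lin g).map_smul t v

lemma IsDefiningForm.smul_sub_eq {H : Set T.X} {a : V →L[ℂ] ℂ} {c : ℂ}
    (h : T.IsDefiningForm H a c) {w : V} (hw : a w = 1) {g : T.W} (hg : g ∈ T.stab H) (v : V) :
    g • v - v = a v • (g • w - w) := by
  have := h.fix g hg (v - a v • w) (by simp [hw])
  rw [smul_sub, smul_smul_complex, sub_eq_sub_iff_sub_eq_sub] at this
  rw [this, smul_sub]

/-- On the fixed locus a takes values in the discrete group {t : t u ∈ Γ}, so it is constant modulo
periods on connected subsets. Conversely a fibre of a is an affine hyperplane, so its image in X is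
connected. -/
lemma mem_component_iff {g : T.W} {a : V →L[ℂ] ℂ} {u : V} (hgu : ∀ v, g • v - v = a v • u)
    (hd : DiscreteTopology (T.Γ.comap ((LinearMap.toSpanSingleton ℂ V u).restrictScalars ℤ)))
    (hle : T.periods a ≤ T.Γ.comap ((LinearMap.toSpanSingleton ℂ V u).restrictScalars ℤ))
    {z₀ : V} (hz₀ : T.proj z₀ ∈ T.fixedPts g) (z : V) :
    T.proj z ∈ connectedComponentIn (T.fixedPts g) (T.proj z₀) ↔ a z - a z₀ ∈ T.periods a := by
  set Λ' := T.Γ.comap ((LinearMap.toSpanSingleton ℂ V u).restrictScalars ℤ) with hΛ'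
  have hmemfix (z : V) : T.proj z ∈ T.fixedPts g ↔ a z ∈ Λ' := by
    change T.proj (g • z) = T.proj z ↔ a z • u ∈ T.Γ
    rw [Submodule.Quotient.eq, hgu]
  have hdp : DiscreteTopology (T.periods a) := DiscreteTopology.of_subset hd hle
  constructor
  · intro hz
    obtain ⟨ε, hε, hsmall⟩ := exists_small_eq_zero Λ'
    -- Over fixed points, being ε-close to a period already means differing from a(z₀) by a period.
    -- Hence the images of A and B are open sets, disjoint on the component and covering it.
    let A : Set V := {z | ∃ t ∈ T.periods a, ‖a z - a z₀ - t‖ < ε}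
    let B : Set V := {z | a z - a z₀ ∉ T.periods a}
    have hA : IsOpen A := by
      have : A = ⋃ t ∈ T.periods a, {z | ‖a z - a z₀ - t‖ < ε} := by ext; simp [A]
      rw [this]
      exact isOpen_biUnion fun t _ => isOpen_lt (by fun_prop) continuous_const
    have hB : IsOpen B :=
      (isClosed_of_discrete (T.periods a)).isOpen_compl.preimage (by fun_prop)
    have hpA := T.Γ.isOpenMap_mkQ A hA
    have hpB := T.Γ.isOpenMap_mkQ B hB
    have hpre := isPreconnected_iff_subset_of_disjoint.1
      (isPreconnected_connectedComponentIn (x := T.proj z₀) (F := T.fixedPts g)) _ _ hpA hpB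
    have hper {y y' : V} (h : T.proj y = T.proj y') : a y - a y' ∈ T.periods a := by
      rw [Submodule.Quotient.eq] at h
      exact ⟨_, h, by simp⟩
    have hAB {y y' : V} (hy : T.proj y ∈ T.fixedPts g) (hyA : y ∈ A) (hyB : y' ∈ B)
        (h : T.proj y' = T.proj y) : False := by
      obtain ⟨t, ht, hlt⟩ := hyA
      have h0 := hsmall _ (Λ'.sub_mem (Λ'.sub_mem ((hmemfix y).1 hy) ((hmemfix z₀).1 hz₀))
        (hle ht)) hlt
      refine hyB ?_
      have h2 := (T.periods a).add_mem (hper h) ht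
      rwa [← sub_eq_zero.1 h0, sub_add_sub_cancel] at h2
    have hcov : connectedComponentIn (T.fixedPts g) (T.proj z₀) ⊆ T.Γ.mkQ '' A ∪ T.Γ.mkQ '' B := by
      intro x _
      obtain ⟨y, rfl⟩ := T.Γ.mkQ_surjective x
      by_cases hy : a y - a z₀ ∈ T.periods a
      · exact Or.inl ⟨y, ⟨_, hy, by simpa using hε⟩, rfl⟩
      · exact Or.inr ⟨y, hy, rfl⟩
    have hdisj : connectedComponentIn (T.fixedPts g) (T.proj z₀) ∩ (T.Γ.mkQ '' A ∩ T.Γ.mkQ '' B) =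
        ∅ := by
      rw [Set.eq_empty_iff_forall_notMem]
      rintro x ⟨hx, ⟨y, hyA, rfl⟩, ⟨y', hyB, hy'⟩⟩
      exact hAB (connectedComponentIn_subset _ _ hx) hyA hyB hy'
    rcases hpre hcov hdisj with h | h
    · obtain ⟨y, hyA, hy⟩ := h hz
      have hyz : T.proj y = T.proj z := hy
      obtain ⟨t, ht, hlt⟩ := hyA
      have hyf : T.proj y ∈ T.fixedPts g := by
        rw [hyz]
        exact connectedComponentIn_subset _ _ hz
      have h0 := hsmall _ (Λ'.sub_mem (Λ'.sub_mem ((hmemfix y).1 hyf) ((hmemfix z₀).1 hz₀))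
        (hle ht)) hlt
      have h2 := (T.periods a).add_mem (hper hyz.symm) ht
      rwa [← sub_eq_zero.1 h0, sub_add_sub_cancel] at h2
    · exfalso
      obtain ⟨y, hyB, hy⟩ := h (mem_connectedComponentIn hz₀)
      exact hAB hz₀ ⟨0, zero_mem _, by simpa using hε⟩ hyB hy
  · rintro ⟨γ, hγ, hz⟩
    have hz' : a γ = a z - a z₀ := hz
    have hconn : IsPreconnected (T.proj '' {y | a y = a z₀}) := by
      refine IsPreconnected.image ?_ _ (continuous_quot_mk (r := _)).continuousOn
      refine Convex.isPreconnected fun x hx y hy s t _ _ hst => ?_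
      simp only [Set.mem_ofPred_eq] at hx hy ⊢
      have hr (s : ℝ) (x : V) : a (s • x) = s • a x :=
        (a.restrictScalars ℝ).map_smul s x
      rw [map_add, hr, hr, hx, hy, ← add_smul, hst, one_smul]
    refine hconn.subset_connectedComponentIn (x := T.proj z₀) ⟨z₀, rfl, rfl⟩ ?_
      ⟨z - γ, by simp [hz'], ?_⟩
    · rintro _ ⟨y, hy, rfl⟩
      have hy' : a y = a z₀ := hy
      rw [hmemfix, hy', ← hmemfix]
      exact hz₀
    · rw [Submodule.Quotient.eq]
      simpa using hγ

variable [FiniteDimensional ℂ V]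

lemma exists_bounded_representative (T : TorusAction V) :
    ∃ R : ℝ, ∀ z : V, ∃ γ ∈ T.Γ, ‖z - γ‖ ≤ R := by
  have : FiniteDimensional ℝ V := FiniteDimensional.complexToReal V
  have := ZLattice.module_free ℝ T.Γ
  have := ZLattice.module_finite ℝ T.Γ
  let b := (Module.Free.chooseBasis ℤ T.Γ).ofZLatticeBasis ℝ
  refine ⟨∑ i, ‖b i‖, fun z => ⟨ZSpan.floor b z, ?_, ZSpan.norm_fract_le b z⟩⟩
  exact (Module.Basis.ofZLatticeBasis_span ℝ T.Γ _).le (ZSpan.floor b z).2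

/-- A reflection differs from the identity by a rank one map, and the components of its fixed
points are the fibres of the corresponding functional modulo periods. -/
lemma IsReflection.exists_form {g : T.W} (hg : T.IsReflection g) :
    ∃ (a : V →L[ℂ] ℂ) (u : V), a ≠ 0 ∧ u ≠ 0 ∧ (∀ v, g • v - v = a v • u) ∧
      DiscreteTopology (T.Γ.comap ((LinearMap.toSpanSingleton ℂ V u).restrictScalars ℤ)) ∧
      T.periods a ≤ T.Γ.comap ((LinearMap.toSpanSingleton ℂ V u).restrictScalars ℤ) := by
  obtain ⟨h1, -, h3⟩ := hg
  have hr : Module.finrank ℂ (LinearMap.range (T.lin g - 1)) = 1 := by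
    have := LinearMap.finrank_range_add_finrank_ker (T.lin g - 1)
    omega
  let e : LinearMap.range (T.lin g - 1) ≃ₗ[ℂ] ℂ :=
    LinearEquiv.ofFinrankEq _ _ (by rw [hr, Module.finrank_self])
  let a₀ : V →ₗ[ℂ] ℂ := e.toLinearMap ∘ₗ (T.lin g - 1).rangeRestrict
  let u : V := (e.symm 1 : LinearMap.range (T.lin g - 1))
  have hu : u ≠ 0 := by
    intro h
    have : e.symm 1 = 0 := Subtype.ext h
    simp at this
  have hgu (v : V) : g • v - v = a₀ v • u := by
    have h4 : ((e.symm (a₀ v • 1) : LinearMap.range (T.lin g - 1)) : V) = a₀ v • u := by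
      rw [map_smul]; rfl
    rw [← h4, smul_eq_mul, mul_one]
    change _ = ((e.symm (e ((T.lin g - 1).rangeRestrict v)) : LinearMap.range (T.lin g - 1)) : V)
    rw [LinearEquiv.symm_apply_apply]
    rfl
  refine ⟨LinearMap.toContinuousLinearMap a₀, u, ?_, hu, hgu, ?_, ?_⟩
  · intro h
    apply h1
    refine Subtype.ext (LinearEquiv.ext fun v => ?_)
    have h0 : a₀ v = 0 := congrArg (fun b : V →L[ℂ] ℂ => b v) h
    have := hgu v
    rw [h0, zero_smul, sub_eq_zero] at this
    exact this
  · have : DiscreteTopology (T.Γ : Set V) := T.discrete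
    exact DiscreteTopology.preimage_of_continuous_injective (T.Γ : Set V)
      (f := fun t : ℂ => t • u) (by fun_prop) (smul_left_injective ℂ hu)
  -- For γ in Γ the vector a(γ) u equals g γ - γ, which again lies in Γ.
  · rintro _ ⟨γ, hγ, rfl⟩
    change a₀ γ • u ∈ T.Γ
    rw [← hgu]
    exact T.Γ.sub_mem (gamma_smul_mem g hγ) hγ

lemma IsHypertorus.exists_isDefiningForm {H : Set T.X} (hH : T.IsHypertorus H) :
    ∃ a c, T.IsDefiningForm H a c := by
  obtain ⟨g, hg, x, hx, rfl⟩ := hH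
  obtain ⟨z₀, rfl⟩ := T.Γ.mkQ_surjective x
  obtain ⟨a, u, ha, -, hgu, hd, hle⟩ := hg.exists_form
  have hmem := mem_component_iff hgu hd hle hx
  refine ⟨a, a z₀, ha, DiscreteTopology.of_subset hd hle, hmem, fun h hh v hv => ?_⟩
  refine fix_of_mem_stab (a := a) (z₀ := z₀) (fun v hv => ?_) hh hv
  rw [Submodule.mkQ_apply, hmem]
  simp [hv]

/-- A component of X^g is determined by the value a(z₀) at any point over it. Choosing z₀ bounded
modulo Γ confines this value to a bounded part of a discrete group, and there are finitely many
reflections. -/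
lemma finite_isHypertorus (T : TorusAction V) : {H | T.IsHypertorus H}.Finite := by
  have hsub : {H | T.IsHypertorus H} ⊆ ⋃ g : {g : T.W // T.IsReflection g},
      (fun x => connectedComponentIn (T.fixedPts g) x) '' T.fixedPts g := by
    rintro H ⟨g, hg, x, hx, rfl⟩
    exact Set.mem_iUnion.2 ⟨⟨g, hg⟩, x, hx, rfl⟩
  refine (Set.finite_iUnion fun g => ?_).subset hsub
  obtain ⟨a, u, ha, -, hgu, hd, hle⟩ := g.2.exists_form
  obtain ⟨R, hR⟩ := T.exists_bounded_representative
  set Λ' := T.Γ.comap ((LinearMap.toSpanSingleton ℂ V u).restrictScalars ℤ) with hΛ'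
  refine ((finite_norm_lt_of_discrete Λ' (‖a‖ * R + 1)).image
    fun t : Λ' => T.proj '' {z | a z - t ∈ T.periods a}).subset ?_
  rintro _ ⟨x, hx, rfl⟩
  obtain ⟨z₁, rfl⟩ := T.Γ.mkQ_surjective x
  obtain ⟨γ, hγ, hz⟩ := hR z₁
  set z₀ := z₁ - γ with hz₀
  have he : T.proj z₁ = T.proj z₀ := by
    rw [Submodule.Quotient.eq]
    simpa [hz₀] using hγ
  have hx' : T.proj z₀ ∈ T.fixedPts g.1 := by rw [← he]; exact hx
  have ht : a z₀ ∈ Λ' := by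
    have h1 : T.proj (g.1 • z₀) = T.proj z₀ := hx'
    rw [Submodule.Quotient.eq, hgu] at h1
    exact h1
  refine ⟨⟨a z₀, ht⟩, ?_, ?_⟩
  · have := a.le_opNorm z₀
    have h2 : ‖a‖ * ‖z₀‖ ≤ ‖a‖ * R := by gcongr
    change ‖a z₀‖ < _
    linarith
  · ext y
    obtain ⟨z, rfl⟩ := T.Γ.mkQ_surjective y
    change _ ↔ T.proj z ∈ connectedComponentIn (T.fixedPts g.1) (T.proj z₁)
    rw [he, mem_component_iff hgu hd hle hx']
    constructor
    · rintro ⟨z', hz', h⟩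
      have h' : T.proj z = T.proj z' := h.symm
      rw [Submodule.Quotient.eq] at h'
      have h3 : a z - a z' ∈ T.periods a := ⟨_, h', by simp⟩
      have := (T.periods a).add_mem h3 hz'
      rwa [sub_add_sub_cancel] at this
    · intro h
      exact ⟨z, h, rfl⟩

instance finite_S (T : TorusAction V) : Finite T.S := by
  have h1 : {p : Set T.X × ℕ | T.IsHypertorus p.1 ∧ 1 ≤ p.2 ∧ p.2 < T.ord p.1} ⊆
      {H | T.IsHypertorus H} ×ˢ Set.Iio (Nat.card T.W + 1) := by
    rintro ⟨H, j⟩ ⟨hH, -, hj⟩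
    refine ⟨hH, ?_⟩
    have : T.ord H ≤ Nat.card T.W := Subgroup.card_le_card_group _
    simp only [Set.mem_Iio] at hj ⊢
    omega
  exact ((T.finite_isHypertorus.prod (Set.finite_Iio _)).subset h1).to_subtype

end HypertorusGeometry

/-! ### The cyclic stabilizer of a hypertorus and its distinguished generator. -/

section Stabilizer

variable {T : TorusAction V} [FiniteDimensional ℂ V] {H : Set T.X} {a : V →L[ℂ] ℂ} {c : ℂ}

namespace IsDefiningForm

variable (h : T.IsDefiningForm H a c)
include h

/-- An element of the stabilizer has the form v ↦ v + a(v) u, with determinant 1 + a(u); applying a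
gives the eigenvalue. -/
lemma apply_smul {g : T.W} (hg : g ∈ T.stab H) (v : V) :
    a (g • v) = LinearMap.det (T.lin g) * a v := by
  obtain ⟨w, hw⟩ := exists_apply_eq_one h.ne_zero
  have h1 : T.lin g = LinearMap.transvection (a : V →ₗ[ℂ] ℂ) (g • w - w) := by
    ext v
    rw [LinearMap.transvection.apply]
    change g • v = _
    rw [← sub_eq_iff_eq_add']
    exact h.smul_sub_eq hw hg v
  have h2 : g • v = v + a v • (g • w - w) := by
    rw [← h.smul_sub_eq hw hg v]; abel
  rw [h1, LinearMap.transvection.det, h2, map_add, map_smul]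
  simp
  ring

/-- With determinant 1 the displacement u lies in `ker a`, so gⁿ w = w + n u; finite order in
characteristic zero gives u = 0. -/
lemma eq_one_of_det {g : T.W} (hg : g ∈ T.stab H) (hdet : LinearMap.det (T.lin g) = 1) :
    g = 1 := by
  obtain ⟨w, hw⟩ := exists_apply_eq_one h.ne_zero
  set u := g • w - w with hu
  have hau : a u = 0 := by
    rw [hu, map_sub, h.apply_smul hg, hdet, one_mul, sub_self]
  have hpow (n : ℕ) : g ^ n • w = w + (n : ℂ) • u := by
    induction n with
    | zero => simp
    | succ n ih =>
      rw [pow_succ', mul_smul, ih, smul_add, smul_smul_complex, h.fix g hg u hau]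
      have : g • w = w + u := by rw [hu]; abel
      rw [this]
      push_cast
      rw [add_smul, one_smul]
      abel
  have hfin := hpow (orderOf g)
  rw [pow_orderOf_eq_one, one_smul, left_eq_add] at hfin
  have hu0 : u = 0 := by
    rcases smul_eq_zero.1 hfin with h1 | h1
    · exact absurd (Nat.cast_eq_zero.1 h1) (orderOf_pos g).ne'
    · exact h1
  refine Subtype.ext (LinearEquiv.ext fun v => ?_)
  have h1 := h.smul_sub_eq hw hg v
  rw [← hu, hu0, smul_zero, sub_eq_zero] at h1
  exact h1

lemma det_injective {g g' : T.W} (hg : g ∈ T.stab H) (hg' : g' ∈ T.stab H)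
    (hdet : LinearMap.det (T.lin g) = LinearMap.det (T.lin g')) : g = g' := by
  have hmul : LinearMap.det (T.lin (g * g'⁻¹)) * LinearMap.det (T.lin g') =
      LinearMap.det (T.lin g) := by
    rw [← LinearMap.det_comp]
    congr 1
    ext v
    change (g * g'⁻¹) • (g' • v) = g • v
    rw [mul_smul, inv_smul_smul]
  have hne : LinearMap.det (T.lin g') ≠ 0 := (LinearEquiv.isUnit_det' (g' : V ≃ₗ[ℂ] V)).ne_zero
  rw [hdet, mul_eq_right₀ hne] at hmul
  exact mul_inv_eq_one.1 (h.eq_one_of_det (mul_mem hg (inv_mem hg')) hmul)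

/-- The determinant embeds the finite stabilizer in a field, so the group is cyclic and a generator
has as determinant a primitive root of unity of order `T.ord H`. A power of it therefore has the
prescribed determinant. -/
lemma exists_gen : ∃ g : T.W, g ∈ T.stab H ∧
    LinearMap.det (T.lin g) = Complex.exp (2 * Real.pi * Complex.I / T.ord H) := by
  let f : T.stab H →* ℂ :=
    { toFun := fun g => LinearMap.det (T.lin g)
      map_one' := LinearMap.det_id
      map_mul' := fun g g' => LinearMap.det_comp (T.lin g) (T.lin g') }
  have hf : Function.Injective f := fun g g' hgg => Subtype.ext (h.det_injective g.2 g'.2 hgg)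
  have : IsCyclic (T.stab H) := isCyclic_of_injective_ringHom f hf
  obtain ⟨s, hs⟩ := IsCyclic.exists_ofOrder_eq_natCard (α := T.stab H)
  have hn : T.ord H ≠ 0 := Nat.card_pos.ne'
  have hprim : IsPrimitiveRoot (f s) (T.ord H) := by
    have : orderOf (f s) = T.ord H := by rw [orderOf_injective f hf, hs]; rfl
    rw [← this]
    exact IsPrimitiveRoot.orderOf _
  have : NeZero (T.ord H) := ⟨hn⟩
  obtain ⟨i, -, hi⟩ := hprim.eq_pow_of_pow_eq_one (Complex.isPrimitiveRoot_exp _ hn).pow_eq_one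
  refine ⟨(s ^ i : T.stab H), (s ^ i).2, ?_⟩
  have := map_pow f s i
  rw [hi] at this
  exact this

lemma gen_spec : T.gen H ∈ T.stab H ∧
    LinearMap.det (T.lin (T.gen H)) = Complex.exp (2 * Real.pi * Complex.I / T.ord H) :=
  Classical.epsilon_spec h.exists_gen

lemma gen_unique {g : T.W} (hg : g ∈ T.stab H)
    (hdet : LinearMap.det (T.lin g) = Complex.exp (2 * Real.pi * Complex.I / T.ord H)) :
    g = T.gen H :=
  h.det_injective hg h.gen_spec.1 (hdet.trans h.gen_spec.2.symm)

lemma smul_eq_self_iff {g : T.W} (hg : g ∈ T.stab H) (h1 : g ≠ 1) (v : V) :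
    g • v = v ↔ a v = 0 := by
  refine ⟨fun hv => ?_, h.fix g hg v⟩
  have h2 := h.apply_smul hg v
  rw [hv] at h2
  by_contra h3
  exact h1 (h.eq_one_of_det hg (mul_right_cancel₀ h3 (by rw [one_mul]; exact h2.symm)))

end IsDefiningForm

lemma elt_mem_stab (p : T.S) : T.elt p ∈ T.stab p.1.1 := by
  obtain ⟨a, c, h⟩ := p.2.1.exists_isDefiningForm
  exact pow_mem h.gen_spec.1 _

lemma det_elt (p : T.S) : LinearMap.det (T.lin (T.elt p)) =
    Complex.exp (2 * Real.pi * Complex.I / T.ord p.1.1) ^ p.1.2 := by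
  obtain ⟨a, c, h⟩ := p.2.1.exists_isDefiningForm
  rw [← h.gen_spec.2, ← map_pow]
  congr 1
  ext v
  have (n : ℕ) (v : V) : (T.gen p.1.1 ^ n) • v = (T.lin (T.gen p.1.1) ^ n) v := by
    induction n generalizing v with
    | zero => simp
    | succ n ih => rw [pow_succ, mul_smul, ih, pow_succ]; rfl
  exact this _ v

lemma elt_ne_one (p : T.S) : T.elt p ≠ 1 := by
  obtain ⟨⟨H, j⟩, hH, h1, h2⟩ := p
  intro he
  have hdet := det_elt (T := T) ⟨⟨H, j⟩, hH, h1, h2⟩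
  rw [he] at hdet
  have hprim := Complex.isPrimitiveRoot_exp (T.ord H) (by simp at h2; omega)
  refine hprim.pow_ne_one_of_pos_of_lt (by simp at h1; omega) h2 ?_
  rw [← hdet]
  exact LinearMap.det_id

lemma gen_ne_one (p : T.S) : T.gen p.1.1 ≠ 1 := by
  intro h
  apply elt_ne_one p
  rw [elt, h, one_pow]

lemma elt_fix_iff {p : T.S} (h : T.IsDefiningForm p.1.1 a c) (v : V) :
    T.elt p • v = v ↔ a v = 0 :=
  h.smul_eq_self_iff (elt_mem_stab p) (elt_ne_one p) v

lemma gen_fix_iff {p : T.S} (h : T.IsDefiningForm p.1.1 a c) (v : V) :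
    T.gen p.1.1 • v = v ↔ a v = 0 :=
  h.smul_eq_self_iff h.gen_spec.1 (gen_ne_one p) v

end Stabilizer

end TorusAction

/-! ### Riemann's removable singularity theorem on a line. -/

section EntireExtension

open Filter

/-- A function on `ℂ` all of whose singularities are isolated and removable agrees, where it is
continuous, with an entire function. -/
lemma exists_entire_extension {F : ℂ → ℂ} (hd : ∀ t₀, ∀ᶠ t in 𝓝[≠] t₀, DifferentiableAt ℂ F t)
    (ho : ∀ t₀, Tendsto (fun t => (t - t₀) * F t) (𝓝[≠] t₀) (𝓝 0)) :
    ∃ E : ℂ → ℂ, Differentiable ℂ E ∧ ∀ t, ContinuousAt F t → E t = F t := by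
  have hE (t : ℂ) (ht : ContinuousAt F t) : limUnder (𝓝[≠] t) F = F t :=
    (ht.tendsto.mono_left nhdsWithin_le_nhds).limUnder_eq
  refine ⟨fun t => limUnder (𝓝[≠] t) F, fun t₀ => ?_, hE⟩
  have h1 := hd t₀
  rw [eventually_nhdsWithin_iff] at h1
  -- The hypothesis (t - t₀) F(t) → 0, put in the little-o form required by Riemann's theorem.
  have hlit : (fun z => F z - F t₀) =o[𝓝[≠] t₀] fun z => (z - t₀)⁻¹ := by
    refine (Asymptotics.isLittleO_iff_tendsto' ?_).2 ?_
    · filter_upwards [self_mem_nhdsWithin] with z hz h0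
      exact absurd (inv_eq_zero.1 h0) (sub_ne_zero.2 hz)
    · have h2 : Tendsto (fun z => (z - t₀) * F z - (z - t₀) * F t₀) (𝓝[≠] t₀) (𝓝 (0 - 0)) := by
        refine (ho t₀).sub ?_
        have : Tendsto (fun z => (z - t₀) * F t₀) (𝓝 t₀) (𝓝 ((t₀ - t₀) * F t₀)) :=
          ((continuous_id.sub continuous_const).mul continuous_const).tendsto t₀
        rw [sub_self, zero_mul] at this
        exact this.mono_left nhdsWithin_le_nhds
      rw [sub_zero] at h2
      refine h2.congr fun z => ?_
      rw [div_inv_eq_mul]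
      ring
  have h3 := Complex.differentiableOn_update_limUnder_of_isLittleO h1
    (fun z hz => (hz.1 hz.2).differentiableWithinAt) hlit
  refine (h3.differentiableAt h1).congr_of_eventuallyEq ?_
  filter_upwards [h1] with z hz
  by_cases hzt : z = t₀
  · simp [hzt]
  · rw [Function.update_of_ne hzt]
    exact hE z (hz hzt).continuousAt

end EntireExtension

/-! ### A Liouville theorem for multiplier functions off a periodic hyperplane arrangement. -/

section Liouville

open Filter

variable {V : Type*} [NormedAddCommGroup V] [NormedSpace ℂ V]

lemma dense_apply_ne {b : V →L[ℂ] ℂ} (hb : b ≠ 0) (c : ℂ) : Dense {z | b z ≠ c} := by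
  obtain ⟨w, hw⟩ := TorusAction.exists_apply_eq_one hb
  intro z
  by_cases hz : b z = c
  · have hcont : Tendsto (fun t : ℂ => z + t • w) (𝓝[≠] 0) (𝓝 z) := by
      have : Tendsto (fun t : ℂ => z + t • w) (𝓝 0) (𝓝 (z + (0 : ℂ) • w)) :=
        (by fun_prop : Continuous fun t : ℂ => z + t • w).tendsto 0
      rw [zero_smul, add_zero] at this
      exact this.mono_left nhdsWithin_le_nhds
    refine mem_closure_of_tendsto hcont ?_
    filter_upwards [self_mem_nhdsWithin] with t ht
    simpa [hw, hz] using ht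
  · exact subset_closure hz

namespace TorusAction

variable {T : TorusAction V}

section Arrangement

variable {ι : Type*} {a : ι → V →L[ℂ] ℂ} {c : ι → ℂ}

/-- The complement of the translates `{a i = c i + a i γ}`, `γ ∈ Γ`, of hyperplanes. -/
def arrCompl (T : TorusAction V) (a : ι → V →L[ℂ] ℂ) (c : ι → ℂ) : Set V :=
  {z | ∀ i, a i z - c i ∉ T.periods (a i)}

lemma apply_gamma_mem_periods (b : V →L[ℂ] ℂ) {γ : V} (hγ : γ ∈ T.Γ) : b γ ∈ T.periods b :=
  ⟨γ, hγ, rfl⟩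

lemma add_gamma_sub_mem_periods_iff (b : V →L[ℂ] ℂ) (d : ℂ) (z : V) {γ : V} (hγ : γ ∈ T.Γ) :
    b (z + γ) - d ∈ T.periods b ↔ b z - d ∈ T.periods b := by
  rw [map_add, add_sub_right_comm]
  exact Submodule.add_mem_iff_left _ (apply_gamma_mem_periods b hγ)

/-- The points `z` such that the line `z + ℂ v` meets no intersection of two hyperplanes. -/
def genericPts (T : TorusAction V) (a : ι → V →L[ℂ] ℂ) (c : ι → ℂ) (v : V) : Set V :=
  {z | ∀ i j, i ≠ j → ∀ t : ℂ, a i (z + t • v) - c i ∈ T.periods (a i) →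
    a j (z + t • v) - c j ∉ T.periods (a j)}

lemma add_smul_mem_genericPts {v z : V} (hz : z ∈ T.genericPts a c v) (t : ℂ) :
    z + t • v ∈ T.genericPts a c v := by
  intro i j hij s hi
  rw [add_assoc, ← add_smul] at hi ⊢
  exact hz i j hij _ hi

variable [Finite ι]

lemma isOpen_arrCompl (hd : ∀ i, DiscreteTopology (T.periods (a i))) :
    IsOpen (T.arrCompl a c) := by
  have : T.arrCompl a c = ⋂ i, {z | a i z - c i ∉ T.periods (a i)} := by
    ext; simp [arrCompl]
  rw [this]
  refine isOpen_iInter_of_finite fun i => ?_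
  have := hd i
  exact (isClosed_of_discrete (T.periods (a i))).isOpen_compl.preimage (by fun_prop)

/-- A direction v with a_i(v) ≠ 0 makes a_i injective on the line, which therefore meets the
arrangement only in isolated points. -/
lemma eventually_mem_arrCompl (hd : ∀ i, DiscreteTopology (T.periods (a i))) (z : V) {v : V}
    (hv : ∀ i, a i v ≠ 0) (t₀ : ℂ) : ∀ᶠ t in 𝓝[≠] t₀, z + t • v ∈ T.arrCompl a c := by
  refine eventually_all.2 fun i => ?_
  have := hd i
  have hmap : Tendsto (fun t : ℂ => a i (z + t • v) - c i) (𝓝[≠] t₀)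
      (𝓝[≠] (a i (z + t₀ • v) - c i)) := by
    refine tendsto_nhdsWithin_iff.2 ⟨?_, ?_⟩
    · exact ((by fun_prop : Continuous fun t : ℂ => a i (z + t • v) - c i).tendsto t₀).mono_left
        nhdsWithin_le_nhds
    · filter_upwards [self_mem_nhdsWithin] with t ht
      simp only [map_add, map_smul, smul_eq_mul, Set.mem_compl_iff, Set.mem_singleton_iff,
        sub_left_inj, add_right_inj, mul_eq_mul_right_iff, not_or]
      exact ⟨ht, hv i⟩
  exact hmap.eventually (eventually_notMem_of_discrete _ _)

variable [FiniteDimensional ℂ V]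

lemma dense_forall_apply_ne {s : Set ((V →L[ℂ] ℂ) × ℂ)} (hs : s.Countable)
    (h0 : ∀ q ∈ s, q.1 ≠ 0) : Dense {z | ∀ q ∈ s, q.1 z ≠ q.2} := by
  have : CompleteSpace V := FiniteDimensional.complete ℂ V
  have heq : {z | ∀ q ∈ s, q.1 z ≠ q.2} = ⋂ q ∈ s, {z | q.1 z ≠ q.2} := by ext; simp
  rw [heq]
  exact dense_biInter_of_isOpen (fun q _ => isOpen_ne_fun (by fun_prop) continuous_const) hs
    fun q hq => dense_apply_ne (h0 q hq) _

instance countable_gamma (T : TorusAction V) : Countable T.Γ := by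
  have : FiniteDimensional ℝ V := FiniteDimensional.complexToReal V
  have := FiniteDimensional.proper ℂ V
  have : SecondCountableTopology V := inferInstance
  exact countable_of_Lindelof_of_discrete

/-- Eliminating t from the equations of two hyperplanes leaves one affine equation on z. There are
countably many pairs, so Baire's theorem applies as long as each equation has a nonzero linear part.
-/
lemma dense_genericPts {v : V} (hv : ∀ i, a i v ≠ 0)
    (hind : ∀ i j, i ≠ j → ∀ z, a i z - c i ∈ T.periods (a i) → a j z - c j ∈ T.periods (a j) →
      ∃ k, a i k = 0 ∧ a j k ≠ 0) : Dense (T.genericPts a c v) := by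
  let f : ι × ι × T.Γ × T.Γ → (V →L[ℂ] ℂ) × ℂ := fun q =>
    (a q.2.1 v • a q.1 - a q.1 v • a q.2.1,
      a q.2.1 v * (c q.1 + a q.1 q.2.2.1) - a q.1 v * (c q.2.1 + a q.2.1 q.2.2.2))
  -- Pairs with zero linear part come from proportional functionals. They may be dropped: by `hind`
  -- two such hyperplanes never meet.
  have hcount : ((Set.range f) \ {q | q.1 = 0}).Countable :=
    (Set.countable_range f).mono Set.sdiff_subset
  refine (dense_forall_apply_ne hcount fun q hq => hq.2).mono fun z hz i j hij t hi hj => ?_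
  obtain ⟨k, hk, hk'⟩ := hind i j hij _ hi hj
  obtain ⟨γ, hγ, hi'⟩ := hi
  obtain ⟨γ', hγ', hj'⟩ := hj
  have hi2 : a i γ = a i (z + t • v) - c i := hi'
  have hj2 : a j γ' = a j (z + t • v) - c j := hj'
  refine hz (f (i, j, ⟨γ, hγ⟩, ⟨γ', hγ'⟩)) ⟨⟨_, rfl⟩, fun h0 => ?_⟩ ?_
  · have := congrArg (fun b : V →L[ℂ] ℂ => b k) h0
    simp only [f, sub_apply, smul_apply, smul_eq_mul, hk,
      zero_apply, mul_zero, zero_sub, neg_eq_zero, mul_eq_zero] at this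
    exact this.elim (hv i) hk'
  · simp only [f, hi2, hj2, map_add, map_smul, sub_apply,
      smul_apply, smul_eq_mul]
    ring

variable {ω : V → ℂ} {χ : V → ℂ}

/-- A function with unitary multipliers whose only singularities are removable along generic lines
is constant along generic lines. -/
lemma apply_add_eq_of_removable (hd : ∀ i, DiscreteTopology (T.periods (a i)))
    (hind : ∀ i j, i ≠ j → ∀ z, a i z - c i ∈ T.periods (a i) → a j z - c j ∈ T.periods (a j) →
      ∃ k, a i k = 0 ∧ a j k ≠ 0)
    (hχ : ∀ v, ‖χ v‖ = 1) (hmul : ∀ z, ∀ γ ∈ T.Γ, ω (z + γ) = χ γ * ω z)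
    (han : ∀ z ∈ T.arrCompl a c, AnalyticAt ℂ ω z)
    (hrem : ∀ i z₀ v, a i z₀ - c i ∈ T.periods (a i) →
      (∀ j, j ≠ i → a j z₀ - c j ∉ T.periods (a j)) → (∀ j, a j v ≠ 0) →
      Tendsto (fun t : ℂ => t * ω (z₀ + t • v)) (𝓝[≠] 0) (𝓝 0))
    {v : V} (hv : ∀ i, a i v ≠ 0) {z : V} (hz : z ∈ T.arrCompl a c)
    (hzv : z + v ∈ T.arrCompl a c) : ω (z + v) = ω z := by
  have := FiniteDimensional.proper ℂ V
  set G := T.genericPts a c v with hG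
  set D := T.arrCompl a c with hD
  have hDo : IsOpen D := isOpen_arrCompl hd
  have hline (z : V) (t : ℂ) (h : z + t • v ∈ D) :
      DifferentiableAt ℂ (fun t : ℂ => ω (z + t • v)) t :=
    (han _ h).differentiableAt.comp t (by fun_prop)
  -- A generic line meets at most one family i at any of its points, so every singularity of the
  -- restriction is covered by `hrem` and the restriction extends to an entire function.
  have hext (z : V) (hz : z ∈ G) : ∃ E : ℂ → ℂ, Differentiable ℂ E ∧
      ∀ t, z + t • v ∈ D → E t = ω (z + t • v) := by
    have hlim (t₀ : ℂ) : Tendsto (fun t : ℂ => (t - t₀) * ω (z + t • v)) (𝓝[≠] t₀) (𝓝 0) := by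
      by_cases ht : z + t₀ • v ∈ D
      · have h1 : ContinuousAt (fun t : ℂ => (t - t₀) * ω (z + t • v)) t₀ :=
          ((continuous_id.sub continuous_const).continuousAt).mul (hline z t₀ ht).continuousAt
        have h2 := h1.tendsto
        simp only [sub_self, zero_mul] at h2
        exact h2.mono_left nhdsWithin_le_nhds
      · obtain ⟨i, hi⟩ : ∃ i, a i (z + t₀ • v) - c i ∈ T.periods (a i) := by
          by_contra! h
          exact ht h
        have h1 := hrem i _ v hi (fun j hj => hz i j (Ne.symm hj) t₀ hi) hv
        have h2 : Tendsto (fun t : ℂ => t - t₀) (𝓝[≠] t₀) (𝓝[≠] 0) := by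
          refine tendsto_nhdsWithin_iff.2 ⟨?_, ?_⟩
          · have : Tendsto (fun t : ℂ => t - t₀) (𝓝 t₀) (𝓝 (t₀ - t₀)) :=
              (continuous_id.sub continuous_const).tendsto t₀
            rw [sub_self] at this
            exact this.mono_left nhdsWithin_le_nhds
          · filter_upwards [self_mem_nhdsWithin] with t ht
            exact sub_ne_zero.2 ht
        refine (h1.comp h2).congr fun t => ?_
        simp only [Function.comp_apply]
        rw [add_assoc, ← add_smul, add_sub_cancel]
    obtain ⟨E, hE, hE'⟩ := exists_entire_extension (F := fun t : ℂ => ω (z + t • v))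
      (fun t₀ => (eventually_mem_arrCompl hd z hv t₀).mono fun t ht => hline z t ht) hlim
    exact ⟨E, hE, fun t ht => hE' t (hline z t ht).continuousAt⟩
  -- A small circle in z₀ + ℂ v avoids the arrangement, and so does a thickening of it, on which ω
  -- is bounded. For generic z near z₀ the maximum principle for the entire extension carries this
  -- bound from the parallel circle to z.
  have hlocal (z₀ : V) : ∃ s ∈ 𝓝 z₀, ∃ C : ℝ, ∀ z ∈ s, z ∈ G → z ∈ D → ‖ω z‖ ≤ C := by
    obtain ⟨ε, hε, hball⟩ := Metric.eventually_nhds_iff.1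
      (eventually_nhdsWithin_iff.1 (eventually_mem_arrCompl (c := c) hd z₀ hv 0))
    set r := ε / 2 with hr
    have hr0 : 0 < r := half_pos hε
    set S : Set V := (fun t : ℂ => z₀ + t • v) '' Metric.sphere 0 r with hS
    have hSc : IsCompact S := (isCompact_sphere 0 r).image (by fun_prop)
    have hSD : S ⊆ D := by
      rintro _ ⟨t, ht, rfl⟩
      have ht' : ‖t‖ = r := by simpa using ht
      refine hball (y := t) ?_ ?_
      · rw [dist_zero_right, ht']
        linarith
      · intro h0
        have h0' : t = 0 := h0
        rw [h0', norm_zero] at ht'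
        linarith
    obtain ⟨δ, hδ, hthick⟩ := hSc.exists_cthickening_subset_open hDo hSD
    obtain ⟨C, hC⟩ := (hSc.cthickening (r := δ)).exists_bound_of_continuousOn (f := ω)
      fun y hy => (han y (hthick hy)).continuousAt.continuousWithinAt
    refine ⟨Metric.closedBall z₀ δ, Metric.closedBall_mem_nhds _ hδ, C, fun z hz hzG hzD => ?_⟩
    obtain ⟨E, hE, hE'⟩ := hext z hzG
    have h0 : E 0 = ω z := by simpa using hE' 0 (by simpa using hzD)
    rw [← h0]
    refine Complex.norm_le_of_forall_mem_frontier_norm_le (U := Metric.ball 0 r)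
      Metric.isBounded_ball hE.diffContOnCl (fun t ht => ?_) (subset_closure (by simpa using hr0))
    rw [frontier_ball _ hr0.ne'] at ht
    have hmem : z + t • v ∈ Metric.cthickening δ S := by
      refine Metric.mem_cthickening_of_dist_le _ (z₀ + t • v) _ _ ⟨t, ht, rfl⟩ ?_
      rw [dist_add_right]
      exact hz
    rw [hE' t (hthick hmem)]
    exact hC _ hmem
  -- The multipliers have modulus 1, so |ω| is Γ-periodic, and a compact ball representing all
  -- classes gives a global bound.
  obtain ⟨C, hC⟩ : ∃ C : ℝ, ∀ z ∈ G, z ∈ D → ‖ω z‖ ≤ C := by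
    obtain ⟨R, hR⟩ := T.exists_bounded_representative
    obtain ⟨C, hC⟩ : ∃ C : ℝ, ∀ z ∈ Metric.closedBall (0 : V) R, z ∈ G → z ∈ D → ‖ω z‖ ≤ C := by
      refine (isCompact_closedBall (0 : V) R).induction_on
        (p := fun s => ∃ C : ℝ, ∀ z ∈ s, z ∈ G → z ∈ D → ‖ω z‖ ≤ C) ⟨0, by simp⟩ ?_ ?_ ?_
      · rintro s t hst ⟨C, hC⟩
        exact ⟨C, fun z hz => hC z (hst hz)⟩
      · rintro s t ⟨C, hC⟩ ⟨C', hC'⟩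
        exact ⟨max C C', fun z hz h1 h2 => hz.elim
          (fun h => (hC z h h1 h2).trans (le_max_left _ _))
          (fun h => (hC' z h h1 h2).trans (le_max_right _ _))⟩
      · intro z₀ _
        obtain ⟨s, hs, hs'⟩ := hlocal z₀
        exact ⟨s, mem_nhdsWithin_of_mem_nhds hs, hs'⟩
    refine ⟨C, fun z hzG hzD => ?_⟩
    obtain ⟨γ, hγ, hle⟩ := hR z
    have hz' : z = (z - γ) + γ := by abel
    have hG' : z - γ ∈ G := by
      intro i j hij t
      have h1 := hzG i j hij t
      have h2 : z + t • v = (z - γ + t • v) + γ := by abel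
      rwa [h2, add_gamma_sub_mem_periods_iff _ _ _ hγ, add_gamma_sub_mem_periods_iff _ _ _ hγ] at h1
    have hD' : z - γ ∈ D := by
      intro i
      have h1 := hzD i
      rwa [hz', add_gamma_sub_mem_periods_iff _ _ _ hγ] at h1
    rw [hz', hmul _ γ hγ, norm_mul, hχ, one_mul]
    exact hC _ (by simpa using hle) hG' hD'
  have hconst (z : V) (hzG : z ∈ G) (hzD : z ∈ D) (hzv : z + v ∈ D) : ω (z + v) = ω z := by
    obtain ⟨E, hE, hE'⟩ := hext z hzG
    have hb (t₀ : ℂ) : ‖E t₀‖ ≤ C := by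
      refine le_of_tendsto (b := C) (x := 𝓝[≠] t₀) ((hE.continuous.norm.tendsto t₀).mono_left nhdsWithin_le_nhds) ?_
      filter_upwards [eventually_mem_arrCompl hd z hv t₀] with t ht
      rw [hE' t ht]
      exact hC _ (add_smul_mem_genericPts hzG t) ht
    have h1 := hE.apply_eq_apply_of_bounded
      (isBounded_iff_forall_norm_le.2 ⟨C, by rintro _ ⟨t, rfl⟩; exact hb t⟩) 1 0
    rw [hE' 1 (by simpa using hzv), hE' 0 (by simpa using hzD)] at h1
    simpa using h1
  -- Liouville on generic lines gives equality only for generic z; continuity and the density of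
  -- generic points extend it.
  have hcont : ContinuousAt (fun y => ω (y + v) - ω y) z := by
    refine ContinuousAt.sub ?_ (han z hz).continuousAt
    exact ContinuousAt.comp (g := ω) (f := fun y => y + v) (han _ hzv).continuousAt
      (by fun_prop)
  have hne : (𝓝[G] z).NeBot := mem_closure_iff_nhdsWithin_neBot.1 (dense_genericPts hv hind z)
  have hlim := hcont.tendsto.mono_left (nhdsWithin_le_nhds (s := G))
  have hzero : ∀ᶠ y in 𝓝[G] z, ω (y + v) - ω y = 0 := by
    have h1 : ∀ᶠ y in 𝓝[G] z, y ∈ D := mem_nhdsWithin_of_mem_nhds (hDo.mem_nhds hz)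
    have h2 : ∀ᶠ y in 𝓝[G] z, y + v ∈ D := mem_nhdsWithin_of_mem_nhds
      ((by fun_prop : Continuous fun y : V => y + v).continuousAt.eventually (hDo.mem_nhds hzv))
    filter_upwards [h1, h2, self_mem_nhdsWithin] with y hy hy' hyG
    rw [hconst y hyG hy hy', sub_self]
  have := tendsto_nhds_unique hlim (tendsto_const_nhds.congr' (hzero.mono fun y hy => hy.symm))
  exact sub_eq_zero.1 this

/-- A function with nontrivial unitary multipliers whose only singularities are removable along
generic lines is zero. -/
theorem eq_zero_of_removable (ha : ∀ i, a i ≠ 0)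
    (hd : ∀ i, DiscreteTopology (T.periods (a i)))
    (hind : ∀ i j, i ≠ j → ∀ z, a i z - c i ∈ T.periods (a i) → a j z - c j ∈ T.periods (a j) →
      ∃ k, a i k = 0 ∧ a j k ≠ 0)
    (hχ : ∀ v, ‖χ v‖ = 1) (hnt : ∃ γ ∈ T.Γ, χ γ ≠ 1)
    (hmul : ∀ z, ∀ γ ∈ T.Γ, ω (z + γ) = χ γ * ω z)
    (han : ∀ z ∈ T.arrCompl a c, AnalyticAt ℂ ω z)
    (hrem : ∀ i z₀ v, a i z₀ - c i ∈ T.periods (a i) →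
      (∀ j, j ≠ i → a j z₀ - c j ∉ T.periods (a j)) → (∀ j, a j v ≠ 0) →
      Tendsto (fun t : ℂ => t * ω (z₀ + t • v)) (𝓝[≠] 0) (𝓝 0))
    {z : V} (hz : z ∈ T.arrCompl a c) : ω z = 0 := by
  obtain ⟨γ, hγ, hγ1⟩ := hnt
  -- Two points are compared through a third, z₃, chosen so that both directions towards it are
  -- transversal to all the hyperplanes.
  have hconst (z₁ z₂ : V) (h₁ : z₁ ∈ T.arrCompl a c) (h₂ : z₂ ∈ T.arrCompl a c) :
      ω z₁ = ω z₂ := by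
    let f : ι × T.Γ → (V →L[ℂ] ℂ) × ℂ := fun q => (a q.1, c q.1 + a q.1 q.2)
    have hcount : (Set.range f ∪ (Set.range (fun i => (a i, a i z₁)) ∪
        Set.range (fun i => (a i, a i z₂)))).Countable :=
      (Set.countable_range f).union ((Set.countable_range _).union (Set.countable_range _))
    obtain ⟨z₃, h₃⟩ := (dense_forall_apply_ne hcount (by
      rintro q (⟨i, rfl⟩ | ⟨i, rfl⟩ | ⟨i, rfl⟩)
      exacts [ha _, ha _, ha _])).nonempty
    have hz₃ : z₃ ∈ T.arrCompl a c := by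
      rintro i ⟨γ, hγ, h⟩
      have h' : a i γ = a i z₃ - c i := h
      exact h₃ (f (i, ⟨γ, hγ⟩)) (Or.inl ⟨_, rfl⟩) (by simp [f, h'])
    have key (y : V) (hy : y ∈ T.arrCompl a c) (hne : ∀ i, a i z₃ ≠ a i y) : ω z₃ = ω y := by
      have := apply_add_eq_of_removable hd hind hχ hmul han hrem (v := z₃ - y)
        (fun i => by rw [map_sub]; exact sub_ne_zero.2 (hne i)) hy (by simpa using hz₃)
      simpa using this
    rw [← key z₁ h₁ fun i => h₃ _ (Or.inr (Or.inl ⟨i, rfl⟩)),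
      key z₂ h₂ fun i => h₃ _ (Or.inr (Or.inr ⟨i, rfl⟩))]
  -- A constant with multiplier χ(γ) ≠ 1 is zero.
  have h1 : ω (z + γ) = ω z := hconst _ _ (fun i => by
    rw [add_gamma_sub_mem_periods_iff _ _ _ hγ]
    exact hz i) hz
  rw [hmul z γ hγ] at h1
  by_contra h0
  exact hγ1 (mul_eq_right₀ h0 |>.1 h1)

end Arrangement

end TorusAction

end Liouville

namespace TorusAction

open Filter

variable {V : Type*} [NormedAddCommGroup V] [NormedSpace ℂ V]

/-! ### The characters χ_α and the action of W on them. -/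

section Characters

variable {T : TorusAction V}

lemma chi_add_right (α : AntiDual V) (u v : V) : chi α (u + v) = chi α u * chi α v := by
  simp only [chi, omega, map_add, Complex.add_im, ← Complex.exp_add]
  push_cast
  ring_nf

lemma chi_add_left (α β : AntiDual V) (v : V) : chi (α + β) v = chi α v * chi β v := by
  simp only [chi, omega, LinearMap.add_apply, Complex.add_im, ← Complex.exp_add]
  push_cast
  ring_nf

lemma norm_chi (α : AntiDual V) (v : V) : ‖chi α v‖ = 1 := by
  rw [chi, Complex.norm_exp]
  simp

lemma chi_ne_zero (α : AntiDual V) (v : V) : chi α v ≠ 0 := Complex.exp_ne_zero _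

lemma chi_neg_left (α : AntiDual V) (v : V) : chi (-α) v = (chi α v)⁻¹ := by
  simp [chi, omega, ← Complex.exp_neg]

lemma chi_sub_left (α β : AntiDual V) (v : V) : chi (α - β) v = chi α v / chi β v := by
  rw [sub_eq_add_neg, chi_add_left, chi_neg_left, div_eq_mul_inv]

lemma dualAct_apply (w : T.W) (α : AntiDual V) (v : V) : dualAct w α v = α (w⁻¹ • v) := rfl

lemma chi_dualAct (w : T.W) (α : AntiDual V) (v : V) : chi (dualAct w α) v = chi α (w⁻¹ • v) := rfl

lemma dualAct_mul (g h : T.W) (α : AntiDual V) :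
    dualAct (g * h) α = dualAct g (dualAct h α) := by
  ext v
  simp [dualAct_apply, mul_smul]

lemma dualAct_sub (g : T.W) (α β : AntiDual V) :
    dualAct g (α - β) = dualAct g α - dualAct g β := rfl

lemma dualAct_neg (g : T.W) (α : AntiDual V) : dualAct g (-α) = -dualAct g α := rfl

/-- The stabilizer of the line bundle `L_α` in `W` is trivial. -/
def IsGeneric (T : TorusAction V) (α : AntiDual V) : Prop :=
  ∀ w : T.W, w ≠ 1 → ∃ γ ∈ T.Γ, chi (α - dualAct w α) γ ≠ 1

lemma isGeneric_of_notMem_dualLattice {α : AntiDual V}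
    (hα : ∀ w : T.W, w ≠ 1 → dualAct w α - α ∉ T.dualLattice) : T.IsGeneric α := by
  intro w hw
  have h := hα w hw
  simp only [dualLattice, Set.mem_ofPred_eq, not_forall] at h
  obtain ⟨γ, hγ, h⟩ := h
  refine ⟨γ, hγ, fun h1 => h ?_⟩
  rw [chi, Complex.exp_eq_one_iff] at h1
  obtain ⟨n, hn⟩ := h1
  refine ⟨-n, ?_⟩
  have h2 : (omega (α - dualAct w α) γ : ℂ) = n := by
    have : (2 * Real.pi * Complex.I : ℂ) ≠ 0 := Complex.two_pi_I_ne_zero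
    rw [mul_comm] at hn
    exact mul_right_cancel₀ this hn
  have h3 : omega (dualAct w α - α) γ = -omega (α - dualAct w α) γ := by simp [omega]
  rw [h3]
  push_cast
  rw [neg_inj]
  exact_mod_cast h2

lemma IsGeneric.dualAct {α : AntiDual V} (hα : T.IsGeneric α) (g : T.W) :
    T.IsGeneric (TorusAction.dualAct g α) := by
  intro w hw
  obtain ⟨γ, hγ, h⟩ := hα (g⁻¹ * w * g) (by
    intro h
    apply hw
    rw [mul_assoc, inv_mul_eq_one] at h
    exact right_eq_mul.1 h)
  refine ⟨g • γ, gamma_smul_mem g hγ, ?_⟩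
  rwa [← dualAct_mul, chi_sub_left, chi_dualAct, chi_dualAct, inv_smul_smul, ← mul_smul,
    show (w * g)⁻¹ * g = (g⁻¹ * w * g)⁻¹ by group, ← chi_dualAct, ← chi_sub_left]

/-- This identifies the multiplier character of a polar section, evaluated at z₀, with the constant
describing the trivialization in its residue condition. -/
lemma chi_sub_dualAct (α : AntiDual V) (g : T.W) (v : V) :
    chi (α - dualAct g α) v = chi α (v - g⁻¹ • v) := by
  simp [chi, omega, dualAct_apply]

end Characters

/-! ### Existence and uniqueness of polar sections. -/

section PolarSections

variable {T : TorusAction V} [FiniteDimensional ℂ V]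

lemma hasDefiningForm (p : T.S) : ∃ a c, T.IsDefiningForm p.1.1 a c := p.2.1.exists_isDefiningForm

/-- Functions of one variable with simple poles along the coset `c + a(Γ)`. -/
structure IsPolarFunction (T : TorusAction V) (a : V →L[ℂ] ℂ) (c : ℂ) (ψ : ℂ → ℂ) : Prop where
  analyticAt : ∀ t, t - c ∉ T.periods a → AnalyticAt ℂ ψ t
  pole : ∀ t, t - c ∈ T.periods a → ∃ h : ℂ → ℂ, AnalyticAt ℂ h t ∧
    ∀ᶠ s in 𝓝[≠] t, (s - t) * ψ s = h s

/-- The section is χ(c) ψ(a(z) - c) a, with ψ the twisted zeta function for the period group of a.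
Its nontriviality condition is the genericity of α applied to the element g_H^j ≠ 1. -/
lemma exists_isPolarSection {α : AntiDual V} (hα : T.IsGeneric α) {p : T.S} {a : V →L[ℂ] ℂ} {c : ℂ}
    (h : T.IsDefiningForm p.1.1 a c) :
    ∃ ψ, T.IsPolarFunction a c ψ ∧ IsPolarSection α p fun z => ψ (a z) • a := by
  obtain ⟨w, hw⟩ := exists_apply_eq_one h.ne_zero
  set g := T.elt p with hg
  set χ : ℂ → ℂ := fun t => chi (α - dualAct g α) (t • w) with hχ
  -- The element g fixes `ker a`, on which the character is therefore trivial, so the character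
  -- descends along a.
  have hχv (v : V) : chi (α - dualAct g α) v = χ (a v) := by
    have h0 : g⁻¹ • (v - a v • w) = v - a v • w := by
      rw [inv_smul_eq_iff, eq_comm, elt_fix_iff h]
      simp [hw]
    have h1 : v = (v - a v • w) + a v • w := by abel
    have h2 : chi (α - dualAct g α) (v - a v • w) = 1 := by
      rw [chi_sub_dualAct, h0, sub_self]
      simp [chi, omega]
    conv_lhs => rw [h1, chi_add_right, h2, one_mul]
  have hχmul (s t : ℂ) : χ (s + t) = χ s * χ t := by
    simp only [hχ, add_smul, chi_add_right]
  have := h.discrete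
  obtain ⟨ψ, hψ, hψan, hψ0, hψp⟩ := exists_twisted_zeta (Λ := T.periods a) (χ := χ)
    (fun t => norm_chi _ _) hχmul (by
      obtain ⟨γ, hγ, hne⟩ := hα g (elt_ne_one p)
      exact ⟨a γ, ⟨γ, hγ, rfl⟩, by rwa [← hχv]⟩)
  have hshift (t : ℂ) : AnalyticAt ℂ (fun t => t - c) t := analyticAt_id.sub analyticAt_const
  -- The factor χ(c) makes the residue at t equal to χ(c) χ(t - c) = χ(t), as the trivialization
  -- requires.
  have hpole (t : ℂ) (ht : t - c ∈ T.periods a) : ∃ h : ℂ → ℂ, AnalyticAt ℂ h t ∧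
      h t = χ t ∧ ∀ᶠ s in 𝓝 t, s ≠ t → (s - t) * (χ c * ψ (s - c)) = h s := by
    obtain ⟨h, hh, hh'⟩ := hψp _ ht
    refine ⟨fun s => χ c * (χ (t - c) + (s - t) * h (s - c)), ?_, ?_, ?_⟩
    · exact analyticAt_const.mul (analyticAt_const.add
        ((analyticAt_id.sub analyticAt_const).mul (AnalyticAt.fun_comp hh (hshift t))))
    · simp only [sub_self, zero_mul, add_zero, ← hχmul, add_sub_cancel]
    · have hmap : Tendsto (fun s : ℂ => s - c) (𝓝 t) (𝓝 (t - c)) := (hshift t).continuousAt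
      rw [eventually_nhdsWithin_iff] at hh'
      filter_upwards [hmap.eventually hh'] with s hs hne
      have hne' : s - t ≠ 0 := sub_ne_zero.2 hne
      rw [hs (by simpa using hne)]
      have : s - c - (t - c) = s - t := by ring
      rw [this]
      field_simp
  refine ⟨fun t => χ c * ψ (t - c), ⟨fun t ht => ?_, fun t ht => ?_⟩, ?_, ?_, ?_, ?_, ?_⟩
  · exact analyticAt_const.mul (AnalyticAt.fun_comp (hψan _ ht) (hshift t))
  · obtain ⟨h, hh, -, hh'⟩ := hpole t ht
    exact ⟨h, hh, eventually_nhdsWithin_iff.2 hh'⟩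
  · intro z v hv
    rw [gen_fix_iff h] at hv
    simp [hv]
  · intro z γ hγ
    have h1 : a (z + γ) - c = a z - c + a γ := by rw [map_add]; ring
    simp only [h1]
    rw [hχv, hψ _ _ (apply_gamma_mem_periods a hγ), smul_smul, mul_left_comm]
  · intro z hz
    rw [h.mem_iff] at hz
    have h1 : AnalyticAt ℂ (fun z => χ c * ψ (a z - c)) z :=
      analyticAt_const.mul (AnalyticAt.fun_comp (hψan _ hz) ((a.analyticAt z).sub analyticAt_const))
    exact h1.smul analyticAt_const
  · intro z₀ hz₀ a' ha'
    rw [h.mem_iff] at hz₀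
    -- Functionals vanishing on the fixed hyperplane are multiples of a, so the residue condition
    -- need only be checked for a.
    have ha'' : a' = a' w • a := by
      ext v
      have : a' (v - a v • w) = 0 := ha' _ ((gen_fix_iff h _).2 (by simp [hw]))
      rw [map_sub, map_smul, sub_eq_zero] at this
      simp [this, mul_comm]
    obtain ⟨h', hh', hval, hev⟩ := hpole _ hz₀
    refine ⟨fun z => (a' w * h' (a z)) • a, ?_, ?_, ?_⟩
    · exact (analyticAt_const.mul (AnalyticAt.fun_comp hh' (a.analyticAt z₀))).smul analyticAt_const
    · filter_upwards [a.continuous.continuousAt.eventually hev] with z hz hzH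
      rw [h.mem_iff] at hzH
      have hne : a z ≠ a z₀ := fun he => hzH (by rwa [he])
      rw [← hz hne, smul_smul]
      congr 1
      rw [ha'']
      simp [hw]
      ring
    · simp only
      rw [hval, ← hχv, chi_sub_dualAct]
      conv_rhs => rw [ha'']
      rw [smul_smul, mul_comm]
  · intro z hz
    rw [h.mem_iff] at hz
    change (χ c * ψ (a z - c)) • a = 0
    rw [hψ0 _ hz, mul_zero]
    exact zero_smul ℂ a

/-- Equal residues make the singularity of the difference removable, and its multiplier is
nontrivial, so the Liouville theorem applies with a one-member arrangement. Both forms are multiples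
of a, hence evaluating at one vector w with a(w) = 1 suffices. -/
theorem isPolarSection_unique {α : AntiDual V} (hα : T.IsGeneric α) {p : T.S}
    {f₁ f₂ : V → V →L[ℂ] ℂ} (h₁ : IsPolarSection α p f₁) (h₂ : IsPolarSection α p f₂) :
    f₁ = f₂ := by
  obtain ⟨a, c, h⟩ := hasDefiningForm p
  obtain ⟨w, hw⟩ := exists_apply_eq_one h.ne_zero
  have hmem (z : V) : z ∈ T.arrCompl (fun _ : Unit => a) (fun _ => c) ↔ T.proj z ∉ p.1.1 := by
    simp [arrCompl, h.mem_iff]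
  have hzero (z : V) (hz : T.proj z ∉ p.1.1) : (f₁ z - f₂ z) w = 0 := by
    refine eq_zero_of_removable (T := T) (ι := Unit) (a := fun _ => a) (c := fun _ => c)
      (ω := fun z => (f₁ z - f₂ z) w) (χ := chi (α - dualAct (T.elt p) α)) (fun _ => h.ne_zero)
      (fun _ => h.discrete) (fun i j hij => absurd rfl hij) (norm_chi _)
      (hα _ (elt_ne_one p)) ?_ ?_ ?_ ((hmem z).2 hz)
    · intro z γ hγ
      simp only [h₁.multiplier z γ hγ, h₂.multiplier z γ hγ, sub_apply, smul_apply, smul_eq_mul]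
      ring
    · intro z hz
      have hd := (h₁.holomorphic z ((hmem z).1 hz)).sub (h₂.holomorphic z ((hmem z).1 hz))
      exact ((ContinuousLinearMap.apply ℂ ℂ w).analyticAt _).comp hd
    · intro _ z₀ v hz₀ _ hv
      have hz₀' : T.proj z₀ ∈ p.1.1 := (h.mem_iff z₀).2 hz₀
      have ha (v : V) (hv : T.gen p.1.1 • v = v) : a v = 0 := (gen_fix_iff h v).1 hv
      obtain ⟨β₁, hβ₁, he₁, hv₁⟩ := h₁.residue z₀ hz₀' a ha
      obtain ⟨β₂, hβ₂, he₂, hv₂⟩ := h₂.residue z₀ hz₀' a ha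
      have hv' : a v ≠ 0 := hv ()
      have hline : Tendsto (fun t : ℂ => z₀ + t • v) (𝓝[≠] 0) (𝓝 z₀) := by
        have : Tendsto (fun t : ℂ => z₀ + t • v) (𝓝 0) (𝓝 (z₀ + (0 : ℂ) • v)) :=
          (by fun_prop : Continuous fun t : ℂ => z₀ + t • v).tendsto 0
        rw [zero_smul, add_zero] at this
        exact this.mono_left nhdsWithin_le_nhds
      have hb : ContinuousAt (fun z => (a v)⁻¹ * (β₁ z - β₂ z) w) z₀ := by
        have := hβ₁.continuousAt
        have := hβ₂.continuousAt
        fun_prop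
      have hlim := hb.tendsto.comp hline
      simp only [hv₁, hv₂, sub_self, zero_apply, mul_zero] at hlim
      refine hlim.congr' ?_
      have hoff := eventually_mem_arrCompl (T := T) (ι := Unit) (a := fun _ => a) (c := fun _ => c)
        (fun _ => h.discrete) z₀ (v := v) hv 0
      filter_upwards [hline.eventually he₁, hline.eventually he₂, hoff] with t h1 h2 h3
      rw [hmem] at h3
      simp only [Function.comp_apply, ← h1 h3, ← h2 h3, add_sub_cancel_left, map_smul, smul_eq_mul,
        sub_apply, smul_apply]
      field_simp
  funext z
  by_cases hz : T.proj z ∈ p.1.1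
  · rw [h₁.zero_on z hz, h₂.zero_on z hz]
  · ext v
    have hk (f : V → V →L[ℂ] ℂ) (hf : IsPolarSection α p f) : f z v = a v * f z w := by
      have : f z (v - a v • w) = 0 := hf.mem_dual z _ ((gen_fix_iff h _).2 (by simp [hw]))
      rw [map_sub, map_smul, sub_eq_zero] at this
      exact this
    rw [hk f₁ h₁, hk f₂ h₂]
    have := hzero z hz
    rw [sub_apply, sub_eq_zero] at this
    rw [this]

lemma isPolarSection_polarSection {α : AntiDual V} (hα : T.IsGeneric α) (p : T.S) :
    IsPolarSection α p (polarSection α p) := by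
  obtain ⟨a, c, h⟩ := hasDefiningForm p
  obtain ⟨ψ, -, hψ⟩ := exists_isPolarSection hα h
  exact Classical.epsilon_spec (p := IsPolarSection α p) ⟨_, hψ⟩

lemma polarSection_eq_of {α : AntiDual V} (hα : T.IsGeneric α) {p : T.S} {f : V → V →L[ℂ] ℂ}
    (hf : IsPolarSection α p f) : polarSection α p = f :=
  isPolarSection_unique hα (isPolarSection_polarSection hα p) hf

/-- A polar section is the pullback of a one-variable form. -/
lemma exists_polarSection_eq {α : AntiDual V} (hα : T.IsGeneric α) {p : T.S} {a : V →L[ℂ] ℂ} {c : ℂ}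
    (h : T.IsDefiningForm p.1.1 a c) :
    ∃ ψ, T.IsPolarFunction a c ψ ∧ ∀ z, polarSection α p z = ψ (a z) • a := by
  obtain ⟨ψ, hψ, hψ'⟩ := exists_isPolarSection hα h
  exact ⟨ψ, hψ, fun z => by rw [polarSection_eq_of hα hψ']⟩

end PolarSections

end TorusAction

namespace TorusAction

open Filter

variable {V : Type*} [NormedAddCommGroup V] [NormedSpace ℂ V] {T : TorusAction V}

/-! ### Equivariance of hypertori, generators and polar sections. -/

section ActionOnHypertori

lemma act_act (g h : T.W) (x : T.X) : T.act g (T.act h x) = T.act (g * h) x := by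
  obtain ⟨z, rfl⟩ := T.Γ.mkQ_surjective x
  change T.proj (g • (h • z)) = T.proj ((g * h) • z)
  rw [mul_smul]

lemma act_one (x : T.X) : T.act 1 x = x := by
  obtain ⟨z, rfl⟩ := T.Γ.mkQ_surjective x
  change T.proj ((1 : T.W) • z) = T.proj z
  rw [one_smul]

lemma act_image_image (g h : T.W) (H : Set T.X) :
    T.act g '' (T.act h '' H) = T.act (g * h) '' H := by
  rw [Set.image_image]
  simp only [act_act]

lemma act_image_one (H : Set T.X) : T.act 1 '' H = H := by
  simp only [act_one, Set.image_id']

lemma proj_mem_act_image (g : T.W) (H : Set T.X) (z : V) :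
    T.proj z ∈ T.act g '' H ↔ T.proj (g⁻¹ • z) ∈ H := by
  constructor
  · rintro ⟨x, hx, h⟩
    have h1 := congrArg (T.act g⁻¹) h
    rw [act_act, inv_mul_cancel, act_one] at h1
    rwa [h1, act_proj] at hx
  · intro h
    exact ⟨_, h, by rw [act_proj, smul_inv_smul]⟩

lemma mem_stab_act_image (g h : T.W) (H : Set T.X) :
    h ∈ T.stab (T.act g '' H) ↔ g⁻¹ * h * g ∈ T.stab H := by
  constructor
  · intro hh z hz
    have h1 := hh (g • z) (by rw [proj_mem_act_image, inv_smul_smul]; exact hz)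
    have h2 := congrArg (T.act g⁻¹) h1
    simpa [act_proj, mul_smul] using h2
  · intro hh z hz
    rw [proj_mem_act_image] at hz
    have h1 := congrArg (T.act g) (hh _ hz)
    simpa [act_proj, mul_smul] using h1

lemma ord_act_image (g : T.W) (H : Set T.X) : T.ord (T.act g '' H) = T.ord H := by
  refine Nat.card_congr ((MulAut.conj g⁻¹).toEquiv.subtypeEquiv fun h => ?_)
  change h ∈ T.stab _ ↔ g⁻¹ * h * g⁻¹⁻¹ ∈ T.stab H
  rw [mem_stab_act_image, inv_inv]

lemma det_lin_conj (g h : T.W) :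
    LinearMap.det (T.lin (g * h * g⁻¹)) = LinearMap.det (T.lin h) := by
  rw [← LinearMap.det_conj (T.lin h) (g : V ≃ₗ[ℂ] V)]
  rfl

variable [FiniteDimensional ℂ V]

lemma continuous_act (g : T.W) : Continuous (T.act g) :=
  continuous_quot_lift _ (continuous_quot_mk.comp (continuous_smul g))

/-- The action of `g` as a homeomorphism of the torus. -/
def actHomeo (g : T.W) : T.X ≃ₜ T.X where
  toFun := T.act g
  invFun := T.act g⁻¹
  left_inv x := by rw [act_act, inv_mul_cancel, act_one]
  right_inv x := by rw [act_act, mul_inv_cancel, act_one]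
  continuous_toFun := continuous_act g
  continuous_invFun := continuous_act g⁻¹

lemma IsHypertorus.act_image {H : Set T.X} (hH : T.IsHypertorus H) (g : T.W) :
    T.IsHypertorus (T.act g '' H) := by
  obtain ⟨r, hr, x, hx, rfl⟩ := hH
  have hfix : T.act g '' T.fixedPts r = T.fixedPts (g * r * g⁻¹) := by
    ext y
    constructor
    · rintro ⟨x, hx, rfl⟩
      change T.act r x = x at hx
      change T.act _ (T.act g x) = T.act g x
      conv_rhs => rw [← hx]
      rw [act_act, act_act, inv_mul_cancel_right]
    · intro hy
      refine ⟨T.act g⁻¹ y, ?_, ?_⟩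
      · change T.act r (T.act g⁻¹ y) = _
        change T.act _ y = y at hy
        conv_rhs => rw [← hy]
        rw [act_act, act_act]
        congr 1
        group
      · rw [act_act, mul_inv_cancel, act_one]
  refine ⟨g * r * g⁻¹, isReflection_conj g r hr, T.act g x, hfix ▸ ⟨x, hx, rfl⟩, ?_⟩
  rw [← hfix]
  exact (actHomeo g).image_connectedComponentIn hx

/-- Conjugation carries stabilizers to stabilizers and keeps both order and determinant, which
characterize the generator. -/
lemma gen_act_image {H : Set T.X} (hH : T.IsHypertorus H) (g : T.W) :
    T.gen (T.act g '' H) = g * T.gen H * g⁻¹ := by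
  obtain ⟨a, c, h⟩ := hH.exists_isDefiningForm
  obtain ⟨a', c', h'⟩ := (hH.act_image g).exists_isDefiningForm
  refine (h'.gen_unique ?_ ?_).symm
  · rw [mem_stab_act_image]
    convert h.gen_spec.1 using 1
    group
  · rw [det_lin_conj, h.gen_spec.2, ord_act_image]

/-- The action of `W` on `S`, `g (H, j) = (g H, j)`. -/
def actS (g : T.W) (p : T.S) : T.S :=
  ⟨(T.act g '' p.1.1, p.1.2), p.2.1.act_image g, p.2.2.1, by rw [ord_act_image]; exact p.2.2.2⟩

lemma elt_actS (g : T.W) (p : T.S) : T.elt (actS g p) = g * T.elt p * g⁻¹ := by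
  change T.gen (T.act g '' p.1.1) ^ p.1.2 = g * T.gen p.1.1 ^ p.1.2 * g⁻¹
  rw [gen_act_image p.2.1, conj_pow]

/-- The action of `g` on `S` as a permutation. -/
def actSEquiv (g : T.W) : T.S ≃ T.S where
  toFun := actS g
  invFun := actS g⁻¹
  left_inv p := Subtype.ext (Prod.ext (by
    change T.act g⁻¹ '' (T.act g '' p.1.1) = p.1.1
    rw [act_image_image, inv_mul_cancel, act_image_one]) rfl)
  right_inv p := Subtype.ext (Prod.ext (by
    change T.act g '' (T.act g⁻¹ '' p.1.1) = p.1.1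
    rw [act_image_image, mul_inv_cancel, act_image_one]) rfl)

/-- `g` as a continuous linear map. -/
def clin (g : T.W) : V →L[ℂ] V := (T.lin g).toContinuousLinearMap

lemma clin_apply (g : T.W) (v : V) : clin g v = g • v := rfl

/-- With uniqueness this turns into the equivariance formula for the chosen sections. The residue
constant is preserved because χ_{gα} at z₀ - (g k g⁻¹)⁻¹ z₀ is χ_α at g⁻¹ z₀ - k⁻¹ g⁻¹ z₀. -/
lemma IsPolarSection.transport {α : AntiDual V} {p : T.S} {f : V → V →L[ℂ] ℂ}
    (hf : IsPolarSection α p f) (g : T.W) :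
    IsPolarSection (dualAct g α) (actS g p) fun z => (f (g⁻¹ • z)).comp (clin g⁻¹) := by
  have hgen : T.gen (actS g p).1.1 = g * T.gen p.1.1 * g⁻¹ := gen_act_image p.2.1 g
  have hgenfix (v : V) : T.gen (actS g p).1.1 • v = v ↔ T.gen p.1.1 • (g⁻¹ • v) = g⁻¹ • v := by
    rw [hgen, mul_smul, mul_smul, smul_eq_iff_eq_inv_smul]
  have hH (z : V) : T.proj z ∈ (actS g p).1.1 ↔ T.proj (g⁻¹ • z) ∈ p.1.1 :=
    proj_mem_act_image g _ z
  have hlin (z : V) : AnalyticAt ℂ (fun z : V => g⁻¹ • z) z := (clin g⁻¹).analyticAt z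
  have hcomp (β : V → V →L[ℂ] ℂ) (z : V) (hβ : AnalyticAt ℂ β (g⁻¹ • z)) :
      AnalyticAt ℂ (fun z => (β (g⁻¹ • z)).comp (clin g⁻¹)) z :=
    (((ContinuousLinearMap.compL ℂ V V ℂ).flip (clin g⁻¹)).analyticAt _).comp
      (hβ.fun_comp (hlin z))
  refine ⟨fun z v hv => hf.mem_dual _ _ ((hgenfix v).1 hv), fun z γ hγ => ?_, fun z hz => ?_,
    fun z₀ hz₀ a ha => ?_, fun z hz => ?_⟩
  · have h1 : dualAct (T.elt (actS g p)) (dualAct g α) = dualAct g (dualAct (T.elt p) α) := by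
      rw [← dualAct_mul, elt_actS, inv_mul_cancel_right, dualAct_mul]
    simp only [smul_add]
    rw [hf.multiplier _ _ (gamma_smul_mem g⁻¹ hγ), h1, ← dualAct_sub, chi_dualAct]
    rfl
  · exact hcomp f z (hf.holomorphic _ (by rwa [hH] at hz))
  · obtain ⟨β, hβ, hev, hval⟩ := hf.residue (g⁻¹ • z₀) (by rwa [hH] at hz₀) (a.comp (clin g))
      fun v hv => ha _ (by
        change T.gen (actS g p).1.1 • (g • v) = g • v
        rw [hgenfix, inv_smul_smul, hv])
    refine ⟨fun z => (β (g⁻¹ • z)).comp (clin g⁻¹), hcomp β z₀ hβ, ?_, ?_⟩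
    · filter_upwards [(continuous_smul g⁻¹).continuousAt.eventually hev] with z hz hzH
      rw [hH] at hzH
      rw [← hz hzH]
      have : a.comp (clin g) (g⁻¹ • z - g⁻¹ • z₀) = a (z - z₀) := by
        rw [ContinuousLinearMap.comp_apply, clin_apply, ← smul_sub, smul_inv_smul]
      rw [this]
      rfl
    · simp only [hval]
      ext v
      simp only [ContinuousLinearMap.comp_apply, smul_apply, clin_apply, smul_inv_smul]
      congr 1
      rw [chi_dualAct, elt_actS]
      congr 1
      rw [smul_sub]
      congr 1
      simp only [← mul_smul]
      congr 1
      group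
  · rw [hH] at hz
    simp only [hf.zero_on _ hz, ContinuousLinearMap.zero_comp]

lemma polarSection_actS {α : AntiDual V} (hα : T.IsGeneric α) (g : T.W) (p : T.S) (z v : V) :
    polarSection (dualAct g α) (actS g p) (g • z) (g • v) = polarSection α p z v := by
  rw [polarSection_eq_of (hα.dualAct g) ((isPolarSection_polarSection hα p).transport g)]
  simp [clin_apply]

end ActionOnHypertori

/-! ### The coefficients F_{C,g}: equivariance, multipliers, direction. -/

section DunklCoefficients

instance fintypeW (T : TorusAction V) : Fintype T.W := Fintype.ofFinite _

variable [FiniteDimensional ℂ V]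

instance fintypeS (T : TorusAction V) : Fintype T.S := Fintype.ofFinite _

open Classical in
lemma dunklCoeff_eq (C : T.S → ℂ) (α : AntiDual V) (g : T.W) (z : V) :
    dunklCoeff C α g z = ∑ p : T.S with T.elt p = g, C p • polarSection α p z := by
  rw [dunklCoeff, finsum_eq_sum_of_fintype, Finset.sum_filter]
  simp only [finsum_eq_if]

open Classical in
lemma dunklCoeff_apply (C : T.S → ℂ) (α : AntiDual V) (g : T.W) (z v : V) :
    dunklCoeff C α g z v = ∑ p : T.S, if T.elt p = g then C p * polarSection α p z v else 0 := by
  rw [dunklCoeff_eq, ← Finset.sum_filter, sum_apply]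
  rfl

/-- The action of g permutes S and conjugates the elements g_H^j, so invariance of C makes the two
sums agree term by term. -/
lemma dunklCoeff_smul {C : T.S → ℂ} (hC : T.IsInvariant C) {α : AntiDual V} (hα : T.IsGeneric α)
    (g h : T.W) (z v : V) :
    dunklCoeff C (dualAct g α) (g * h * g⁻¹) (g • z) (g • v) = dunklCoeff C α h z v := by
  classical
  rw [dunklCoeff_apply, dunklCoeff_apply, ← (actSEquiv g).sum_comp]
  refine Finset.sum_congr rfl fun p _ => ?_
  change (if T.elt (actS g p) = _ then C (actS g p) * polarSection _ (actS g p) _ _ else 0) = _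
  rw [polarSection_actS hα, elt_actS, hC g p (actS g p) rfl rfl]
  simp only [mul_left_inj, mul_right_inj]

lemma dunklCoeff_add_gamma (C : T.S → ℂ) {α : AntiDual V} (hα : T.IsGeneric α) (g : T.W) (z : V)
    {γ : V} (hγ : γ ∈ T.Γ) :
    dunklCoeff C α g (z + γ) = chi (α - dualAct g α) γ • dunklCoeff C α g z := by
  classical
  rw [dunklCoeff_eq, dunklCoeff_eq, Finset.smul_sum]
  refine Finset.sum_congr rfl fun p hp => ?_
  rw [(isPolarSection_polarSection hα p).multiplier z γ hγ, (Finset.mem_filter.1 hp).2, smul_comm]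

/-- The generator g_H and its nontrivial power g have the same fixed space `ker a`, so all summands
vanish there. -/
lemma dunklCoeff_apply_eq_zero (C : T.S → ℂ) {α : AntiDual V} (hα : T.IsGeneric α) {g : T.W}
    (z : V) {v : V} (hv : g • v = v) : dunklCoeff C α g z v = 0 := by
  classical
  rw [dunklCoeff_apply]
  refine Finset.sum_eq_zero fun p _ => ?_
  split_ifs with hp
  · obtain ⟨a, c, h⟩ := hasDefiningForm p
    rw [(isPolarSection_polarSection hα p).mem_dual, mul_zero]
    rw [gen_fix_iff h, ← elt_fix_iff h, hp, hv]
  · rfl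

lemma dunklCoeff_eq_zero_of_ne (C : T.S → ℂ) (α : AntiDual V) {g : T.W}
    (hg : ∀ p : T.S, T.elt p ≠ g) (z v : V) : dunklCoeff C α g z v = 0 := by
  classical
  rw [dunklCoeff_apply]
  exact Finset.sum_eq_zero fun p _ => if_neg (hg p)

/-- Functionals vanishing on the fixed space of a reflection are proportional. -/
lemma mul_eq_mul_of_fix {p : T.S} {b b' : V →ₗ[ℂ] ℂ}
    (hb : ∀ v, T.elt p • v = v → b v = 0) (hb' : ∀ v, T.elt p • v = v → b' v = 0) (u v : V) :
    b u * b' v = b v * b' u := by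
  obtain ⟨a, c, h⟩ := hasDefiningForm p
  obtain ⟨w, hw⟩ := exists_apply_eq_one h.ne_zero
  have key (L : V →ₗ[ℂ] ℂ) (hL : ∀ v, T.elt p • v = v → L v = 0) (v : V) : L v = a v * L w := by
    have := hL (v - a v • w) ((elt_fix_iff h _).2 (by simp [hw]))
    rwa [map_sub, map_smul, sub_eq_zero] at this
  rw [key b hb u, key b hb v, key b' hb' u, key b' hb' v]
  ring

end DunklCoefficients

end TorusAction

namespace TorusAction

open Filter

variable {V : Type*} [NormedAddCommGroup V] [NormedSpace ℂ V] {T : TorusAction V}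

/-! ### Wedge products of functionals and limits along lines. -/

/-- The wedge product of two functionals, evaluated at `u, v`. -/
def wedge (b b' : V →L[ℂ] ℂ) (u v : V) : ℂ := b u * b' v - b v * b' u

lemma wedge_add_left (b₁ b₂ b' : V →L[ℂ] ℂ) (u v : V) :
    wedge (b₁ + b₂) b' u v = wedge b₁ b' u v + wedge b₂ b' u v := by
  simp only [wedge, add_apply]; ring

lemma wedge_add_right (b b₁ b₂ : V →L[ℂ] ℂ) (u v : V) :
    wedge b (b₁ + b₂) u v = wedge b b₁ u v + wedge b b₂ u v := by
  simp only [wedge, add_apply]; ring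

lemma wedge_smul_left (r : ℂ) (b b' : V →L[ℂ] ℂ) (u v : V) :
    wedge (r • b) b' u v = r * wedge b b' u v := by
  simp only [wedge, smul_apply, smul_eq_mul]; ring

lemma wedge_smul_right (r : ℂ) (b b' : V →L[ℂ] ℂ) (u v : V) :
    wedge b (r • b') u v = r * wedge b b' u v := by
  simp only [wedge, smul_apply, smul_eq_mul]; ring

lemma wedge_swap (b b' : V →L[ℂ] ℂ) (u v : V) : wedge b b' u v = -wedge b' b u v := by
  simp only [wedge]; ring

lemma wedge_self (b : V →L[ℂ] ℂ) (u v : V) : wedge b b u v = 0 := by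
  simp only [wedge]; ring

lemma wedge_zero_right (b : V →L[ℂ] ℂ) (u v : V) : wedge b 0 u v = 0 := by
  simp [wedge]

lemma analyticAt_wedge {b b' : V → V →L[ℂ] ℂ} {z : V} (hb : AnalyticAt ℂ b z)
    (hb' : AnalyticAt ℂ b' z) (u v : V) : AnalyticAt ℂ (fun z => wedge (b z) (b' z) u v) z := by
  have hev (b : V → V →L[ℂ] ℂ) (hb : AnalyticAt ℂ b z) (v : V) :
      AnalyticAt ℂ (fun z => b z v) z := ((ContinuousLinearMap.apply ℂ ℂ v).analyticAt _).comp hb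
  exact ((hev b hb u).mul (hev b' hb' v)).sub ((hev b hb v).mul (hev b' hb' u))

lemma tendsto_add_smul (z v : V) : Tendsto (fun t : ℂ => z + t • v) (𝓝[≠] 0) (𝓝 z) := by
  have : Tendsto (fun t : ℂ => z + t • v) (𝓝 0) (𝓝 (z + (0 : ℂ) • v)) :=
    (by fun_prop : Continuous fun t : ℂ => z + t • v).tendsto 0
  rw [zero_smul, add_zero] at this
  exact this.mono_left nhdsWithin_le_nhds

lemma tendsto_wedge {b b' : V →L[ℂ] ℂ} {f f' : ℂ → V →L[ℂ] ℂ} (hf : Tendsto f (𝓝[≠] 0) (𝓝 b))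
    (hf' : Tendsto f' (𝓝[≠] 0) (𝓝 b')) (u v : V) :
    Tendsto (fun t => wedge (f t) (f' t) u v) (𝓝[≠] 0) (𝓝 (wedge b b' u v)) := by
  have hev {f : ℂ → V →L[ℂ] ℂ} {b : V →L[ℂ] ℂ} (hf : Tendsto f (𝓝[≠] 0) (𝓝 b)) (v : V) :
      Tendsto (fun t => f t v) (𝓝[≠] 0) (𝓝 (b v)) :=
    ((ContinuousLinearMap.apply ℂ ℂ v).continuous.tendsto b).comp hf
  exact ((hev hf u).mul (hev hf' v)).sub ((hev hf v).mul (hev hf' u))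

/-! ### The arrangement of all reflection hypertori. -/

section HypertorusForms

variable [FiniteDimensional ℂ V]

/-- A functional defining the hypertorus `H`. -/
def hform (H : {H : Set T.X // T.IsHypertorus H}) : V →L[ℂ] ℂ := H.2.exists_isDefiningForm.choose

/-- The value of `hform H` on the preimage of `H`, modulo periods. -/
def hconst (H : {H : Set T.X // T.IsHypertorus H}) : ℂ :=
  H.2.exists_isDefiningForm.choose_spec.choose

lemma isDefiningForm_hform (H : {H : Set T.X // T.IsHypertorus H}) :
    T.IsDefiningForm H.1 (hform H) (hconst H) :=
  H.2.exists_isDefiningForm.choose_spec.choose_spec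

instance finite_hypertori (T : TorusAction V) : Finite {H : Set T.X // T.IsHypertorus H} :=
  T.finite_isHypertorus.to_subtype

lemma mem_arrCompl_hform (z : V) : z ∈ T.arrCompl (hform (T := T)) hconst ↔ T.proj z ∈ T.reg := by
  constructor
  · intro h H hH hz
    exact h ⟨H, hH⟩ (((isDefiningForm_hform ⟨H, hH⟩).mem_iff z).1 hz)
  · intro h H hz
    exact h H.1 H.2 (((isDefiningForm_hform H).mem_iff z).2 hz)

/-- If the two functionals were proportional, both hypertori would have the preimage z + `ker` + Γ
and so coincide. This is the independence hypothesis of the Liouville theorem. -/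
lemma exists_hform_ne_zero (H₁ H₂ : {H : Set T.X // T.IsHypertorus H}) (hne : H₁ ≠ H₂) (z : V)
    (h₁ : hform H₁ z - hconst H₁ ∈ T.periods (hform H₁))
    (h₂ : hform H₂ z - hconst H₂ ∈ T.periods (hform H₂)) :
    ∃ k, hform H₁ k = 0 ∧ hform H₂ k ≠ 0 := by
  by_contra! hk
  apply hne
  have hd₁ := isDefiningForm_hform H₁
  have hd₂ := isDefiningForm_hform H₂
  have hk' (k : V) (h0 : hform H₂ k = 0) : hform H₁ k = 0 := by
    obtain ⟨w, hw⟩ := exists_apply_eq_one hd₂.ne_zero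
    obtain ⟨w', hw'⟩ := exists_apply_eq_one hd₁.ne_zero
    have h1 (v : V) : hform H₂ v = hform H₁ v * hform H₂ w' := by
      have := hk (v - hform H₁ v • w') (by simp [hw'])
      rwa [map_sub, map_smul, sub_eq_zero] at this
    have h2 := h1 w
    rw [hw] at h2
    rw [h1] at h0
    exact (mul_eq_zero.1 h0).resolve_right fun h => by rw [h, mul_zero] at h2; exact one_ne_zero h2
  have hcoset (H : {H : Set T.X // T.IsHypertorus H})
      (h : hform H z - hconst H ∈ T.periods (hform H)) (y : V) :
      T.proj y ∈ H.1 ↔ ∃ γ ∈ T.Γ, hform H (y - z - γ) = 0 := by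
    rw [(isDefiningForm_hform H).mem_iff]
    have h1 : hform H y - hconst H = (hform H y - hform H z) + (hform H z - hconst H) := by ring
    rw [h1, Submodule.add_mem_iff_left _ h, mem_periods]
    refine exists_congr fun γ => and_congr_right fun _ => ?_
    rw [map_sub, map_sub, sub_eq_zero, eq_comm]
  refine Subtype.ext (Set.ext fun x => ?_)
  obtain ⟨y, rfl⟩ := T.Γ.mkQ_surjective x
  change T.proj y ∈ H₁.1 ↔ T.proj y ∈ H₂.1
  rw [hcoset H₁ h₁, hcoset H₂ h₂]
  exact exists_congr fun γ => and_congr_right fun _ => ⟨hk _, hk' _⟩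

end HypertorusForms

/-! ### Vanishing of the quadratic part of the curvature. -/

section Flatness

variable [FiniteDimensional ℂ V] {α : AntiDual V} {C : T.S → ℂ}

lemma analyticAt_dunklCoeff (C : T.S → ℂ) (hα : T.IsGeneric α) (g : T.W) {z : V}
    (hz : T.proj z ∈ T.reg) : AnalyticAt ℂ (dunklCoeff C α g) z := by
  classical
  have h : dunklCoeff C α g = fun z => ∑ p : T.S with T.elt p = g, C p • polarSection α p z :=
    funext fun z => dunklCoeff_eq C α g z
  rw [h]
  exact Finset.analyticAt_fun_sum _ fun p _ => AnalyticAt.fun_smul analyticAt_const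
    ((isPolarSection_polarSection hα p).holomorphic z (hz _ p.2.1))

open Classical in
/-- The part of `dunklCoeff` that is singular along `H`. -/
def dunklPolar (C : T.S → ℂ) (α : AntiDual V) (H : Set T.X) (g : T.W) (z : V) : V →L[ℂ] ℂ :=
  ∑ p : T.S with T.elt p = g ∧ p.1.1 = H, C p • polarSection α p z

open Classical in
/-- The part of `dunklCoeff` that is regular along `H`. -/
def dunklRest (C : T.S → ℂ) (α : AntiDual V) (H : Set T.X) (g : T.W) (z : V) : V →L[ℂ] ℂ :=
  ∑ p : T.S with T.elt p = g ∧ p.1.1 ≠ H, C p • polarSection α p z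

open Classical in
/-- The total coefficient of the poles along `H` attached to `g`. -/
def polarCoeff (C : T.S → ℂ) (H : Set T.X) (g : T.W) : ℂ :=
  ∑ p : T.S with T.elt p = g ∧ p.1.1 = H, C p

lemma dunklCoeff_eq_add (C : T.S → ℂ) (α : AntiDual V) (H : Set T.X) (g : T.W) (z : V) :
    dunklCoeff C α g z = dunklPolar C α H g z + dunklRest C α H g z := by
  classical
  rw [dunklCoeff_eq, dunklPolar, dunklRest,
    ← Finset.sum_filter_add_sum_filter_not _ (fun p : T.S => p.1.1 = H), Finset.filter_filter,
    Finset.filter_filter]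

variable {H : Set T.X} {a : V →L[ℂ] ℂ} {c : ℂ}

lemma exists_dunklPolar_eq (hα : T.IsGeneric α) (h : T.IsDefiningForm H a c) (g : T.W) (z : V) :
    ∃ r : ℂ, dunklPolar C α H g z = r • a := by
  classical
  have hp (p : T.S) (hp : p.1.1 = H) : ∃ r : ℂ, polarSection α p z = r • a := by
    obtain ⟨ψ, -, hψ⟩ := exists_polarSection_eq hα (p := p) (hp ▸ h)
    exact ⟨_, hψ z⟩
  choose! r hr using hp
  refine ⟨∑ p : T.S with T.elt p = g ∧ p.1.1 = H, C p * r p, ?_⟩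
  have hs := Finset.sum_smul (f := fun p : T.S => C p * r p)
    (s := Finset.univ.filter fun p : T.S => T.elt p = g ∧ p.1.1 = H) (x := a)
  rw [dunklPolar]
  refine Eq.trans ?_ hs.symm
  refine Finset.sum_congr rfl fun p hp => ?_
  rw [hr p (Finset.mem_filter.1 hp).2.2, smul_smul]

/-- The polar part is a multiple of a and dies under a ∧, so residues can be expressed through the
full coefficient, whose equivariance is known. -/
lemma wedge_dunklRest (hα : T.IsGeneric α) (h : T.IsDefiningForm H a c) (g : T.W) (z u v : V) :
    wedge a (dunklRest C α H g z) u v = wedge a (dunklCoeff C α g z) u v := by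
  obtain ⟨r, hr⟩ := exists_dunklPolar_eq (C := C) hα h g z
  rw [dunklCoeff_eq_add C α H, wedge_add_right, hr, wedge_smul_right, wedge_self, mul_zero,
    zero_add]

lemma analyticAt_dunklRest (hα : T.IsGeneric α) (g : T.W) {z : V}
    (hz : ∀ H', T.IsHypertorus H' → H' ≠ H → T.proj z ∉ H') :
    AnalyticAt ℂ (dunklRest C α H g) z := by
  classical
  exact Finset.analyticAt_fun_sum _ fun p hp => AnalyticAt.fun_smul analyticAt_const
    ((isPolarSection_polarSection hα p).holomorphic z (hz _ p.2.1 (Finset.mem_filter.1 hp).2.2))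

/-- All summands have the same element g, hence the same trivialization constant at z₀; only their
coefficients C add up. -/
lemma tendsto_dunklPolar (hα : T.IsGeneric α) (h : T.IsDefiningForm H a c) (g : T.W) {z₀ v : V}
    (hz₀ : T.proj z₀ ∈ H) (hv : a v ≠ 0) :
    Tendsto (fun t : ℂ => t • dunklPolar C α H g (z₀ + t • v)) (𝓝[≠] 0)
      (𝓝 (((a v)⁻¹ * (polarCoeff C H g * chi α (z₀ - g⁻¹ • z₀))) • a)) := by
  classical
  have hp (p : T.S) (hp : T.elt p = g ∧ p.1.1 = H) :
      Tendsto (fun t : ℂ => t • polarSection α p (z₀ + t • v)) (𝓝[≠] 0)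
        (𝓝 ((a v)⁻¹ • chi α (z₀ - g⁻¹ • z₀) • a)) := by
    obtain ⟨rfl, rfl⟩ := hp
    obtain ⟨β, hβ, hev, hval⟩ := (isPolarSection_polarSection hα p).residue z₀ hz₀ a
      fun v hv => (gen_fix_iff h v).1 hv
    rw [← hval]
    have hoff := eventually_mem_arrCompl (T := T) (ι := Unit) (a := fun _ => a) (c := fun _ => c)
      (fun _ => h.discrete) z₀ (v := v) (fun _ => hv) 0
    refine ((hβ.continuousAt.tendsto.comp (tendsto_add_smul z₀ v)).const_smul (a v)⁻¹).congr' ?_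
    filter_upwards [(tendsto_add_smul z₀ v).eventually hev, hoff] with t h1 h2
    have h3 : T.proj (z₀ + t • v) ∉ p.1.1 := by
      rw [h.mem_iff]
      exact h2 ()
    rw [Function.comp_apply, ← h1 h3, add_sub_cancel_left, map_smul, smul_eq_mul, smul_smul]
    congr 1
    field_simp
  have hsum := tendsto_finsetSum (Finset.univ.filter fun p : T.S => T.elt p = g ∧ p.1.1 = H)
    fun p hpm => (hp p (Finset.mem_filter.1 hpm).2).const_smul (C p)
  convert! hsum using 2
  · rw [dunklPolar, Finset.smul_sum]
    exact Finset.sum_congr rfl fun p _ => smul_comm _ _ _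
  · rw [polarCoeff, ← Finset.sum_smul, smul_smul, smul_smul]
    congr 1
    ring

/-- The product of the two polar parts is a multiple of a ∧ a = 0, so the pole is at most simple and
its residue comes from polar times regular parts. -/
lemma tendsto_wedge_dunklCoeff {α' : AntiDual V} (hα : T.IsGeneric α) (hα' : T.IsGeneric α')
    (h : T.IsDefiningForm H a c) (g g' : T.W) {z₀ v : V} (hz₀ : T.proj z₀ ∈ H) (hv : a v ≠ 0)
    (hz₀' : ∀ H', T.IsHypertorus H' → H' ≠ H → T.proj z₀ ∉ H') (u₁ u₂ : V) :
    Tendsto (fun t : ℂ => t * wedge (dunklCoeff C α g (z₀ + t • v))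
      (dunklCoeff C α' g' (z₀ + t • v)) u₁ u₂) (𝓝[≠] 0)
      (𝓝 ((a v)⁻¹ * (polarCoeff C H g * chi α (z₀ - g⁻¹ • z₀) *
          wedge a (dunklCoeff C α' g' z₀) u₁ u₂ -
        polarCoeff C H g' * chi α' (z₀ - g'⁻¹ • z₀) *
          wedge a (dunklCoeff C α g z₀) u₁ u₂))) := by
  have hP := tendsto_dunklPolar (C := C) hα h g hz₀ hv
  have hP' := tendsto_dunklPolar (C := C) hα' h g' hz₀ hv
  have hE : Tendsto (fun t : ℂ => dunklRest C α H g (z₀ + t • v)) (𝓝[≠] 0)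
      (𝓝 (dunklRest C α H g z₀)) :=
    (analyticAt_dunklRest hα g hz₀').continuousAt.tendsto.comp (tendsto_add_smul z₀ v)
  have hE' : Tendsto (fun t : ℂ => dunklRest C α' H g' (z₀ + t • v)) (𝓝[≠] 0)
      (𝓝 (dunklRest C α' H g' z₀)) :=
    (analyticAt_dunklRest hα' g' hz₀').continuousAt.tendsto.comp (tendsto_add_smul z₀ v)
  have ht : Tendsto (fun t : ℂ => t) (𝓝[≠] 0) (𝓝 0) := tendsto_id.mono_left nhdsWithin_le_nhds
  have hlim := ((tendsto_wedge hP hE' u₁ u₂).add (tendsto_wedge hE hP' u₁ u₂)).add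
    (ht.mul (tendsto_wedge hE hE' u₁ u₂))
  have hval : wedge (((a v)⁻¹ * (polarCoeff C H g * chi α (z₀ - g⁻¹ • z₀))) • a)
        (dunklRest C α' H g' z₀) u₁ u₂ +
      wedge (dunklRest C α H g z₀)
        (((a v)⁻¹ * (polarCoeff C H g' * chi α' (z₀ - g'⁻¹ • z₀))) • a) u₁ u₂ +
      0 * wedge (dunklRest C α H g z₀) (dunklRest C α' H g' z₀) u₁ u₂ =
      (a v)⁻¹ * (polarCoeff C H g * chi α (z₀ - g⁻¹ • z₀) *
          wedge a (dunklCoeff C α' g' z₀) u₁ u₂ -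
        polarCoeff C H g' * chi α' (z₀ - g'⁻¹ • z₀) *
          wedge a (dunklCoeff C α g z₀) u₁ u₂) := by
    rw [wedge_smul_left, wedge_smul_right, wedge_dunklRest hα' h, wedge_swap _ a,
      wedge_dunklRest hα h]
    ring
  rw [hval] at hlim
  refine hlim.congr fun t => ?_
  obtain ⟨r, hr⟩ := exists_dunklPolar_eq (C := C) hα h g (z₀ + t • v)
  obtain ⟨r', hr'⟩ := exists_dunklPolar_eq (C := C) hα' h g' (z₀ + t • v)
  rw [dunklCoeff_eq_add C α H, dunklCoeff_eq_add C α' H, hr, hr']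
  simp only [wedge_add_left, wedge_add_right, wedge_smul_left, wedge_smul_right, wedge_self]
  ring

lemma polarCoeff_eq_zero {g : T.W} (hg : ∀ p : T.S, T.elt p = g → p.1.1 ≠ H) :
    polarCoeff C H g = 0 := by
  classical
  rw [polarCoeff, Finset.filter_eq_empty_iff.2 fun p _ hp => hg p hp.1 hp.2, Finset.sum_empty]

/-- The residues of the two sides of the curvature along `H` cancel. -/
lemma residue_cancel (hC : T.IsInvariant C) (hα : T.IsGeneric α) (h : T.IsDefiningForm H a c)
    (g k : T.W) {z₀ : V} (hz₀ : T.proj z₀ ∈ H) (u₁ u₂ : V) :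
    polarCoeff C H k * chi (dualAct (k⁻¹ * g) α) (z₀ - k⁻¹ • z₀) *
        wedge a (dunklCoeff C α (k⁻¹ * g) z₀) u₁ u₂ =
      polarCoeff C H k * chi α (z₀ - k⁻¹ • z₀) *
        wedge a (dunklCoeff C (dualAct k α) (g * k⁻¹) z₀) u₁ u₂ := by
  -- If k contributes no pole along H, both residues are zero; otherwise k lies in the stabilizer
  -- and moves z₀ by a lattice vector γ.
  by_cases hk : ∀ p : T.S, T.elt p = k → p.1.1 ≠ H
  · rw [polarCoeff_eq_zero hk]
    ring
  push Not at hk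
  obtain ⟨p, hpk, hpH⟩ := hk
  have hks : k ∈ T.stab H := by
    rw [← hpk, ← hpH]
    exact elt_mem_stab p
  have hγ : k • z₀ - z₀ ∈ T.Γ := by
    have := hks z₀ hz₀
    rwa [Submodule.Quotient.eq] at this
  set γ := k • z₀ - z₀ with hγdef
  have hkz : k • z₀ = z₀ + γ := by rw [hγdef]; abel
  obtain ⟨w, hw⟩ := exists_apply_eq_one h.ne_zero
  obtain ⟨s, hkv⟩ : ∃ s : V, ∀ v, k • v = v + a v • s :=
    ⟨k • w - w, fun v => by rw [← h.smul_sub_eq hw hks v]; abel⟩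
  -- Equivariance under k moves the base point to k z₀ = z₀ + γ; the multiplier law brings it back
  -- to z₀ at the cost of a character value.
  have heq (v : V) : dunklCoeff C α (k⁻¹ * g) z₀ v =
      chi (dualAct k α - dualAct g α) γ * dunklCoeff C (dualAct k α) (g * k⁻¹) z₀ (k • v) := by
    have h1 := dunklCoeff_smul hC hα k (k⁻¹ * g) z₀ v
    have h2 : k * (k⁻¹ * g) * k⁻¹ = g * k⁻¹ := by group
    rw [h2, hkz, dunklCoeff_add_gamma C (hα.dualAct k) _ _ hγ, ← dualAct_mul,
      inv_mul_cancel_right] at h1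
    rw [← h1]
    rfl
  -- Replacing v by k v = v + a(v) s changes a functional by a multiple of a, which is invisible
  -- after wedging with a.
  have hwedge : wedge a (dunklCoeff C α (k⁻¹ * g) z₀) u₁ u₂ =
      chi (dualAct k α - dualAct g α) γ *
        wedge a (dunklCoeff C (dualAct k α) (g * k⁻¹) z₀) u₁ u₂ := by
    simp only [wedge, heq, hkv, map_add, map_smul, smul_eq_mul]
    ring
  have hγ' : z₀ - k⁻¹ • z₀ = k⁻¹ • γ := by rw [hγdef, smul_sub, inv_smul_smul]
  have h3 : chi (dualAct (k⁻¹ * g) α) (z₀ - k⁻¹ • z₀) = chi (dualAct g α) γ := by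
    rw [hγ', dualAct_mul, chi_dualAct k⁻¹, inv_inv, smul_inv_smul]
  have h4 : chi α (z₀ - k⁻¹ • z₀) = chi (dualAct k α) γ := by rw [hγ', chi_dualAct]
  rw [hwedge, h3, h4, chi_sub_left]
  have := chi_ne_zero (dualAct g α) γ
  field_simp

/-- The quadratic part of the curvature of the Dunkl connection vanishes. -/
theorem sum_wedge_dunklCoeff (hC : T.IsInvariant C) (hα : T.IsGeneric α) (g : T.W) {z : V}
    (hz : T.proj z ∈ T.reg) (u₁ u₂ : V) :
    ∑ h : T.W, wedge (dunklCoeff C (dualAct h α) (g * h⁻¹) z) (dunklCoeff C α h z) u₁ u₂ = 0 := by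
  -- Here the multiplier is trivial and the Liouville argument is unavailable, but F_{h⁻¹} and F_h
  -- are proportional, as both vanish on the fixed space of h.
  by_cases hg : g = 1
  · subst hg
    refine Finset.sum_eq_zero fun h _ => ?_
    by_cases hp : ∃ p : T.S, T.elt p = h
    · obtain ⟨p, rfl⟩ := hp
      refine sub_eq_zero.2 (mul_eq_mul_of_fix (p := p)
        (b := (dunklCoeff C (dualAct (T.elt p) α) (1 * (T.elt p)⁻¹) z : V →ₗ[ℂ] ℂ))
        (b' := (dunklCoeff C α (T.elt p) z : V →ₗ[ℂ] ℂ)) (fun v hv => ?_) (fun v hv => ?_) u₁ u₂)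
      · refine dunklCoeff_apply_eq_zero C (hα.dualAct _) z ?_
        rw [one_mul, inv_smul_eq_iff, hv]
      · exact dunklCoeff_apply_eq_zero C hα z hv
    · push Not at hp
      simp [wedge, dunklCoeff_eq_zero_of_ne C α hp]
  refine eq_zero_of_removable (T := T) (a := hform) (c := hconst)
    (ω := fun z => ∑ h : T.W,
      wedge (dunklCoeff C (dualAct h α) (g * h⁻¹) z) (dunklCoeff C α h z) u₁ u₂)
    (χ := chi (α - dualAct g α)) (fun H => (isDefiningForm_hform H).ne_zero)
    (fun H => (isDefiningForm_hform H).discrete) exists_hform_ne_zero (norm_chi _) (hα g hg)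
    (fun z γ hγ => ?_) (fun z hz => ?_) (fun H z₀ v hz₀ hz₀' hv => ?_)
    ((mem_arrCompl_hform z).2 hz)
  · rw [Finset.mul_sum]
    refine Finset.sum_congr rfl fun h _ => ?_
    rw [dunklCoeff_add_gamma C (hα.dualAct h) _ _ hγ, dunklCoeff_add_gamma C hα _ _ hγ,
      wedge_smul_left, wedge_smul_right, ← dualAct_mul, inv_mul_cancel_right, ← mul_assoc,
      ← chi_add_left]
    congr 3
    abel
  · rw [mem_arrCompl_hform] at hz
    exact Finset.analyticAt_fun_sum _ fun h _ =>
      analyticAt_wedge (analyticAt_dunklCoeff C (hα.dualAct h) _ hz)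
        (analyticAt_dunklCoeff C hα _ hz) _ _
  · have hdf := isDefiningForm_hform H
    have hzH : T.proj z₀ ∈ H.1 := (hdf.mem_iff z₀).2 hz₀
    have hoth (H' : Set T.X) (hH' : T.IsHypertorus H') (hne : H' ≠ H.1) : T.proj z₀ ∉ H' := by
      rw [(isDefiningForm_hform ⟨H', hH'⟩).mem_iff]
      exact hz₀' ⟨H', hH'⟩ fun h => hne (congrArg Subtype.val h)
    have hlim := tendsto_finsetSum (Finset.univ : Finset T.W) fun h _ =>
      tendsto_wedge_dunklCoeff (C := C) (hα.dualAct h) hα hdf (g * h⁻¹) h hzH (hv H) hoth u₁ u₂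
    simp only [← Finset.mul_sum] at hlim
    rw [Finset.sum_sub_distrib, sub_eq_zero.2, mul_zero] at hlim
    · exact hlim
    -- The pole of the first factor at h is matched with that of the second factor at k, where k = g
    -- h⁻¹.
    · let e : T.W ≃ T.W := (Equiv.inv T.W).trans (Equiv.mulRight g)
      rw [← e.sum_comp]
      refine Finset.sum_congr rfl fun k _ => ?_
      have he : e k = k⁻¹ * g := rfl
      have hek : g * (k⁻¹ * g)⁻¹ = k := by group
      rw [he, hek]
      exact residue_cancel hC hα hdf g k hzH u₁ u₂

end Flatness

end TorusAction

namespace TorusAction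

open Filter

variable {V : Type*} [NormedAddCommGroup V] [NormedSpace ℂ V] {T : TorusAction V}

/-! ### Sections with multipliers and meromorphy of the coefficients. -/

section Multipliers

lemma mul_mem_sec {U : T.InvOpen} {α α' : AntiDual V} {f f' : V → ℂ} (hf : f ∈ sec U α)
    (hf' : f' ∈ sec U α') : f * f' ∈ sec U (α + α') :=
  ⟨mul_mem_merFun hf.1 hf'.1, fun z γ hγ => by
    simp only [Pi.mul_apply, hf.2 z γ hγ, hf'.2 z γ hγ, chi_add_left]; ring⟩

variable [FiniteDimensional ℂ V]

lemma derivFun_mem_sec {U : T.InvOpen} {α : AntiDual V} {f : V → ℂ} (hf : f ∈ sec U α) (v : V) :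
    derivFun U v f ∈ sec U α := by
  refine ⟨derivFun_mem v hf.1, fun z γ hγ => ?_⟩
  by_cases hz : z ∈ dom U
  · have h1 : (fun y => f (y + γ)) = fun y => chi α γ • f y := funext fun y => hf.2 y γ hγ
    simp only [derivFun, hz, (add_gamma_mem_dom_iff hγ).2 hz, if_true]
    rw [← fderiv_comp_add_right, h1,
      fderiv_fun_const_smul (analyticAt_of_mem hf.1 hz).differentiableAt]
    rfl
  · simp [derivFun, hz, add_gamma_mem_dom_iff hγ]

/-- A form with constant periodic coefficients is constant. -/
lemma FlatConnection.form_eq (D : T.FlatConnection) (z : V) : D.form z = D.form 0 := by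
  have : FiniteDimensional ℝ V := FiniteDimensional.complexToReal V
  -- A continuous Γ-periodic function has compact image, so Liouville applies.
  refine D.holomorphic.apply_eq_apply_of_bounded ?_ z 0
  exact (IsZLattice.isCompact_range_of_periodic T.Γ D.form D.holomorphic.continuous
    fun z γ hγ => D.periodic z γ hγ).isBounded

/-- `⟨F_{C,g}, v⟩` as a function over `U ∩ X_reg`, extended by zero. -/
def dunklFun (U : T.InvOpen) (C : T.S → ℂ) (α : AntiDual V) (g : T.W) (v : V) : V → ℂ :=
  (dom U).indicator fun z => dunklCoeff C α g z v

/-- Near a point z over H the denominator is a(y) - a(z); it can vanish only at points over H, never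
over X_reg. -/
lemma indicator_polarSection_mem {α : AntiDual V} (hα : T.IsGeneric α) (U : T.InvOpen) (p : T.S)
    (v : V) : (dom U).indicator (fun z => polarSection α p z v) ∈ merFun U := by
  obtain ⟨a, c, h⟩ := hasDefiningForm p
  obtain ⟨ψ, hψ, hψ'⟩ := exists_polarSection_eq hα h
  refine ⟨fun z hz => ?_, fun z hz => Set.indicator_of_notMem hz _⟩
  have hval (y : V) (hy : y ∈ dom U) :
      (dom U).indicator (fun z => polarSection α p z v) y = ψ (a y) * a v := by
    rw [Set.indicator_of_mem hy, hψ']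
    rfl
  by_cases hza : a z - c ∈ T.periods a
  · obtain ⟨r, hr, hr'⟩ := hψ.pole _ hza
    refine ⟨fun y => r (a y) * a v, fun y => a y - a z,
      (hr.fun_comp (a.analyticAt z)).mul analyticAt_const,
      (a.analyticAt z).sub analyticAt_const, ?_⟩
    filter_upwards [a.continuous.continuousAt.eventually (eventually_nhdsWithin_iff.1 hr')]
      with y hy hyd
    have hne : a y ≠ a z := fun he => hyd.2 _ p.2.1 ((h.mem_iff y).2 (by rwa [he]))
    have hne' := sub_ne_zero.2 hne
    refine ⟨hne', ?_⟩
    rw [hval y hyd, ← hy hne]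
    field_simp
  · refine ⟨fun y => ψ (a y) * a v, fun _ => 1,
      ((hψ.analyticAt _ hza).fun_comp (a.analyticAt z)).mul analyticAt_const, analyticAt_const, ?_⟩
    exact Eventually.of_forall fun y hyd => ⟨one_ne_zero, by rw [hval y hyd, div_one]⟩

lemma dunklFun_mem {α : AntiDual V} (hα : T.IsGeneric α) (U : T.InvOpen) (C : T.S → ℂ) (g : T.W)
    (v : V) : dunklFun U C α g v ∈ sec U (α - dualAct g α) := by
  classical
  refine ⟨?_, fun z γ hγ => ?_⟩
  · have h : dunklFun U C α g v = ∑ p : T.S with T.elt p = g,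
        C p • (dom U).indicator (fun z => polarSection α p z v) := by
      ext z
      rw [dunklFun, Finset.sum_apply]
      by_cases hz : z ∈ dom U
      · simp only [Set.indicator_of_mem hz, dunklCoeff_eq, sum_apply, Pi.smul_apply]
        rfl
      · simp [Set.indicator_of_notMem hz]
    rw [h]
    exact Submodule.sum_mem _ fun p _ =>
      (merFun U).smul_mem _ (indicator_polarSection_mem hα U p v)
  · by_cases hz : z ∈ dom U
    · rw [dunklFun, Set.indicator_of_mem hz,
        Set.indicator_of_mem ((add_gamma_mem_dom_iff hγ).2 hz), dunklCoeff_add_gamma C hα g z hγ]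
      rfl
    · rw [dunklFun, Set.indicator_of_notMem hz,
        Set.indicator_of_notMem fun h => hz ((add_gamma_mem_dom_iff hγ).1 h), mul_zero]

end Multipliers

/-! ### The connection matrix of the Dunkl operators and its flatness. -/

section Connection

variable [FiniteDimensional ℂ V]

open Classical in
/-- The matrix of the connection form of the Dunkl connection. -/
def conn (D : T.FlatConnection) (C : T.S → ℂ) (α : AntiDual V) (k w : T.W) (z : V) : V →L[ℂ] ℂ :=
  dunklCoeff C (dualAct w α) (k * w⁻¹) z + if k = w then -(D.form 0).comp (clin k⁻¹) else 0

variable {D : T.FlatConnection} {C : T.S → ℂ} {α : AntiDual V}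

lemma analyticAt_conn (hα : T.IsGeneric α) (k w : T.W) {z : V} (hz : T.proj z ∈ T.reg) :
    AnalyticAt ℂ (conn D C α k w) z :=
  (analyticAt_dunklCoeff C (hα.dualAct w) _ hz).add analyticAt_const

lemma conn_smul (hC : T.IsInvariant C) (hα : T.IsGeneric α) (g k w : T.W) (z v : V) :
    conn D C α (g * k) (g * w) (g • z) (g • v) = conn D C α k w z v := by
  simp only [conn, add_apply]
  rw [dualAct_mul, show g * k * (g * w)⁻¹ = g * (k * w⁻¹) * g⁻¹ by group,
    dunklCoeff_smul hC (hα.dualAct w)]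
  congr 1
  by_cases hkw : k = w
  · simp [hkw, clin_apply, mul_smul]
  · simp [hkw]

/-- Closedness: the derivative of ψ(a z) a is ψ'(a z) a ⊗ a, which is symmetric. -/
lemma fderiv_dunklCoeff_symm (hα : T.IsGeneric α) (g : T.W) {z : V} (hz : T.proj z ∈ T.reg)
    (u v : V) : fderiv ℂ (dunklCoeff C α g) z u v = fderiv ℂ (dunklCoeff C α g) z v u := by
  classical
  have hp (p : T.S) : ∃ B : V →L[ℂ] V →L[ℂ] ℂ, HasFDerivAt (polarSection α p) B z ∧
      ∀ u v, B u v = B v u := by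
    obtain ⟨a, c, h⟩ := hasDefiningForm p
    obtain ⟨ψ, hψ, hψ'⟩ := exists_polarSection_eq hα h
    have hza : a z - c ∉ T.periods a := fun hza => hz _ p.2.1 ((h.mem_iff z).2 hza)
    have h1 : HasFDerivAt (fun z => ψ (a z)) (deriv ψ (a z) • a) z :=
      (hψ.analyticAt _ hza).differentiableAt.hasDerivAt.comp_hasFDerivAt z a.hasFDerivAt
    refine ⟨(deriv ψ (a z) • a).smulRight a, ?_, fun u v => ?_⟩
    · rw [funext hψ']
      exact h1.smul_const a
    · simp only [ContinuousLinearMap.smulRight_apply, smul_apply, smul_eq_mul]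
      ring
  choose B hB hsymm using hp
  have h : HasFDerivAt (dunklCoeff C α g) (∑ p : T.S with T.elt p = g, C p • B p) z := by
    rw [funext fun z => dunklCoeff_eq C α g z]
    exact HasFDerivAt.fun_sum fun p _ => (hB p).const_smul (C p)
  rw [h.fderiv]
  simp only [sum_apply, smul_apply]
  exact Finset.sum_congr rfl fun p _ => by rw [hsymm]

lemma fderiv_conn_symm (hα : T.IsGeneric α) (k w : T.W) {z : V} (hz : T.proj z ∈ T.reg)
    (u v : V) : fderiv ℂ (conn D C α k w) z u v = fderiv ℂ (conn D C α k w) z v u := by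
  have h : fderiv ℂ (conn D C α k w) z = fderiv ℂ (dunklCoeff C (dualAct w α) (k * w⁻¹)) z := by
    unfold conn
    exact fderiv_add_const _
  rw [h, fderiv_dunklCoeff_symm (hα.dualAct w) _ hz]

/-- Together the terms form the wedge of F with θ∘k⁻¹ - θ∘w⁻¹. Both functionals vanish on the fixed
space of k w⁻¹, so they are proportional when k w⁻¹ occurs in S; otherwise F is zero. -/
lemma wedge_form_dunklCoeff (hα : T.IsGeneric α) (θ : V →L[ℂ] ℂ) (k w : T.W) (z u v : V) :
    wedge (dunklCoeff C (dualAct w α) (k * w⁻¹) z) (-θ.comp (clin w⁻¹)) u v +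
      wedge (-θ.comp (clin k⁻¹)) (dunklCoeff C (dualAct w α) (k * w⁻¹) z) u v = 0 := by
  by_cases hp : ∃ p : T.S, T.elt p = k * w⁻¹
  · obtain ⟨p, hp⟩ := hp
    have h := mul_eq_mul_of_fix (p := p)
      (b := (dunklCoeff C (dualAct w α) (k * w⁻¹) z : V →ₗ[ℂ] ℂ))
      (b' := (θ.comp (clin k⁻¹) - θ.comp (clin w⁻¹) : V →L[ℂ] ℂ))
      (fun v hv => dunklCoeff_apply_eq_zero C (hα.dualAct w) z (by rw [← hp, hv]))
      (fun v hv => by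
        rw [hp] at hv
        have : k⁻¹ • v = w⁻¹ • v := by
          conv_lhs => rw [← hv]
          rw [← mul_smul, inv_mul_cancel_left]
        simp [clin_apply, this]) u v
    simp only [ContinuousLinearMap.coe_coe, sub_apply] at h
    simp only [wedge, neg_apply]
    linear_combination h
  · push Not at hp
    simp [wedge, dunklCoeff_eq_zero_of_ne C _ hp]

lemma sum_wedge_conn (hC : T.IsInvariant C) (hα : T.IsGeneric α) (k w : T.W) {z : V}
    (hz : T.proj z ∈ T.reg) (u v : V) :
    ∑ x : T.W, wedge (conn D C α k x z) (conn D C α x w z) u v = 0 := by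
  classical
  have h1 : ∑ x : T.W, wedge (dunklCoeff C (dualAct x α) (k * x⁻¹) z)
      (dunklCoeff C (dualAct w α) (x * w⁻¹) z) u v = 0 := by
    rw [← sum_wedge_dunklCoeff hC (hα.dualAct w) (k * w⁻¹) hz u v, ← Equiv.sum_comp (Equiv.mulRight w)]
    refine Finset.sum_congr rfl fun h _ => ?_
    simp only [Equiv.coe_mulRight, dualAct_mul, mul_inv_rev, mul_assoc, mul_inv_cancel, mul_one]
  have h2 : ∑ x : T.W, wedge (dunklCoeff C (dualAct x α) (k * x⁻¹) z)
      (if x = w then -(D.form 0).comp (clin x⁻¹) else 0) u v =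
      wedge (dunklCoeff C (dualAct w α) (k * w⁻¹) z) (-(D.form 0).comp (clin w⁻¹)) u v := by
    rw [Finset.sum_eq_single w]
    · rw [if_pos rfl]
    · intro x _ hx
      rw [if_neg hx, wedge_zero_right]
    · simp
  have h3 : ∑ x : T.W, wedge (if k = x then -(D.form 0).comp (clin k⁻¹) else 0)
      (dunklCoeff C (dualAct w α) (x * w⁻¹) z) u v =
      wedge (-(D.form 0).comp (clin k⁻¹)) (dunklCoeff C (dualAct w α) (k * w⁻¹) z) u v := by
    rw [Finset.sum_eq_single k]
    · rw [if_pos rfl]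
    · intro x _ hx
      rw [if_neg (Ne.symm hx), wedge_swap, wedge_zero_right, neg_zero]
    · simp
  have h4 : ∑ x : T.W, wedge (if k = x then -(D.form 0).comp (clin k⁻¹) else 0)
      (if x = w then -(D.form 0).comp (clin x⁻¹) else 0) u v = 0 := by
    refine Finset.sum_eq_zero fun x _ => ?_
    split_ifs with hk hw
    · subst hk
      exact wedge_self _ _ _
    · exact wedge_zero_right _ _ _
    · rw [wedge_swap, wedge_zero_right, neg_zero]
    · exact wedge_zero_right _ _ _
  have h5 := wedge_form_dunklCoeff (C := C) hα (D.form 0) k w z u v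
  simp only [conn, wedge_add_left, wedge_add_right, Finset.sum_add_distrib, h1, h2, h3, h4]
  linear_combination h5

/-- Covariant derivatives for the Dunkl connection commute. -/
lemma fderiv_covariant_symm (hC : T.IsInvariant C) (hα : T.IsGeneric α) {β : T.W → V → ℂ} {z : V}
    (hz : T.proj z ∈ T.reg) (hβ : ∀ w, AnalyticAt ℂ (β w) z) (k : T.W) (u v : V) :
    fderiv ℂ (fun y => fderiv ℂ (β k) y v + ∑ w, conn D C α k w y v * β w y) z u +
        ∑ x, conn D C α k x z u * (fderiv ℂ (β x) z v + ∑ w, conn D C α x w z v * β w z) =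
      fderiv ℂ (fun y => fderiv ℂ (β k) y u + ∑ w, conn D C α k w y u * β w y) z v +
        ∑ x, conn D C α k x z v * (fderiv ℂ (β x) z u + ∑ w, conn D C α x w z u * β w z) := by
  have : CompleteSpace V := FiniteDimensional.complete ℂ V
  have hfd (u v : V) :
      fderiv ℂ (fun y => fderiv ℂ (β k) y v + ∑ w, conn D C α k w y v * β w y) z u =
        fderiv ℂ (fderiv ℂ (β k)) z u v + ∑ w, (conn D C α k w z v * fderiv ℂ (β w) z u +
          β w z * fderiv ℂ (conn D C α k w) z u v) := by
    have h1 : HasFDerivAt (fun y => fderiv ℂ (β k) y v)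
        ((ContinuousLinearMap.apply ℂ ℂ v).comp (fderiv ℂ (fderiv ℂ (β k)) z)) z :=
      (ContinuousLinearMap.apply ℂ ℂ v).hasFDerivAt.comp z
        (hβ k).fderiv.differentiableAt.hasFDerivAt
    have h2 (w : T.W) : HasFDerivAt (fun y => conn D C α k w y v * β w y)
        (conn D C α k w z v • fderiv ℂ (β w) z +
          β w z • (ContinuousLinearMap.apply ℂ ℂ v).comp (fderiv ℂ (conn D C α k w) z)) z := by
      have h3 : HasFDerivAt (fun y => conn D C α k w y v)
          ((ContinuousLinearMap.apply ℂ ℂ v).comp (fderiv ℂ (conn D C α k w) z)) z :=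
        (ContinuousLinearMap.apply ℂ ℂ v).hasFDerivAt.comp z
          (analyticAt_conn hα k w hz).differentiableAt.hasFDerivAt
      exact h3.mul (hβ w).differentiableAt.hasFDerivAt
    have h4 := h1.add (HasFDerivAt.fun_sum (u := Finset.univ) fun w _ => h2 w)
    have h5 : fderiv ℂ (fun y => fderiv ℂ (β k) y v + ∑ w, conn D C α k w y v * β w y) z = _ :=
      h4.fderiv
    rw [h5]
    simp [sum_apply]
  have hsymm : fderiv ℂ (fderiv ℂ (β k)) z u v = fderiv ℂ (fderiv ℂ (β k)) z v u := by
    have hcd : ContDiffAt ℂ ⊤ (β k) z := (hβ k).contDiffAt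
    exact (hcd.isSymmSndFDerivAt (by simp)).eq u v
  -- Antisymmetrizing the double sum and exchanging the summations produces the coefficients of
  -- `sum_wedge_conn`.
  have hquad : ∑ x, conn D C α k x z u * ∑ w, conn D C α x w z v * β w z -
      ∑ x, conn D C α k x z v * ∑ w, conn D C α x w z u * β w z = 0 := by
    have h6 (w : T.W) : (∑ x, wedge (conn D C α k x z) (conn D C α x w z) u v) * β w z = 0 := by
      rw [sum_wedge_conn hC hα k w hz, zero_mul]
    have h7 := Finset.sum_eq_zero (s := Finset.univ) fun w _ => h6 w
    simp only [Finset.sum_mul] at h7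
    rw [Finset.sum_comm] at h7
    rw [← Finset.sum_sub_distrib, ← h7]
    refine Finset.sum_congr rfl fun x _ => ?_
    rw [Finset.mul_sum, Finset.mul_sum, ← Finset.sum_sub_distrib]
    refine Finset.sum_congr rfl fun w _ => ?_
    rw [wedge]
    ring
  rw [hfd u v, hfd v u, hsymm]
  simp only [mul_add, Finset.sum_add_distrib, fderiv_conn_symm hα k _ hz u v]
  linear_combination hquad

end Connection

end TorusAction

namespace TorusAction

open Filter

variable {V : Type*} [NormedAddCommGroup V] [NormedSpace ℂ V] {T : TorusAction V}

/-! ### Multiplications, translations and Dunkl operators on sections of F. -/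

section SectionOperators

/-- Multiplication by a section of `L_α`, as a map from sections of `L_α'` to sections of
`L_(α + α')`. -/
def mulSec {U : T.InvOpen} {α α' α'' : AntiDual V} (f : V → ℂ) (hf : f ∈ sec U α)
    (h : α + α' = α'') : sec U α' →ₗ[ℂ] sec U α'' where
  toFun β := ⟨f * β.1, h ▸ mul_mem_sec hf β.2⟩
  map_add' a b := by ext; simp [mul_add]
  map_smul' c a := by ext; simp; ring

/-- Multiplication of sections of `F` by a function. -/
def secMul (U : T.InvOpen) (α : AntiDual V) (f : regFun U) : Module.End ℂ (Fsec U α) :=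
  LinearMap.pi fun w => (mulSec f.1 f.2 (zero_add _)).comp (LinearMap.proj w)

lemma secMul_apply {U : T.InvOpen} {α : AntiDual V} (f : regFun U) (β : Fsec U α) (w : T.W)
    (z : V) : (secMul U α f β w).1 z = f.1 z * (β w).1 z := rfl

/-- Sections are extended by zero, so only their values over U ∩ X_reg matter. -/
lemma Fsec_ext {U : T.InvOpen} {α : AntiDual V} {β β' : Fsec U α}
    (h : ∀ w, ∀ z ∈ dom U, (β w).1 z = (β' w).1 z) : β = β' := by
  refine funext fun w => Subtype.ext (funext fun z => ?_)
  by_cases hz : z ∈ dom U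
  · exact h w z hz
  · rw [(β w).2.1.2 z hz, (β' w).2.1.2 z hz]

lemma fderiv_mul_apply {f f' : V → ℂ} {z : V} (hf : AnalyticAt ℂ f z) (hf' : AnalyticAt ℂ f' z)
    (v : V) : fderiv ℂ (f * f') z v = fderiv ℂ f z v * f' z + f z * fderiv ℂ f' z v := by
  rw [fderiv_mul hf.differentiableAt hf'.differentiableAt]
  simp only [add_apply, smul_apply, smul_eq_mul]
  ring

variable [FiniteDimensional ℂ V]

lemma translate_mem_sec {U : T.InvOpen} {α α' : AntiDual V} (g : T.W) (h : dualAct g α = α')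
    {f : V → ℂ} (hf : f ∈ sec U α) : (fun z => f (g⁻¹ • z)) ∈ sec U α' := by
  refine ⟨translate_mem g hf.1, fun z γ hγ => ?_⟩
  change f (g⁻¹ • (z + γ)) = _ * f (g⁻¹ • z)
  rw [smul_add, hf.2 _ _ (gamma_smul_mem g⁻¹ hγ), ← h, chi_dualAct]

/-- The action of `g ∈ W` on sections of `F`. -/
def secTranslate (U : T.InvOpen) (α : AntiDual V) (g : T.W) : Module.End ℂ (Fsec U α) where
  toFun β w := ⟨fun z => (β (g⁻¹ * w)).1 (g⁻¹ • z),
    translate_mem_sec g (by rw [← dualAct_mul, mul_inv_cancel_left]) (β (g⁻¹ * w)).2⟩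
  map_add' _ _ := rfl
  map_smul' _ _ := rfl

lemma secTranslate_apply {U : T.InvOpen} {α : AntiDual V} (g : T.W) (β : Fsec U α) (w : T.W)
    (z : V) : (secTranslate U α g β w).1 z = (β (g⁻¹ * w)).1 (g⁻¹ • z) := rfl

/-- The action of `W` on sections of `F` as a homomorphism. -/
def secTranslateHom (U : T.InvOpen) (α : AntiDual V) : T.W →* Module.End ℂ (Fsec U α) where
  toFun := secTranslate U α
  map_one' := by
    refine LinearMap.ext fun β => Fsec_ext fun w z _ => ?_
    rw [secTranslate_apply, inv_one, one_mul, one_smul]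
    rfl
  map_mul' g h := by
    refine LinearMap.ext fun β => Fsec_ext fun w z _ => ?_
    rw [Module.End.mul_apply, secTranslate_apply, secTranslate_apply, secTranslate_apply,
      mul_inv_rev, mul_assoc, mul_smul]

/-- The vector field `∂_v` acting on sections of `L_α`. -/
def derivSec (U : T.InvOpen) (α : AntiDual V) (v : V) : sec U α →ₗ[ℂ] sec U α where
  toFun f := ⟨derivFun U v f.1, derivFun_mem_sec f.2 v⟩
  map_add' a b := by
    have h := congrArg Subtype.val ((derivEnd U v).map_add ⟨a.1, a.2.1⟩ ⟨b.1, b.2.1⟩)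
    exact Subtype.ext h
  map_smul' c a := by
    have h := congrArg Subtype.val ((derivEnd U v).map_smul c ⟨a.1, a.2.1⟩)
    exact Subtype.ext h

/-- The Dunkl operator `ρ(∂_v)`. -/
def dunklOp {α : AntiDual V} (hα : T.IsGeneric α) (D : T.FlatConnection) (C : T.S → ℂ)
    (U : T.InvOpen) (v : V) : Module.End ℂ (Fsec U α) :=
  LinearMap.pi fun k => (derivSec U _ v - D.form 0 (k⁻¹ • v) • LinearMap.id).comp
    (LinearMap.proj k) + ∑ w : T.W,
      -- The multiplier exponents add up: (wα - kα) + w(-α) = k(-α), so the product lands in the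
      -- k-th summand.
      (mulSec (dunklFun U C (dualAct w α) (k * w⁻¹) v) (dunklFun_mem (hα.dualAct w) U C _ v) (by
        rw [← dualAct_mul, inv_mul_cancel_right, dualAct_neg, dualAct_neg]; abel)).comp
        (LinearMap.proj w)

variable {α : AntiDual V} (hα : T.IsGeneric α) (D : T.FlatConnection) (C : T.S → ℂ)
  {U : T.InvOpen}

lemma dunklOp_apply' (v : V) (β : Fsec U α) (k : T.W) {z : V} (hz : z ∈ dom U) :
    (dunklOp hα D C U v β k).1 z = fderiv ℂ (β k).1 z v - D.form 0 (k⁻¹ • v) * (β k).1 z +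
      ∑ w : T.W, dunklCoeff C (dualAct w α) (k * w⁻¹) z v * (β w).1 z := by
  have h1 : dunklOp hα D C U v β k = derivSec U _ v (β k) - D.form 0 (k⁻¹ • v) • β k +
      ∑ w : T.W, mulSec (dunklFun U C (dualAct w α) (k * w⁻¹) v)
        (dunklFun_mem (hα.dualAct w) U C _ v) (by
          rw [← dualAct_mul, inv_mul_cancel_right, dualAct_neg, dualAct_neg]; abel) (β w) := by
    rw [dunklOp, LinearMap.pi_apply, LinearMap.add_apply, LinearMap.sum_apply]
    rfl
  rw [h1, Submodule.coe_add, Submodule.coe_sub, Submodule.coe_smul, Submodule.coe_sum,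
    Pi.add_apply, Pi.sub_apply, Finset.sum_apply]
  have h2 : (derivSec U _ v (β k)).1 z = fderiv ℂ (β k).1 z v := if_pos hz
  rw [h2]
  congr 1
  refine Finset.sum_congr rfl fun w _ => ?_
  change dunklFun U C (dualAct w α) (k * w⁻¹) v z * (β w).1 z = _
  rw [dunklFun, Set.indicator_of_mem hz]

lemma dunklOp_apply (v : V) (β : Fsec U α) (k : T.W) {z : V} (hz : z ∈ dom U) :
    (dunklOp hα D C U v β k).1 z = fderiv ℂ (β k).1 z v +
      ∑ w : T.W, conn D C α k w z v * (β w).1 z := by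
  classical
  have h : ∑ w : T.W, (if k = w then -(D.form 0).comp (clin k⁻¹) else 0) v * (β w).1 z =
      -(D.form 0 (k⁻¹ • v)) * (β k).1 z := by
    rw [Finset.sum_eq_single k]
    · rw [if_pos rfl]
      rfl
    · intro w _ hw
      rw [if_neg (Ne.symm hw)]
      simp
    · simp
  simp only [conn, add_apply, add_mul, Finset.sum_add_distrib, h]
  rw [dunklOp_apply' hα D C v β k hz]
  ring

/-- The Dunkl operators, as a linear function of the direction. -/
def dunklMap (U : T.InvOpen) : V →ₗ[ℂ] Module.End ℂ (Fsec U α) where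
  toFun := dunklOp hα D C U
  map_add' u v := by
    refine LinearMap.ext fun β => Fsec_ext fun k z hz => ?_
    rw [LinearMap.add_apply, Pi.add_apply, Submodule.coe_add, Pi.add_apply]
    simp only [dunklOp_apply hα D C _ β k hz, map_add, add_mul, Finset.sum_add_distrib]
    ring
  map_smul' c v := by
    refine LinearMap.ext fun β => Fsec_ext fun k z hz => ?_
    rw [RingHom.id_apply, LinearMap.smul_apply, Pi.smul_apply, Submodule.coe_smul, Pi.smul_apply]
    simp only [dunklOp_apply hα D C _ β k hz, map_smul, smul_eq_mul, mul_add, Finset.mul_sum,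
      mul_assoc]

lemma dunklOp_eventuallyEq (v : V) (β : Fsec U α) (k : T.W) {z : V} (hz : z ∈ dom U) :
    (dunklOp hα D C U v β k).1 =ᶠ[𝓝 z] fun y => fderiv ℂ (β k).1 y v +
      ∑ w : T.W, conn D C α k w y v * (β w).1 y := by
  filter_upwards [(isOpen_dom U).mem_nhds hz] with y hy
  exact dunklOp_apply hα D C v β k hy

lemma dunklOp_comm (hC : T.IsInvariant C) (u v : V) :
    dunklOp hα D C U u * dunklOp hα D C U v = dunklOp hα D C U v * dunklOp hα D C U u := by
  refine LinearMap.ext fun β => Fsec_ext fun k z hz => ?_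
  rw [Module.End.mul_apply, Module.End.mul_apply, dunklOp_apply hα D C _ _ k hz,
    dunklOp_apply hα D C _ _ k hz, (dunklOp_eventuallyEq hα D C v β k hz).fderiv_eq,
    (dunklOp_eventuallyEq hα D C u β k hz).fderiv_eq]
  simp only [dunklOp_apply hα D C _ _ _ hz]
  exact fderiv_covariant_symm hC hα hz.2 (fun w => analyticAt_of_mem (β w).2.1 hz) k u v

lemma secTranslate_dunklOp (hC : T.IsInvariant C) (g : T.W) (v : V) :
    secTranslate U α g * dunklOp hα D C U v =
      dunklOp hα D C U (g • v) * secTranslate U α g := by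
  refine LinearMap.ext fun β => Fsec_ext fun k z hz => ?_
  have hz' : g⁻¹ • z ∈ dom U := smul_mem_dom g⁻¹ hz
  have hfd : fderiv ℂ (secTranslate U α g β k).1 z (g • v) =
      fderiv ℂ (β (g⁻¹ * k)).1 (g⁻¹ • z) v := by
    have h1 : HasFDerivAt (fun y : V => g⁻¹ • y) (clin g⁻¹) z := (clin g⁻¹).hasFDerivAt
    have h2 := (analyticAt_of_mem (β (g⁻¹ * k)).2.1 hz').differentiableAt.hasFDerivAt
    have h3 : HasFDerivAt (secTranslate U α g β k).1
        ((fderiv ℂ (β (g⁻¹ * k)).1 (g⁻¹ • z)).comp (clin g⁻¹)) z := h2.comp z h1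
    rw [h3.fderiv, ContinuousLinearMap.comp_apply, clin_apply, inv_smul_smul]
  rw [Module.End.mul_apply, Module.End.mul_apply, secTranslate_apply,
    dunklOp_apply hα D C _ _ _ hz', dunklOp_apply hα D C _ _ _ hz, hfd]
  congr 1
  rw [← Equiv.sum_comp (Equiv.mulLeft g) fun w => conn D C α k w z (g • v) * _]
  refine Finset.sum_congr rfl fun w _ => ?_
  rw [Equiv.coe_mulLeft, secTranslate_apply, inv_mul_cancel_left]
  congr 1
  have h := conn_smul (D := D) hC hα g (g⁻¹ * k) w (g⁻¹ • z) v
  rw [mul_inv_cancel_left, smul_inv_smul] at h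
  exact h.symm

/-- The derivative of a function on `U`. -/
def derivReg (v : V) (f : regFun U) : regFun U := ⟨derivFun U v f.1, derivFun_mem_sec f.2 v⟩

lemma dunklOp_secMul (v : V) (f : regFun U) (β : Fsec U α) :
    dunklOp hα D C U v (secMul U α f β) =
      secMul U α (derivReg v f) β + secMul U α f (dunklOp hα D C U v β) := by
  refine Fsec_ext fun k z hz => ?_
  have h1 : (secMul U α f β k).1 = f.1 * (β k).1 := rfl
  have h2 : (derivReg v f).1 z = fderiv ℂ f.1 z v := if_pos hz
  rw [Pi.add_apply, Submodule.coe_add, Pi.add_apply, dunklOp_apply hα D C _ _ _ hz, h1,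
    fderiv_mul_apply (analyticAt_of_mem f.2.1 hz) (analyticAt_of_mem (β k).2.1 hz), secMul_apply,
    secMul_apply, h2, dunklOp_apply hα D C _ _ _ hz, mul_add, Finset.mul_sum, add_assoc]
  congr 2
  refine Finset.sum_congr rfl fun w _ => ?_
  rw [secMul_apply]
  ring

lemma derivEnd_mulEnd (v : V) (f : regFun U) (φ : merFun U) :
    derivEnd U v (mulEnd U f φ) = mulEnd U (derivReg v f) φ + mulEnd U f (derivEnd U v φ) := by
  refine Subtype.ext (funext fun z => ?_)
  by_cases hz : z ∈ dom U
  · change derivFun U v (f.1 * φ.1) z = derivFun U v f.1 z * φ.1 z + f.1 z * derivFun U v φ.1 z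
    simp only [derivFun, if_pos hz]
    exact fderiv_mul_apply (analyticAt_of_mem f.2.1 hz) (analyticAt_of_mem φ.2 hz) v
  · rw [(derivEnd U v _).2.2 z hz, (Subtype.prop (_ + _ : merFun U)).2 z hz]

end SectionOperators

end TorusAction

namespace TorusAction

open Filter

variable {V : Type*} [NormedAddCommGroup V] [NormedSpace ℂ V] {T : TorusAction V}

/-! ### Covariant jets, and why an operator on functions determines one on sections. -/

section Jets

variable {U : T.InvOpen} {α : AntiDual V}

/-- The term of degree `k` (up to the factor `k!`) of the covariant Taylor expansion at `z₀`. -/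
def taylorTerm (R : V →ₗ[ℂ] Module.End ℂ (Fsec U α)) (z₀ : V) (k : ℕ) (m : Fsec U α) (w : T.W)
    (x : V) : ℂ := ((R x ^ k) m w).1 z₀

/-- The covariant Taylor polynomial at `z₀` of degree less than `N` of a section of `F`. -/
def taylorPoly (R : V →ₗ[ℂ] Module.End ℂ (Fsec U α)) (z₀ : V) (N : ℕ) (m : Fsec U α) (w : T.W)
    (z : V) : ℂ := ∑ k ∈ Finset.range N, (k.factorial : ℂ)⁻¹ * taylorTerm R z₀ k m w (z - z₀)

lemma taylorPoly_self {R : V →ₗ[ℂ] Module.End ℂ (Fsec U α)} (z₀ : V) (N : ℕ) (m : Fsec U α) (w : T.W) :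
    taylorPoly R z₀ (N + 1) m w z₀ = (m w).1 z₀ := by
  rw [taylorPoly, Finset.sum_range_succ', Finset.sum_eq_zero]
  · simp [taylorTerm]
  · intro k _
    simp [taylorTerm, sub_self, zero_pow]

lemma cut_mem_merFun_of_analyticAt (U : T.InvOpen) {q : V → ℂ} (hq : ∀ z, AnalyticAt ℂ q z) :
    cut U q ∈ merFun U := by
  refine ⟨fun z _ => ⟨q, fun _ => 1, hq z, analyticAt_const, Eventually.of_forall fun y hy => ?_⟩,
    fun z hz => Set.indicator_of_notMem hz q⟩
  exact ⟨one_ne_zero, by rw [cut, Set.indicator_of_mem hy, div_one]⟩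

variable [FiniteDimensional ℂ V]

/-- A commuting family of operators on sections of `F` satisfying the Leibniz rule. -/
structure IsFlatAction (R : V →ₗ[ℂ] Module.End ℂ (Fsec U α)) : Prop where
  comm : ∀ u v, R u * R v = R v * R u
  leibniz : ∀ (v : V) (f : regFun U) (β : Fsec U α),
    R v (secMul U α f β) = secMul U α (derivReg v f) β + secMul U α f (R v β)

/-- The covariant jet of order less than `N` of the section `m` at `z` agrees with the jet of the
tuple of functions `φ`. -/
def JetEq (R : V →ₗ[ℂ] Module.End ℂ (Fsec U α)) (z : V) : ℕ → Fsec U α → (T.W → merFun U) → Prop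
  | 0, _, _ => True
  | N + 1, m, φ => (∀ w, (m w).1 z = (φ w).1 z) ∧
      ∀ v, JetEq R z N (R v m) fun w => derivEnd U v (φ w)

variable {R : V →ₗ[ℂ] Module.End ℂ (Fsec U α)} {z : V}

lemma JetEq.of_succ {N : ℕ} {m : Fsec U α} {φ : T.W → merFun U} (h : JetEq R z (N + 1) m φ) :
    JetEq R z N m φ := by
  induction N generalizing m φ with
  | zero => trivial
  | succ N ih => exact ⟨h.1, fun v => ih (h.2 v)⟩

lemma JetEq.mono {N N' : ℕ} (hN : N ≤ N') {m : Fsec U α} {φ : T.W → merFun U}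
    (h : JetEq R z N' m φ) : JetEq R z N m φ := by
  induction N', hN using Nat.le_induction with
  | base => exact h
  | succ k _ ih => exact ih h.of_succ

lemma JetEq.add {N : ℕ} {m m' : Fsec U α} {φ φ' : T.W → merFun U} (h : JetEq R z N m φ)
    (h' : JetEq R z N m' φ') : JetEq R z N (m + m') fun w => φ w + φ' w := by
  induction N generalizing m m' φ φ' with
  | zero => trivial
  | succ N ih =>
    refine ⟨fun w => ?_, fun v => ?_⟩
    · rw [Pi.add_apply, Submodule.coe_add, Submodule.coe_add, Pi.add_apply, Pi.add_apply, h.1 w,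
        h'.1 w]
    · simp only [map_add]
      exact ih (h.2 v) (h'.2 v)

lemma JetEq.smul {N : ℕ} {m : Fsec U α} {φ : T.W → merFun U} (c : ℂ) (h : JetEq R z N m φ) :
    JetEq R z N (c • m) fun w => c • φ w := by
  induction N generalizing m φ with
  | zero => trivial
  | succ N ih =>
    refine ⟨fun w => ?_, fun v => ?_⟩
    · rw [Pi.smul_apply, Submodule.coe_smul, Submodule.coe_smul, Pi.smul_apply, Pi.smul_apply,
        h.1 w]
    · simp only [map_smul]
      exact ih (h.2 v)

/-- The operators R v and ∂_v obey the same Leibniz rule, so multiplication preserves agreement of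
jets without loss of order. -/
lemma JetEq.secMul (hR : IsFlatAction R) {N : ℕ} {m : Fsec U α} {φ : T.W → merFun U}
    (f : regFun U) (h : JetEq R z N m φ) :
    JetEq R z N (secMul U α f m) fun w => mulEnd U f (φ w) := by
  induction N generalizing m φ f with
  | zero => trivial
  | succ N ih =>
    refine ⟨fun w => ?_, fun v => ?_⟩
    · rw [secMul_apply, h.1 w]
      rfl
    · simp only [hR.leibniz, derivEnd_mulEnd]
      exact (ih _ h.of_succ).add (ih _ (h.2 v))

/-- Pairs of a differential operator on functions and the corresponding operator on sections
of `F`. -/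
def pairAlg (R : V →ₗ[ℂ] Module.End ℂ (Fsec U α)) :
    Subalgebra ℂ (Module.End ℂ (merFun U) × Module.End ℂ (Fsec U α)) :=
  Algebra.adjoin ℂ (Set.range (fun f => (mulEnd U f, TorusAction.secMul U α f)) ∪
    Set.range fun v => (derivEnd U v, R v))

/-- Each derivation costs one order of the jet. The total loss d depends on the pair alone, not on
the point, the section or N. -/
lemma exists_jetEq_of_mem_pairAlg (hR : IsFlatAction R)
    {x : Module.End ℂ (merFun U) × Module.End ℂ (Fsec U α)} (hx : x ∈ pairAlg R) :
    ∃ d, ∀ N z m φ, JetEq R z (N + d) m φ → JetEq R z N (x.2 m) fun w => x.1 (φ w) := by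
  induction hx using Algebra.adjoin_induction with
  | mem x hx =>
    rcases hx with ⟨f, rfl⟩ | ⟨v, rfl⟩
    · exact ⟨0, fun N z m φ h => h.secMul hR f⟩
    · exact ⟨1, fun N z m φ h => h.2 v⟩
  | algebraMap r =>
    refine ⟨0, fun N z m φ h => ?_⟩
    simp only [Algebra.algebraMap_eq_smul_one, Prod.smul_fst, Prod.smul_snd, Prod.fst_one,
      Prod.snd_one, LinearMap.smul_apply, Module.End.one_apply]
    exact h.smul r
  | add x y _ _ hx hy =>
    obtain ⟨d, hd⟩ := hx
    obtain ⟨e, he⟩ := hy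
    exact ⟨max d e, fun N z m φ h => (hd N z m φ (h.mono (by omega))).add
      (he N z m φ (h.mono (by omega)))⟩
  | mul x y _ _ hx hy =>
    obtain ⟨d, hd⟩ := hx
    obtain ⟨e, he⟩ := hy
    exact ⟨d + e, fun N z m φ h => hd N z _ _ (he (N + d) z m φ (by rwa [add_assoc]))⟩

/-- Expanding one factor R x in a basis exhibits the term as a polynomial in x and supports
induction on the degree. -/
lemma taylorTerm_succ (z₀ : V) (k : ℕ) (m : Fsec U α) (w : T.W) (x : V) :
    taylorTerm R z₀ (k + 1) m w x =
      ∑ i, (Module.finBasis ℂ V).repr x i * taylorTerm R z₀ k (R (Module.finBasis ℂ V i) m) w x := by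
  have h : R x m =
      ∑ i, (Module.finBasis ℂ V).repr x i • R (Module.finBasis ℂ V i) m := by
    conv_lhs => rw [← (Module.finBasis ℂ V).sum_repr x, map_sum, LinearMap.sum_apply]
    simp only [map_smul, LinearMap.smul_apply]
  simp only [taylorTerm]
  rw [pow_succ, Module.End.mul_apply, h, map_sum, Finset.sum_apply, Submodule.coe_sum,
    Finset.sum_apply]
  refine Finset.sum_congr rfl fun i _ => ?_
  rw [map_smul]
  rfl

lemma analyticAt_repr (i : Fin (Module.finrank ℂ V)) (x : V) :
    AnalyticAt ℂ (fun x => (Module.finBasis ℂ V).repr x i) x :=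
  ((Module.finBasis ℂ V).coord i).toContinuousLinearMap.analyticAt x

lemma fderiv_repr (i : Fin (Module.finrank ℂ V)) (x v : V) :
    fderiv ℂ (fun x => (Module.finBasis ℂ V).repr x i) x v = (Module.finBasis ℂ V).repr v i := by
  have h : HasFDerivAt (fun x => (Module.finBasis ℂ V).repr x i)
      ((Module.finBasis ℂ V).coord i).toContinuousLinearMap x :=
    ((Module.finBasis ℂ V).coord i).toContinuousLinearMap.hasFDerivAt
  rw [h.fderiv]
  rfl

lemma analyticAt_taylorTerm (z₀ : V) (k : ℕ) (m : Fsec U α) (w : T.W) (x : V) :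
    AnalyticAt ℂ (taylorTerm R z₀ k m w) x := by
  induction k generalizing m with
  | zero => exact (analyticAt_const : AnalyticAt ℂ (fun _ : V => (m w).1 z₀) x)
  | succ k ih =>
    have h : taylorTerm R z₀ (k + 1) m w = _ := funext (taylorTerm_succ z₀ k m w)
    rw [h]
    exact Finset.analyticAt_fun_sum _ fun i _ => (analyticAt_repr i x).mul (ih _)

/-- Flatness enters here: only because the operators commute can the differentiated factor be moved
next to m in every position. At k = 0 the truncated k - 1 is harmless, being multiplied by 0. -/
lemma fderiv_taylorTerm (hR : IsFlatAction R) (z₀ : V) (k : ℕ) (m : Fsec U α) (w : T.W) (x v : V) :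
    fderiv ℂ (taylorTerm R z₀ k m w) x v = k * taylorTerm R z₀ (k - 1) (R v m) w x := by
  induction k generalizing m with
  | zero =>
    have : taylorTerm R z₀ 0 m w = fun _ => (m w).1 z₀ := rfl
    simp [this]
  | succ k ih =>
    have hcomm (i) : R v (R (Module.finBasis ℂ V i) m) = R (Module.finBasis ℂ V i) (R v m) :=
      LinearMap.congr_fun (hR.comm _ _) m
    have hd : fderiv ℂ (taylorTerm R z₀ (k + 1) m w) x v =
        ∑ i, ((Module.finBasis ℂ V).repr v i *
            taylorTerm R z₀ k (R (Module.finBasis ℂ V i) m) w x +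
          (Module.finBasis ℂ V).repr x i *
            (k * taylorTerm R z₀ (k - 1) (R (Module.finBasis ℂ V i) (R v m)) w x)) := by
      rw [funext (taylorTerm_succ z₀ k m w), fderiv_fun_sum fun i _ =>
        ((analyticAt_repr i x).fun_mul (analyticAt_taylorTerm z₀ k _ w x)).differentiableAt,
        sum_apply]
      refine Finset.sum_congr rfl fun i _ => ?_
      rw [← hcomm, ← ih, ← fderiv_repr i x v]
      exact fderiv_mul_apply (analyticAt_repr i x) (analyticAt_taylorTerm z₀ k _ w x) v
    have h1 : ∑ i, (Module.finBasis ℂ V).repr v i *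
        taylorTerm R z₀ k (R (Module.finBasis ℂ V i) m) w x = taylorTerm R z₀ k (R v m) w x := by
      have h : R v m =
          ∑ i, (Module.finBasis ℂ V).repr v i • R (Module.finBasis ℂ V i) m := by
        conv_lhs => rw [← (Module.finBasis ℂ V).sum_repr v, map_sum, LinearMap.sum_apply]
        simp only [map_smul, LinearMap.smul_apply]
      simp only [taylorTerm]
      rw [h, map_sum, Finset.sum_apply, Submodule.coe_sum, Finset.sum_apply]
      refine Finset.sum_congr rfl fun i _ => ?_
      rw [map_smul]
      rfl
    have h2 : ∑ i, (Module.finBasis ℂ V).repr x i *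
        (k * taylorTerm R z₀ (k - 1) (R (Module.finBasis ℂ V i) (R v m)) w x) =
        k * taylorTerm R z₀ k (R v m) w x := by
      cases k with
      | zero => simp
      | succ k =>
        rw [taylorTerm_succ z₀ k (R v m), Finset.mul_sum]
        exact Finset.sum_congr rfl fun i _ => by rw [Nat.add_sub_cancel]; ring
    rw [hd, Finset.sum_add_distrib, h1, h2, Nat.add_sub_cancel]
    push_cast
    ring

lemma analyticAt_taylorTerm_sub (z₀ : V) (k : ℕ) (m : Fsec U α) (w : T.W) (z : V) :
    AnalyticAt ℂ (fun z => taylorTerm R z₀ k m w (z - z₀)) z :=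
  AnalyticAt.fun_comp (g := taylorTerm R z₀ k m w) (f := fun z => z - z₀)
    (analyticAt_taylorTerm z₀ k m w (z - z₀)) (analyticAt_id.sub analyticAt_const)

lemma analyticAt_taylorPoly (z₀ : V) (N : ℕ) (m : Fsec U α) (w : T.W) (z : V) :
    AnalyticAt ℂ (taylorPoly R z₀ N m w) z :=
  Finset.analyticAt_fun_sum _ fun k _ =>
    analyticAt_const.mul (analyticAt_taylorTerm_sub z₀ k m w z)

lemma fderiv_taylorPoly (hR : IsFlatAction R) (z₀ : V) (N : ℕ) (m : Fsec U α) (w : T.W)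
    (z v : V) : fderiv ℂ (taylorPoly R z₀ (N + 1) m w) z v = taylorPoly R z₀ N (R v m) w z := by
  have hd (k : ℕ) : fderiv ℂ (fun z => (k.factorial : ℂ)⁻¹ * taylorTerm R z₀ k m w (z - z₀)) z v =
      (k.factorial : ℂ)⁻¹ * (k * taylorTerm R z₀ (k - 1) (R v m) w (z - z₀)) := by
    rw [fderiv_const_mul (analyticAt_taylorTerm_sub z₀ k m w z).differentiableAt, smul_apply,
      fderiv_comp_sub, fderiv_taylorTerm hR]
    rfl
  have hsum : fderiv ℂ (taylorPoly R z₀ (N + 1) m w) z v = ∑ k ∈ Finset.range (N + 1),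
      (k.factorial : ℂ)⁻¹ * (k * taylorTerm R z₀ (k - 1) (R v m) w (z - z₀)) := by
    have h : taylorPoly R z₀ (N + 1) m w = fun z => ∑ k ∈ Finset.range (N + 1),
      (k.factorial : ℂ)⁻¹ * taylorTerm R z₀ k m w (z - z₀) := rfl
    rw [h, fderiv_fun_sum fun k _ => (analyticAt_const.fun_mul
      (analyticAt_taylorTerm_sub z₀ k m w z)).differentiableAt, sum_apply]
    exact Finset.sum_congr rfl fun k _ => hd k
  rw [hsum, Finset.sum_range_succ', taylorPoly]
  simp only [Nat.cast_zero, zero_mul, mul_zero, add_zero, Nat.add_sub_cancel]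
  refine Finset.sum_congr rfl fun k _ => ?_
  rw [Nat.factorial_succ]
  have := Nat.cast_ne_zero (R := ℂ).2 k.factorial_ne_zero
  have := Nat.cast_ne_zero (R := ℂ).2 k.succ_ne_zero
  push_cast at *
  field_simp

/-- The derivative along v of the Taylor polynomial of m is that of R v m with one degree less, so
induction compares all jets. -/
lemma jetEq_taylorPoly (hR : IsFlatAction R) {z₀ : V} (hz₀ : z₀ ∈ dom U) (N : ℕ) (m : Fsec U α) :
    JetEq R z₀ N m fun w =>
      ⟨cut U (taylorPoly R z₀ N m w), cut_mem_merFun_of_analyticAt U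
        (analyticAt_taylorPoly z₀ N m w)⟩ := by
  induction N generalizing m with
  | zero => trivial
  | succ N ih =>
    refine ⟨fun w => ?_, fun v => ?_⟩
    · change _ = cut U _ z₀
      rw [cut, Set.indicator_of_mem hz₀, taylorPoly_self]
    · convert ih (R v m) using 2 with w
      refine Subtype.ext (funext fun z => ?_)
      change derivFun U v _ z = cut U _ z
      by_cases hz : z ∈ dom U
      · have he : cut U (taylorPoly R z₀ (N + 1) m w) =ᶠ[𝓝 z] taylorPoly R z₀ (N + 1) m w := by
          filter_upwards [(isOpen_dom U).mem_nhds hz] with y hy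
          exact Set.indicator_of_mem hy _
        rw [derivFun, if_pos hz, cut, Set.indicator_of_mem hz, he.fderiv_eq,
          fderiv_taylorPoly hR]
      · rw [derivFun, if_neg hz, cut, Set.indicator_of_notMem hz]

/-- The operator on sections of `F` is determined by the values of the corresponding operator on
entire functions. -/
lemma eq_of_mem_pairAlg (hR : IsFlatAction R) {P P' : Module.End ℂ (merFun U)}
    {Q Q' : Module.End ℂ (Fsec U α)} (hPQ : (P, Q) ∈ pairAlg R) (hPQ' : (P', Q') ∈ pairAlg R)
    (h : ∀ (q : V → ℂ) (hq : ∀ z, AnalyticAt ℂ q z),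
      P ⟨cut U q, cut_mem_merFun_of_analyticAt U hq⟩ =
        P' ⟨cut U q, cut_mem_merFun_of_analyticAt U hq⟩) : Q = Q' := by
  obtain ⟨d, hd⟩ := exists_jetEq_of_mem_pairAlg hR hPQ
  obtain ⟨e, he⟩ := exists_jetEq_of_mem_pairAlg hR hPQ'
  refine LinearMap.ext fun m => Fsec_ext fun w z hz => ?_
  -- One order for the value at z, plus the orders d and e lost by the two pairs.
  have hm := jetEq_taylorPoly hR hz (1 + (d + e)) m
  have h1 := (hd 1 z m _ (hm.mono (by omega))).1 w
  have h2 := (he 1 z m _ (hm.mono (by omega))).1 w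
  have h3 := h _ (analyticAt_taylorPoly (R := R) z (1 + (d + e)) m w)
  exact h1.trans ((congrArg (fun φ : merFun U => φ.1 z) h3).trans h2.symm)

end Jets

end TorusAction

namespace TorusAction

open Filter

variable {V : Type*} [NormedAddCommGroup V] [NormedSpace ℂ V] {T : TorusAction V}

/-! ### Representations of the crossed product from flat equivariant actions. -/

section Representation

variable {U U' : T.InvOpen} {α : AntiDual V}

lemma cut_cut (h : U'.carrier ⊆ U.carrier) (f : V → ℂ) : cut U' (cut U f) = cut U' f := by
  ext z
  by_cases hz : z ∈ dom U'
  · rw [cut, cut, cut, Set.indicator_of_mem hz, Set.indicator_of_mem hz,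
      Set.indicator_of_mem (show z ∈ dom U from ⟨h hz.1, hz.2⟩)]
  · exact (Set.indicator_of_notMem hz _).trans (Set.indicator_of_notMem hz _).symm

lemma Fres_apply (h : U'.carrier ⊆ U.carrier) (β : Fsec U α) (w : T.W) {z : V}
    (hz : z ∈ dom U') : (Fres h β w).1 z = (β w).1 z := Set.indicator_of_mem hz _

lemma conj_mul_conj {A : Type*} [Monoid A] {a a' : A} (h : a' * a = 1) (x y : A) :
    a * x * a' * (a * y * a') = a * (x * y) * a' := by
  calc _ = a * x * (a' * a) * y * a' := by simp only [mul_assoc]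
    _ = _ := by rw [h, mul_one]; simp only [mul_assoc]

lemma conj_mem_adjoin {A B : Type*} [Semiring A] [Algebra ℂ A] [Semiring B] [Algebra ℂ B]
    {s : Set (A × B)} {a a' : A} {b b' : B} (ha : a * a' = 1) (ha' : a' * a = 1)
    (hb : b * b' = 1) (hb' : b' * b = 1)
    (hs : ∀ x ∈ s, (a * x.1 * a', b * x.2 * b') ∈ Algebra.adjoin ℂ s) {x : A × B}
    (hx : x ∈ Algebra.adjoin ℂ s) : (a * x.1 * a', b * x.2 * b') ∈ Algebra.adjoin ℂ s := by
  induction hx using Algebra.adjoin_induction with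
  | mem x hx => exact hs x hx
  | algebraMap r =>
    convert (Algebra.adjoin ℂ s).algebraMap_mem r using 1
    refine Prod.ext ?_ ?_
    · change a * algebraMap ℂ A r * a' = algebraMap ℂ A r
      rw [← Algebra.commutes, mul_assoc, ha, mul_one]
    · change b * algebraMap ℂ B r * b' = algebraMap ℂ B r
      rw [← Algebra.commutes, mul_assoc, hb, mul_one]
  | add x y _ _ hx hy =>
    simpa only [Prod.fst_add, Prod.snd_add, mul_add, add_mul, Prod.mk_add_mk] using add_mem hx hy
  | mul x y _ _ hx hy =>
    simpa only [Prod.fst_mul, Prod.snd_mul, Prod.mk_mul_mk, conj_mul_conj ha',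
      conj_mul_conj hb'] using mul_mem hx hy

variable [FiniteDimensional ℂ V] {R : V →ₗ[ℂ] Module.End ℂ (Fsec U α)}

lemma exists_mem_pairAlg (R : V →ₗ[ℂ] Module.End ℂ (Fsec U α)) (P : diffOps U) :
    ∃ Q, (P.1, Q) ∈ pairAlg R := by
  obtain ⟨P, hP⟩ := P
  induction hP using Algebra.adjoin_induction with
  | mem x hx =>
    rcases hx with ⟨f, rfl⟩ | ⟨v, rfl⟩
    · exact ⟨secMul U α f, Algebra.subset_adjoin (Or.inl ⟨f, rfl⟩)⟩
    · exact ⟨R v, Algebra.subset_adjoin (Or.inr ⟨v, rfl⟩)⟩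
  | algebraMap r => exact ⟨algebraMap ℂ _ r, (pairAlg R).algebraMap_mem r⟩
  | add x y _ _ hx hy =>
    obtain ⟨Q, hQ⟩ := hx
    obtain ⟨Q', hQ'⟩ := hy
    exact ⟨Q + Q', add_mem hQ hQ'⟩
  | mul x y _ _ hx hy =>
    obtain ⟨Q, hQ⟩ := hx
    obtain ⟨Q', hQ'⟩ := hy
    exact ⟨Q * Q', mul_mem hQ hQ'⟩

/-- The action of differential operators on sections of `F`. -/
def repFun (R : V →ₗ[ℂ] Module.End ℂ (Fsec U α)) (P : diffOps U) : Module.End ℂ (Fsec U α) :=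
  (exists_mem_pairAlg R P).choose

lemma mem_pairAlg_repFun (R : V →ₗ[ℂ] Module.End ℂ (Fsec U α)) (P : diffOps U) :
    (P.1, repFun R P) ∈ pairAlg R := (exists_mem_pairAlg R P).choose_spec

/-- This says that `pairAlg` is the graph of a function; the homomorphism laws then hold because it
is a subalgebra. -/
lemma repFun_eq (hR : IsFlatAction R) {P : diffOps U} {Q : Module.End ℂ (Fsec U α)}
    (h : (P.1, Q) ∈ pairAlg R) : repFun R P = Q :=
  eq_of_mem_pairAlg hR (mem_pairAlg_repFun R P) h fun _ _ => rfl

/-- The action of differential operators on sections of `F`, as a homomorphism. -/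
def repHom (hR : IsFlatAction R) : diffOps U →ₐ[ℂ] Module.End ℂ (Fsec U α) where
  toFun := repFun R
  map_one' := repFun_eq hR (one_mem _)
  map_mul' P P' := repFun_eq hR (mul_mem (mem_pairAlg_repFun R P) (mem_pairAlg_repFun R P'))
  map_zero' := repFun_eq hR (zero_mem _)
  map_add' P P' := repFun_eq hR (add_mem (mem_pairAlg_repFun R P) (mem_pairAlg_repFun R P'))
  commutes' r := repFun_eq hR ((pairAlg R).algebraMap_mem r)

lemma repFun_mulOp (hR : IsFlatAction R) (f : regFun U) : repFun R (mulOp U f) = secMul U α f :=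
  repFun_eq hR (Algebra.subset_adjoin (Or.inl ⟨f, rfl⟩))

lemma repFun_derivOp (hR : IsFlatAction R) (v : V) : repFun R (derivOp U v) = R v :=
  repFun_eq hR (Algebra.subset_adjoin (Or.inr ⟨v, rfl⟩))

lemma secTranslate_mul_inv (U : T.InvOpen) (α : AntiDual V) (g : T.W) :
    secTranslate U α g * secTranslate U α g⁻¹ = 1 := by
  have := map_mul (secTranslateHom U α) g g⁻¹
  rw [mul_inv_cancel, map_one] at this
  exact this.symm

/-- Simultaneous conjugation by g permutes the generating pairs: f goes to its translate and v to g
v. -/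
lemma conj_mem_pairAlg (hS : ∀ (g : T.W) v, secTranslate U α g * R v =
      R (g • v) * secTranslate U α g) (g : T.W)
    {x : Module.End ℂ (merFun U) × Module.End ℂ (Fsec U α)} (hx : x ∈ pairAlg R) :
    (translate U g * x.1 * translate U g⁻¹,
      secTranslate U α g * x.2 * secTranslate U α g⁻¹) ∈ pairAlg R := by
  have h1 (g : T.W) : translate U g * translate U g⁻¹ = 1 := by
    rw [← translate_mul, mul_inv_cancel, translate_one]
  have h2 := h1 g⁻¹
  have h3 := secTranslate_mul_inv U α g⁻¹
  rw [inv_inv] at h2 h3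
  refine conj_mem_adjoin (h1 g) h2 (secTranslate_mul_inv U α g) h3 ?_ hx
  rintro _ (⟨f, rfl⟩ | ⟨v, rfl⟩)
  · have hf : (fun z => f.1 (g⁻¹ • z)) ∈ regFun U := translate_mem_sec g (LinearMap.zero_comp _) f.2
    refine Algebra.subset_adjoin (Or.inl ⟨⟨_, hf⟩, Prod.ext ?_ ?_⟩)
    · ext φ z
      simp [translate, mulEnd]
    · refine LinearMap.ext fun β => Fsec_ext fun w z _ => ?_
      change _ = (secTranslate U α g (secMul U α f (secTranslate U α g⁻¹ β)) w).1 z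
      rw [secTranslate_apply, secMul_apply, secMul_apply, secTranslate_apply, inv_inv,
        mul_inv_cancel_left, smul_inv_smul]
  · refine Algebra.subset_adjoin (Or.inr ⟨g • v, Prod.ext (translate_derivEnd g v).symm ?_⟩)
    change _ = secTranslate U α g * R v * secTranslate U α g⁻¹
    rw [hS, mul_assoc, secTranslate_mul_inv, mul_one]

lemma repFun_smul (hR : IsFlatAction R) (hS : ∀ (g : T.W) v, secTranslate U α g * R v =
      R (g • v) * secTranslate U α g) (g : T.W) (P : diffOps U) :
    repFun R (g • P) * secTranslate U α g = secTranslate U α g * repFun R P := by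
  have h3 := secTranslate_mul_inv U α g⁻¹
  rw [inv_inv] at h3
  have h : repFun R (g • P) = secTranslate U α g * repFun R P * secTranslate U α g⁻¹ :=
    repFun_eq hR (conj_mem_pairAlg hS g (mem_pairAlg_repFun R P))
  rw [h, mul_assoc, h3, mul_one]

/-- The representation of the crossed product on sections of `F`. -/
def crossedRep (hR : IsFlatAction R) (hS : ∀ (g : T.W) v, secTranslate U α g * R v =
      R (g • v) * secTranslate U α g) : Crossed U →ₐ[ℂ] Module.End ℂ (Fsec U α) :=
  SkewMonoidAlgebra.liftNCAlgHom (repHom hR) (secTranslateHom U α)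
    fun {P g} => repFun_smul hR hS g P

lemma crossedRep_single (hR : IsFlatAction R) (hS : ∀ (g : T.W) v, secTranslate U α g * R v =
      R (g • v) * secTranslate U α g) (g : T.W) (P : diffOps U) :
    crossedRep hR hS (SkewMonoidAlgebra.single g P) = repFun R P * secTranslate U α g :=
  SkewMonoidAlgebra.liftNC_single _ _ _ _

/-- Homomorphisms from the crossed product are determined on generators. -/
lemma crossed_algHom_ext {A : Type*} [Ring A] [Algebra ℂ A] {ρ ρ' : Crossed U →ₐ[ℂ] A}
    (hW : ∀ g, ρ (SkewMonoidAlgebra.single g 1) = ρ' (SkewMonoidAlgebra.single g 1))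
    (hf : ∀ f, ρ (SkewMonoidAlgebra.single 1 (mulOp U f)) =
      ρ' (SkewMonoidAlgebra.single 1 (mulOp U f)))
    (hv : ∀ v, ρ (SkewMonoidAlgebra.single 1 (derivOp U v)) =
      ρ' (SkewMonoidAlgebra.single 1 (derivOp U v))) : ρ = ρ' := by
  have h1 (P : diffOps U) :
      ρ (SkewMonoidAlgebra.single 1 P) = ρ' (SkewMonoidAlgebra.single 1 P) := by
    obtain ⟨P, hP⟩ := P
    induction hP using Algebra.adjoin_induction with
    | mem x hx =>
      rcases hx with ⟨f, rfl⟩ | ⟨v, rfl⟩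
      · exact hf f
      · exact hv v
    | algebraMap r =>
      have h : SkewMonoidAlgebra.single (1 : T.W) (algebraMap ℂ (diffOps U) r) =
          algebraMap ℂ (Crossed U) r := by
        rw [SkewMonoidAlgebra.coe_algebraMap]
        rfl
      exact (congrArg ρ h).trans ((ρ.commutes r).trans
        ((ρ'.commutes r).symm.trans (congrArg ρ' h).symm))
    | add x y hx hy ihx ihy =>
      have h : SkewMonoidAlgebra.single (1 : T.W) ((⟨x, hx⟩ : diffOps U) + ⟨y, hy⟩) =
        SkewMonoidAlgebra.single 1 ⟨x, hx⟩ + SkewMonoidAlgebra.single 1 ⟨y, hy⟩ :=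
        SkewMonoidAlgebra.single_add _ _ _
      have h' := congrArg₂ (· + ·) ihx ihy
      simp only [← map_add, ← h] at h'
      exact h'
    | mul x y hx hy ihx ihy =>
      have h : SkewMonoidAlgebra.single (1 : T.W) (⟨x, hx⟩ : diffOps U) *
          SkewMonoidAlgebra.single 1 ⟨y, hy⟩ =
          SkewMonoidAlgebra.single 1 ((⟨x, hx⟩ : diffOps U) * ⟨y, hy⟩) := by
        rw [SkewMonoidAlgebra.single_mul_single, one_smul, one_mul]
      have h' := congrArg₂ (· * ·) ihx ihy
      simp only [← map_mul, h] at h'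
      exact h'
  refine AlgHom.ext fun x => ?_
  induction x using SkewMonoidAlgebra.induction_on with
  | zero => rw [map_zero, map_zero]
  | single g P =>
    have h : SkewMonoidAlgebra.single g P =
        SkewMonoidAlgebra.single (1 : T.W) P * SkewMonoidAlgebra.single g 1 := by
      rw [SkewMonoidAlgebra.single_mul_single, one_smul, one_mul, mul_one]
    rw [h, map_mul, map_mul, h1, hW]
  | add x y hx hy => rw [map_add, map_add, hx, hy]

/-- Both components of a pair are restricted at once, so that the result is again a pair in the
algebra over the smaller set. -/
lemma exists_restriction_mem_pairAlg (h : U'.carrier ⊆ U.carrier)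
    {R' : V →ₗ[ℂ] Module.End ℂ (Fsec U' α)} (hres : ∀ v β, R' v (Fres h β) = Fres h (R v β))
    {x : Module.End ℂ (merFun U) × Module.End ℂ (Fsec U α)} (hx : x ∈ pairAlg R) :
    ∃ y ∈ pairAlg R', (∀ φ : merFun U,
        (y.1 ⟨cut U' φ.1, cut_mem h φ.2⟩).1 = cut U' (x.1 φ).1) ∧
      ∀ β, y.2 (Fres h β) = Fres h (x.2 β) := by
  induction hx using Algebra.adjoin_induction with
  | mem x hx =>
    rcases hx with ⟨f, rfl⟩ | ⟨v, rfl⟩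
    · refine ⟨(mulEnd U' ⟨cut U' f.1, cut_mem_sec h f.2⟩,
        secMul U' α ⟨cut U' f.1, cut_mem_sec h f.2⟩),
        Algebra.subset_adjoin (Or.inl ⟨_, rfl⟩), fun φ => ?_, fun β => Fsec_ext fun w z hz => ?_⟩
      · ext z
        by_cases hz : z ∈ dom U' <;> simp [mulEnd, cut, hz]
      · rw [Fres_apply h _ _ hz, secMul_apply, secMul_apply, Fres_apply h _ _ hz]
        exact congrArg (· * _) (Set.indicator_of_mem hz _)
    · refine ⟨(derivEnd U' v, R' v), Algebra.subset_adjoin (Or.inr ⟨v, rfl⟩), fun φ => ?_,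
        fun β => hres v β⟩
      ext z
      by_cases hz : z ∈ dom U'
      · have hz' : z ∈ dom U := ⟨h hz.1, hz.2⟩
        have he : cut U' φ.1 =ᶠ[𝓝 z] φ.1 := by
          filter_upwards [(isOpen_dom U').mem_nhds hz] with y hy
          exact Set.indicator_of_mem hy _
        change derivFun U' v (cut U' φ.1) z = cut U' (derivFun U v φ.1) z
        have e : cut U' (derivFun U v φ.1) z = derivFun U v φ.1 z := Set.indicator_of_mem hz _
        rw [e, derivFun, derivFun, if_pos hz, if_pos hz']
        exact congrArg (fun L : V →L[ℂ] ℂ => L v) he.fderiv_eq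
      · exact (((derivEnd U' v) _).2.2 z hz).trans (Set.indicator_of_notMem hz _).symm
  | algebraMap r =>
    refine ⟨algebraMap ℂ _ r, (pairAlg R').algebraMap_mem r, fun φ => ?_,
      fun β => Fsec_ext fun w z hz => ?_⟩
    · ext z
      by_cases hz : z ∈ dom U' <;> simp [cut, hz, Algebra.algebraMap_eq_smul_one]
    · rw [Fres_apply h _ _ hz]
      change r * (Fres h β w).1 z = r * (β w).1 z
      rw [Fres_apply h _ _ hz]
  | add x y _ _ hx hy =>
    obtain ⟨x', hx', h1, h1'⟩ := hx
    obtain ⟨y', hy', h2, h2'⟩ := hy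
    refine ⟨x' + y', add_mem hx' hy', fun φ => ?_, fun β => Fsec_ext fun w z hz => ?_⟩
    · have e : cut U' ((x.1 + y.1) φ).1 = cut U' (x.1 φ).1 + cut U' (y.1 φ).1 :=
        Set.indicator_add _ _ _
      rw [Prod.fst_add, Prod.fst_add, e, ← h1, ← h2]
      rfl
    · rw [Fres_apply h _ _ hz, Prod.snd_add, Prod.snd_add, LinearMap.add_apply,
        LinearMap.add_apply, h1', h2', Pi.add_apply, Pi.add_apply, Submodule.coe_add,
        Submodule.coe_add, Pi.add_apply, Pi.add_apply, Fres_apply h _ _ hz, Fres_apply h _ _ hz]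
  | mul x y _ _ hx hy =>
    obtain ⟨x', hx', h1, h1'⟩ := hx
    obtain ⟨y', hy', h2, h2'⟩ := hy
    refine ⟨x' * y', mul_mem hx' hy', fun φ => ?_, fun β => ?_⟩
    · have e : y'.1 ⟨cut U' φ.1, cut_mem h φ.2⟩ = ⟨cut U' (y.1 φ).1, cut_mem h (y.1 φ).2⟩ :=
        Subtype.ext (h2 φ)
      change (x'.1 (y'.1 _)).1 = _
      rw [e]
      exact h1 (y.1 φ)
    · change x'.2 (y'.2 _) = Fres h (x.2 (y.2 β))
      rw [h2', h1']

lemma repFun_restriction (h : U'.carrier ⊆ U.carrier)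
    {R' : V →ₗ[ℂ] Module.End ℂ (Fsec U' α)} (hR' : IsFlatAction R')
    (hres : ∀ v β, R' v (Fres h β) = Fres h (R v β)) {P : diffOps U} {P' : diffOps U'}
    (hP : IsRestriction h P P') (β : Fsec U α) :
    repFun R' P' (Fres h β) = Fres h (repFun R P β) := by
  obtain ⟨⟨P'', Q⟩, hy, h1, h2⟩ := exists_restriction_mem_pairAlg h hres (mem_pairAlg_repFun R P)
  have hQ : repFun R' P' = Q := by
    -- `IsRestriction` controls P' only on functions restricted from U. Entire functions are among
    -- these, and they suffice for the comparison.
    refine eq_of_mem_pairAlg hR' (mem_pairAlg_repFun R' P') hy fun q hq => ?_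
    have e : (⟨cut U' q, cut_mem_merFun_of_analyticAt U' hq⟩ : merFun U') =
        ⟨cut U' (cut U q), cut_mem h (cut_mem_merFun_of_analyticAt U hq)⟩ :=
      Subtype.ext (cut_cut h q).symm
    rw [e]
    exact Subtype.ext ((hP ⟨_, cut_mem_merFun_of_analyticAt U hq⟩).trans
      (h1 ⟨_, cut_mem_merFun_of_analyticAt U hq⟩).symm)
  rw [hQ]
  exact h2 β

end Representation

/-! ### The Dunkl representation, its uniqueness and its compatibility with restriction. -/

section DunklRepresentation

variable [FiniteDimensional ℂ V] {U U' : T.InvOpen} {α : AntiDual V}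

lemma isFlatAction_dunklMap (hα : T.IsGeneric α) (D : T.FlatConnection) {C : T.S → ℂ}
    (hC : T.IsInvariant C) (U : T.InvOpen) : IsFlatAction (dunklMap hα D C U) :=
  ⟨dunklOp_comm hα D C hC, dunklOp_secMul hα D C⟩

/-- The Dunkl representation of the crossed product. -/
def dunklRep (hα : T.IsGeneric α) (D : T.FlatConnection) {C : T.S → ℂ} (hC : T.IsInvariant C)
    (U : T.InvOpen) : Crossed U →ₐ[ℂ] Module.End ℂ (Fsec U α) :=
  crossedRep (isFlatAction_dunklMap hα D hC U) (secTranslate_dunklOp hα D C hC)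

lemma dunklRep_single (hα : T.IsGeneric α) (D : T.FlatConnection) {C : T.S → ℂ}
    (hC : T.IsInvariant C) (U : T.InvOpen) (g : T.W) (P : diffOps U) :
    dunklRep hα D hC U (SkewMonoidAlgebra.single g P) =
      repFun (dunklMap hα D C U) P * secTranslate U α g := crossedRep_single _ _ _ _

lemma isDunklRep_dunklRep (hα : T.IsGeneric α) (D : T.FlatConnection) {C : T.S → ℂ}
    (hC : T.IsInvariant C) (U : T.InvOpen) : IsDunklRep α D C U (dunklRep hα D hC U) := by
  have hone : secTranslate U α 1 = 1 := map_one (secTranslateHom U α)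
  have hR := isFlatAction_dunklMap hα D hC U
  have hR1 : repFun (dunklMap hα D C U) 1 = 1 := map_one (repHom hR)
  refine ⟨fun g w β z => ?_, fun f w β z => ?_, fun v k β z hz => ?_⟩
  · rw [dunklRep_single, hR1, one_mul,
      secTranslate_apply, inv_mul_cancel_left]
  · rw [dunklRep_single, hone, mul_one, repFun_mulOp hR, secMul_apply]
  -- The connection form is constant, so its value at k⁻¹ z may be replaced by its value at 0, the
  -- one built into `dunklOp`.
  · rw [dunklRep_single, hone, mul_one, repFun_derivOp hR, finsum_eq_sum_of_fintype, nabla,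
      D.form_eq (k⁻¹ • z)]
    exact dunklOp_apply' hα D C v β k hz

lemma IsDunklRep.unique {D : T.FlatConnection} {C : T.S → ℂ}
    {ρ ρ' : Crossed U →ₐ[ℂ] Module.End ℂ (Fsec U α)} (h : IsDunklRep α D C U ρ)
    (h' : IsDunklRep α D C U ρ') : ρ = ρ' := by
  refine crossed_algHom_ext (A := Module.End ℂ (Fsec U α)) (fun g => ?_) (fun f => ?_) fun v => ?_
  · refine LinearMap.ext fun β => Fsec_ext fun w z _ => ?_
    have e := h.map_group g (g⁻¹ * w) β z
    have e' := h'.map_group g (g⁻¹ * w) β z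
    rw [mul_inv_cancel_left] at e e'
    exact e.trans e'.symm
  · exact LinearMap.ext fun β => Fsec_ext fun w z _ =>
      (h.map_function f w β z).trans (h'.map_function f w β z).symm
  · exact LinearMap.ext fun β => Fsec_ext fun w z hz =>
      (h.map_deriv v w β z hz).trans (h'.map_deriv v w β z hz).symm

lemma dunklOp_Fres (hα : T.IsGeneric α) (D : T.FlatConnection) (C : T.S → ℂ)
    (h : U'.carrier ⊆ U.carrier) (v : V) (β : Fsec U α) :
    dunklOp hα D C U' v (Fres h β) = Fres h (dunklOp hα D C U v β) := by
  refine Fsec_ext fun k z hz => ?_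
  have hz' : z ∈ dom U := ⟨h hz.1, hz.2⟩
  have he : (Fres h β k).1 =ᶠ[𝓝 z] (β k).1 := by
    filter_upwards [(isOpen_dom U').mem_nhds hz] with y hy
    exact Fres_apply h β k hy
  rw [Fres_apply h _ _ hz, dunklOp_apply hα D C _ _ _ hz, dunklOp_apply hα D C _ _ _ hz',
    he.fderiv_eq]
  simp only [Fres_apply h _ _ hz]

lemma secTranslate_Fres (h : U'.carrier ⊆ U.carrier) (g : T.W) (β : Fsec U α) :
    secTranslate U' α g (Fres h β) = Fres h (secTranslate U α g β) := by
  refine Fsec_ext fun k z hz => ?_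
  rw [Fres_apply h _ _ hz, secTranslate_apply, secTranslate_apply,
    Fres_apply h _ _ (smul_mem_dom g⁻¹ hz)]

lemma dunklRep_Fres (hα : T.IsGeneric α) (D : T.FlatConnection) {C : T.S → ℂ}
    (hC : T.IsInvariant C) (h : U'.carrier ⊆ U.carrier) {P : diffOps U} {P' : diffOps U'}
    (hP : IsRestriction h P P') (g : T.W) (β : Fsec U α) :
    dunklRep hα D hC U' (SkewMonoidAlgebra.single g P') (Fres h β) =
      Fres h (dunklRep hα D hC U (SkewMonoidAlgebra.single g P) β) := by
  rw [dunklRep_single, dunklRep_single, Module.End.mul_apply, Module.End.mul_apply,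
    secTranslate_Fres]
  exact repFun_restriction (R := dunklMap hα D C U) h (isFlatAction_dunklMap hα D hC U') (dunklOp_Fres hα D C h) hP _

end DunklRepresentation

end TorusAction

end

theorem proposition5p2 {V : Type*} [NormedAddCommGroup V] [NormedSpace ℂ V]
    [FiniteDimensional ℂ V] (T : TorusAction V) (α : TorusAction.AntiDual V)
    (hα : ∀ w : T.W, w ≠ 1 → TorusAction.dualAct w α - α ∉ T.dualLattice)
    (D : T.FlatConnection) (C : T.S → ℂ) (hC : T.IsInvariant C) :
    (∀ (w : T.W) (p : T.S),
      ∃! f : V → V →L[ℂ] ℂ, TorusAction.IsPolarSection (TorusAction.dualAct w α) p f) ∧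
    (∀ U : T.InvOpen,
      ∃! ρ : TorusAction.Crossed U →ₐ[ℂ] Module.End ℂ (TorusAction.Fsec U α),
        TorusAction.IsDunklRep α D C U ρ) ∧
    (∀ (U U' : T.InvOpen) (h : U'.carrier ⊆ U.carrier)
      (ρ : TorusAction.Crossed U →ₐ[ℂ] Module.End ℂ (TorusAction.Fsec U α))
      (ρ' : TorusAction.Crossed U' →ₐ[ℂ] Module.End ℂ (TorusAction.Fsec U' α)),
      TorusAction.IsDunklRep α D C U ρ → TorusAction.IsDunklRep α D C U' ρ' →
      ∀ (P : TorusAction.diffOps U) (P' : TorusAction.diffOps U'),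
        TorusAction.IsRestriction h P P' → ∀ (g : T.W) (β : TorusAction.Fsec U α),
          ρ' (SkewMonoidAlgebra.single g P') (TorusAction.Fres h β) =
            TorusAction.Fres h (ρ (SkewMonoidAlgebra.single g P) β)) := by
  refine ⟨fun w p => ?_, fun U => ?_, fun U U' h ρ ρ' hρ hρ' P P' hP g β => ?_⟩
  · have hw := (TorusAction.isGeneric_of_notMem_dualLattice hα).dualAct w
    exact ⟨_, TorusAction.isPolarSection_polarSection hw p,
      fun f hf => TorusAction.isPolarSection_unique hw hf
        (TorusAction.isPolarSection_polarSection hw p)⟩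
  · have hα' := TorusAction.isGeneric_of_notMem_dualLattice hα
    exact ⟨_, TorusAction.isDunklRep_dunklRep hα' D hC U,
      fun ρ hρ => hρ.unique (TorusAction.isDunklRep_dunklRep hα' D hC U)⟩
  · have hα' := TorusAction.isGeneric_of_notMem_dualLattice hα
    rw [hρ.unique (TorusAction.isDunklRep_dunklRep hα' D hC U),
      hρ'.unique (TorusAction.isDunklRep_dunklRep hα' D hC U')]
    exact TorusAction.dunklRep_Fres hα' D hC h hP g β
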